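/- Let $B=\mathbb{R}^2\times(-\infty,0)$, $\partial B\simeq\mathbb{R}^2$, and let $T>0$. Let $(\Gamma(t))_{t\in[0,T)}$ be a family of $C^2$ Jordan curves in $\mathbb{R}^2$ with counter-clockwise regular parametrizations $\gamma(t,\cdot)\colon\mathbb{R}/\mathbb{Z}\to\mathbb{R}^2$, where $\gamma\in C([0,T);C^2)\cap C^1([0,T);C)$. Denote by $\nu$ the outward unit normal of $\Gamma(t)$, by $\kappa$ its curvature (positive on circles), by $U=\partial_t\gamma\cdot\nu$ its normal velocity, by $\mathcal{L}(t)$ its length, and by $f_-,f_+$ the limits on $\Gamma(t)$ of a function $f$ from the enclosed and from the exterior side; put $\llbracket f\rrbracket=f_--f_+$. For a bounded field $u\colon\mathbb{R}^2\to\mathbb{R}^2$ let $$v_\parallel(x',x_3)=-\frac{x_3}{2\pi}\int_{\mathbb{R}^2}\frac{u(y)}{|(x',x_3)-(y,0)|^3}\,\mathrm{d}y\qquad(x_3<0)$$ be its harmonic extension to $B$, and let $\Lambda_{\mathrm{DN}}u=\partial_{x_3}v_\parallel|_{\partial B}$ be the Dirichlet-to-Neumann operator. Assume that the family evolves according to the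 ILLSS (inviscid Langmuir layer--Stokesian subfluid) model: for every $t\in[0,T)$ there are given a surface velocity $u=u(t)\colon\mathbb{R}^2\setminus\Gamma(t)\to\mathbb{R}^2$ and a surface pressure $p=p(t)\colon\mathbb{R}^2\setminus\Gamma(t)\to\mathbb{R}$, which are of class $C^1$ in $\mathbb{R}^2\setminus\Gamma(t)$ and continuous up to $\Gamma(t)$ from each of its two sides, with $|u(x)|,|p(x)|=\mathcal{O}(|x|^{-2})$ as $|x|\to\infty$ and $\int_B|\nabla v_\parallel|^2\,\mathrm{d}x<\infty$, such that $\partial_{x_3}v_\parallel$ extends continuously to $\partial B\setminus\Gamma(t)$ and $$\nabla p=-\Lambda_{\mathrm{DN}}u,\quad \nabla\cdot u=0\quad\text{in }\partial B\setminus\Gamma(t),\qquad \llbracket u\cdot\nu\rrbracket=0,\quad \llbracket p\rrbracket=\kappa,\quad U=u\cdot\nu\quad\text{on }\Gamma(t).$$ Then, for every $t\in[0,T)$, $u(t)\in L^2(\mathbb{R}^2)$, the norm $\|u\|_{\dot H^{1/2}(\mathbb{R}^2)}=\bigl\||k|^{1/2}\hat u(k)\bigr\|_{L^2(\mathbb{R}^2)}$,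 with $\hat u(k)=\int_{\mathbb{R}^2}u(x)e^{-ik\cdot x}\,\mathrm{d}x$ (in the $L^2$ sense), is finite, $\mathcal{L}$ is differentiable at $t$ (from the right if $t=0$), and $$\frac{\mathrm{d}}{\mathrm{d}t}\mathcal{L}(t)=-\frac{1}{(2\pi)^2}\|u(t)\|_{\dot H^{1/2}(\mathbb{R}^2)}^2 .$$ In particular the length is strictly decreasing unless the fluid is at rest: $\frac{\mathrm{d}}{\mathrm{d}t}\mathcal{L}(t)<0$ whenever $u(t)\not\equiv0$, and $\mathcal{L}(t)<\mathcal{L}(s)$ whenever $0\le s<t<T$ and $u(r)\not\equiv0$ for some $r\in[s,t]$. -/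

import Mathlib

open MeasureTheory Set Filter Topology
open scoped ENNReal FourierTransform

noncomputable section

namespace ILLSS

/-- The film `∂B ≃ ℝ²`, with its Euclidean structure. -/
abbrev Plane := EuclideanSpace ℝ (Fin 2)

/-- The complexified plane, in which Fourier transforms of vector fields take their values. -/
abbrev CPlane := EuclideanSpace ℂ (Fin 2)

/-! ### Geometry of a closed curve, parametrized by `ℝ/ℤ` (that is, `1`-periodically by `ℝ`) -/

/-- Unit tangent `τ = ∂ₓc / |∂ₓc|`. -/
def tangent (c : ℝ → Plane) (x : ℝ) : Plane := ‖deriv c x‖⁻¹ • deriv c x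

/-- Unit normal: the tangent rotated clockwise by a right angle, `ν = (τ₂, -τ₁)`.  It is the outward
normal when the curve is traversed counter-clockwise. -/
def normal (c : ℝ → Plane) (x : ℝ) : Plane := !₂[tangent c x 1, -tangent c x 0]

/-- Geometric curvature `κ = -(ν · ∂ₓ²c) / |∂ₓc|²`; it is `+1` on the unit circle. -/
def curvature (c : ℝ → Plane) (x : ℝ) : ℝ :=
  -(inner ℝ (normal c x) (deriv (deriv c) x)) / ‖deriv c x‖ ^ 2

/-- Length of the closed curve. -/
def length (c : ℝ → Plane) : ℝ := ∫ x in (0 : ℝ)..1, ‖deriv c x‖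

/-- `c` is a regular, counter-clockwise, `1`-periodic parametrization of a Jordan curve of class
`C²`; the curve itself is `Γ = range c`.  Counter-clockwise means that the enclosed signed area
`½ ∫ (c₁ c₂' - c₂ c₁')` is positive. -/
structure IsC2Jordan (c : ℝ → Plane) : Prop where
  contDiff : ContDiff ℝ 2 c
  periodic : Function.Periodic c 1
  regular : ∀ x, deriv c x ≠ 0
  injOn : InjOn c (Ico 0 1)
  ccw : 0 < ∫ x in (0 : ℝ)..1, (c x 0 * deriv c x 1 - c x 1 * deriv c x 0)

/-- `a` is the limit of `f` at the point `c x` of the curve from the enclosed side.  The limit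
is taken as `y → x` and `ε ↘ 0` jointly, so that existence of these limits for all `x` amounts to
continuity of `f` up to the curve from that side. -/
def HasInnerTrace {E : Type*} [TopologicalSpace E] (c : ℝ → Plane) (f : Plane → E) (x : ℝ) (a : E) :
    Prop :=
  Tendsto (fun q : ℝ × ℝ => f (c q.1 - q.2 • normal c q.1)) (𝓝 x ×ˢ 𝓝[>] 0) (𝓝 a)

/-- The same from the exterior side. -/
def HasOuterTrace {E : Type*} [TopologicalSpace E] (c : ℝ → Plane) (f : Plane → E) (x : ℝ) (a : E) :
    Prop :=
  Tendsto (fun q : ℝ × ℝ => f (c q.1 + q.2 • normal c q.1)) (𝓝 x ×ˢ 𝓝[>] 0) (𝓝 a)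

/-! ### Harmonic extension to the subfluid and the Dirichlet-to-Neumann operator -/

/-- The harmonic extension `v_∥` of `u` to the lower half-space `B = {(x', x₃) : x₃ < 0}`, given by
the Poisson integral `v(x', x₃) = -(x₃ / 2π) ∫ u(y) / |(x', x₃) - (y, 0)|³ dy`.  (The third
component of the velocity in the subfluid is the harmonic extension of `0`, hence `0`.) -/
def harmExt (u : Plane → Plane) (z : Plane × ℝ) : Plane :=
  (-z.2 / (2 * Real.pi)) • ∫ y, ((Real.sqrt (‖z.1 - y‖ ^ 2 + z.2 ^ 2)) ^ 3)⁻¹ • u y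

/-- The Dirichlet-to-Neumann operator at `x`: `w = (Λ_DN u)(x) = ∂_{x₃} v_∥ (x, 0)`, meaning that
the vertical derivative of the harmonic extension tends to `w` as one approaches `(x, 0)` from
within `B`. -/
def HasDtN (u : Plane → Plane) (x w : Plane) : Prop :=
  Tendsto (fun z : Plane × ℝ => deriv (fun s => harmExt u (z.1, s)) z.2) (𝓝 x ×ˢ 𝓝[<] 0) (𝓝 w)

/-- Dirichlet integral `∫_B |∇v|²` of the harmonic extension of `u`. -/
def dirichletEnergy (u : Plane → Plane) : ℝ≥0∞ :=
  ∫⁻ z in {z : Plane × ℝ | z.2 < 0},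
    ((∑ i : Fin 2, ‖fderiv ℝ (harmExt u) z (EuclideanSpace.single i 1, 0)‖ₑ ^ 2)
      + ‖fderiv ℝ (harmExt u) z (0, 1)‖ₑ ^ 2)

/-- Divergence of a planar vector field. -/
def divergence (u : Plane → Plane) (x : Plane) : ℝ :=
  ∑ i : Fin 2, fderiv ℝ u x (EuclideanSpace.single i 1) i

/-! ### The model -/

/-- `(u, p)` is a surface velocity and a surface pressure of the ILLSS model for the curve
`Γ = range c`, and `U x` is the resulting normal velocity of the curve at the point `c x`:
`∇p = -Λ_DN u` and `∇ · u = 0` off `Γ`, and `⟦u · ν⟧ = 0`, `⟦p⟧ = κ`, `U = u · ν` on `Γ`.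
The velocity may be discontinuous across `Γ`. -/
structure IsState (c : ℝ → Plane) (u : Plane → Plane) (p : Plane → ℝ) (U : ℝ → ℝ) : Prop where
  u_contDiffOn : ContDiffOn ℝ 1 u (range c)ᶜ
  p_contDiffOn : ContDiffOn ℝ 1 p (range c)ᶜ
  u_decay : u =O[Bornology.cobounded Plane] fun x => (‖x‖ ^ 2)⁻¹
  p_decay : p =O[Bornology.cobounded Plane] fun x => (‖x‖ ^ 2)⁻¹
  finite_energy : dirichletEnergy u < ∞
  momentum : ∀ x ∉ range c, HasDtN u x (-gradient p x)
  incompressible : ∀ x ∉ range c, divergence u x = 0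
  u_jump : ∃ ui uo : ℝ → Plane, (∀ x, HasInnerTrace c u x (ui x)) ∧
    (∀ x, HasOuterTrace c u x (uo x)) ∧
    (∀ x, inner ℝ (ui x) (normal c x) - inner ℝ (uo x) (normal c x) = 0) ∧
    (∀ x, U x = inner ℝ (ui x) (normal c x))
  p_jump : ∃ pi po : ℝ → ℝ, (∀ x, HasInnerTrace c p x (pi x)) ∧
    (∀ x, HasOuterTrace c p x (po x)) ∧
    (∀ x, pi x - po x = curvature c x)

/-- `∂ₜγ` on the time interval `[0, T)`, one-sided at `t = 0`. -/
def timeDeriv (T : ℝ) (γ : ℝ → ℝ → Plane) (t x : ℝ) : Plane :=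
  derivWithin (fun s => γ s x) (Ico 0 T) t

/-- `(Γ(t))`, `t ∈ [0, T)`, is a family of `C²` Jordan curves, parametrized by `γ t`, that evolves
by the ILLSS model with surface velocity `u t` and surface pressure `p t`.  In time and space `γ`
is of class `C([0,T); C²) ∩ C¹([0,T); C)`.  Only the normal component of `∂ₜγ` is prescribed; the
tangential one, which depends on the parametrization, is arbitrary. -/
structure IsEvolution (T : ℝ) (γ : ℝ → ℝ → Plane) (u : ℝ → Plane → Plane) (p : ℝ → Plane → ℝ) :
    Prop where
  jordan : ∀ t ∈ Ico 0 T, IsC2Jordan (γ t)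
  cont : ContinuousOn (fun q : ℝ × ℝ => γ q.1 q.2) (Ico 0 T ×ˢ univ)
  cont_deriv : ContinuousOn (fun q : ℝ × ℝ => deriv (γ q.1) q.2) (Ico 0 T ×ˢ univ)
  cont_deriv2 : ContinuousOn (fun q : ℝ × ℝ => deriv (deriv (γ q.1)) q.2) (Ico 0 T ×ˢ univ)
  diff_time : ∀ t ∈ Ico 0 T, ∀ x, DifferentiableWithinAt ℝ (fun s => γ s x) (Ico 0 T) t
  cont_time : ContinuousOn (fun q : ℝ × ℝ => timeDeriv T γ q.1 q.2) (Ico 0 T ×ˢ univ)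
  state : ∀ t ∈ Ico 0 T,
    IsState (γ t) (u t) (p t) (fun x => inner ℝ (timeDeriv T γ t x) (normal (γ t) x))

/-! ### The homogeneous Sobolev norm -/

/-- A real vector field, regarded as a complex one. -/
def complexify (u : Plane → Plane) (x : Plane) : CPlane :=
  WithLp.toLp 2 (fun i => (u x i : ℂ))

/-- The Fourier transform `û(k) = ∫ u(x) e^{-i k·x} dx` of an `L²` field.  Mathlib's transform has
the kernel `e^{-2πi ⟨x, ξ⟩}`, so that `û(k)` is its value at `ξ = k / 2π`. -/
def fourierHat (f : Lp CPlane 2 (volume : Measure Plane)) (k : Plane) : CPlane :=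
  (𝓕 f : Lp CPlane 2 (volume : Measure Plane)) ((2 * Real.pi)⁻¹ • k)

/-- The norm `‖f‖_{Ḣˢ(ℝ²)} = ‖ |k|ˢ f̂ ‖_{L²(ℝ²)}` of an `L²` field, with values in `[0, ∞]`. -/
def hDotNorm (s : ℝ) (f : Lp CPlane 2 (volume : Measure Plane)) : ℝ≥0∞ :=
  eLpNorm (fun k : Plane => (‖k‖ ^ s) • fourierHat f k) 2 volume

end ILLSS

end

/-! Three identities combine. The first variation of length is `L' = ∫_Γ κ U`. The energy balance is
`∫_B |∇v|² = -∫_Γ κ U`: viscous dissipation in the subfluid equals the work of line tension.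
Plancherel at each height followed by integration over the height gives `∫_B |∇v|² = (2π)⁻² ‖u‖²`
with the `Ḣ^{1/2}` norm. Finite length decay and strictness then follow because vanishing energy
forces `û = 0`. Plancherel (`dirichletEnergy_eq`, `hDotNorm_half_sq`) rests on the Poisson kernel
being the inverse Fourier transform of `e^{-2πh|ξ|}`, so that the harmonic extension is a
superposition of decaying plane waves. For the energy balance (`IsState.toReal_dirichletEnergy`) one
would like to test `Λu = -∇p` with `u`, but the equation holds only off `Γ`, where nothing controls
`∇p` up to the curve. The test field is `χₙ u`, with `χₙ` vanishing near `Γ` and near infinity.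
Write `P_h u` for the extension at depth `h`. The limit of `h⁻¹ ⟨u - P_h u, φ⟩` as `h → 0` is the
singular bilinear form `bform u φ`; for `φ = u` it is the Dirichlet energy, and for `φ = χₙ u` it is
also `∫ Λu · χₙ u = ∫ p ∇χₙ · u`, by incompressibility. As `n → ∞` the right side concentrates on
the two sides of `Γ` and tends to `-∫_Γ ⟦p⟧ u·ν`. On the left the cutoff is critical: slope `1/ε` on
a layer of area `O(ε)` costs an energy that stays bounded but need not vanish. Boundedness suffices
(`tendsto_bform_cutoff`), since the error is a product of this bounded quantity with a part of the
energy of `u` that disappears. For the first variation (`IsEvolution.hasDerivWithinAt_length`),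
`∂ₜγ` is merely continuous in space, so one cannot differentiate `|∂ₓγ|` in time. Convexity of the
norm instead encloses the length increment between two integrals from which integration by parts
removes the space derivative. -/

noncomputable section

/-! ### The inverse Fourier transform on `L¹ ∩ L²` -/

theorem Real.integral_fourierInv_smul_eq {V F : Type*} [NormedAddCommGroup V] [InnerProductSpace ℝ V]
    [FiniteDimensional ℝ V] [MeasurableSpace V] [BorelSpace V] [NormedAddCommGroup F]
    [NormedSpace ℂ F] [CompleteSpace F] {g : V → ℂ} {f : V → F}
    (hg : Integrable g) (hf : Integrable f) :
    ∫ x, 𝓕⁻ g x • f x = ∫ x, g x • 𝓕⁻ f x := by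
  have := VectorFourier.integral_fourierIntegral_smul_eq_flip (𝕜 := ℝ) (μ := volume) (ν := volume)
    (L := -innerₗ V) Real.continuous_fourierChar (by exact continuous_inner.neg) hg hf
  have hflip : (-innerₗ V).flip = -innerₗ V := by
    ext x y; simp [real_inner_comm]
  rw [hflip] at this
  exact this

/-- The abstract `L²` transform and the integral define the same tempered distribution: against a
smooth compactly supported, hence Schwartz, test function both can be moved onto the test function.
Local integrability then gives equality almost everywhere. -/
theorem MeasureTheory.Lp.fourierInv_toLp_ae {V F : Type*} [NormedAddCommGroup V]
    [InnerProductSpace ℝ V] [FiniteDimensional ℝ V] [MeasurableSpace V] [BorelSpace V]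
    [NormedAddCommGroup F] [InnerProductSpace ℂ F] [CompleteSpace F] {f : V → F}
    (h1 : Integrable f) (h2 : MemLp f 2) :
    (𝓕⁻ (h2.toLp f) : Lp F 2 (volume : Measure V)) =ᵐ[volume] 𝓕⁻ f := by
  let _ : NormedSpace ℝ F := NormedSpace.complexToReal
  refine ae_eq_of_integral_contDiff_smul_eq ((Lp.memLp _).locallyIntegrable (by norm_num))
    (VectorFourier.fourierIntegral_continuous Real.continuous_fourierChar
      (by exact continuous_inner.neg) h1).locallyIntegrable fun g hg hgs => ?_
  have hs : HasCompactSupport (fun x => (g x : ℂ)) := hgs.comp_left (g := fun r : ℝ => (r : ℂ)) rfl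
  have hd : ContDiff ℝ (⊤ : ℕ∞) (fun x => (g x : ℂ)) := Complex.ofRealCLM.contDiff.comp hg
  set G := hs.toSchwartzMap hd with hG
  have hGx : ∀ x, G x = (g x : ℂ) := fun x => rfl
  have key := Lp.fourierInv_toTemperedDistribution_eq (h2.toLp f)
  have key2 := DFunLike.congr_fun key G
  rw [TemperedDistribution.fourierInv_apply, Lp.toTemperedDistribution_apply,
    Lp.toTemperedDistribution_apply] at key2
  calc ∫ x, g x • (𝓕⁻ (h2.toLp f) : Lp F 2 (volume : Measure V)) x
      = ∫ x, G x • (𝓕⁻ (h2.toLp f) : Lp F 2 (volume : Measure V)) x := by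
        simp only [hGx, Complex.coe_smul]
    _ = ∫ x, (𝓕⁻ G) x • f x := by
        rw [← key2]
        refine integral_congr_ae ?_
        filter_upwards [h2.coeFn_toLp] with x hx
        rw [hx]
    _ = ∫ x, (𝓕⁻ (G : V → ℂ)) x • f x := by
        simp only [SchwartzMap.fourierInv_coe]
    _ = ∫ x, G x • 𝓕⁻ f x := Real.integral_fourierInv_smul_eq G.integrable h1
    _ = _ := by simp only [hGx, Complex.coe_smul]

/-! ### The Poisson kernel and its Fourier transform -/

open Real in
-- Cauchy–Schlömilch substitution `t = aμ - b/μ`: the exponent becomes `-t² - 2ab` and `dt = (a +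
-- b/μ²) dμ`. The involution `μ ↦ b/(aμ)` sends `t` to `-t` and shows that the two terms of this
-- Jacobian contribute equally to `∫ e^{-t²} dt = √π`.
theorem integral_exp_neg_sq_sub_div {a b : ℝ} (ha : 0 < a) (hb : 0 < b) :
    ∫ μ in Ioi (0:ℝ), exp (-(a ^ 2 * μ ^ 2) - b ^ 2 / μ ^ 2) = √π / (2 * a) * exp (-(2 * a * b)) := by
  set f : ℝ → ℝ := fun μ => a * μ - b / μ with hf
  set g : ℝ → ℝ := fun t => exp (-t ^ 2) with hg
  have hderiv : ∀ x ∈ Ioi (0:ℝ), HasDerivAt f (a + b / x ^ 2) x := by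
    intro x hx
    have hx' : x ≠ 0 := (mem_Ioi.1 hx).ne'
    have := ((hasDerivAt_id x).const_mul a).sub ((hasDerivAt_const x b).div (hasDerivAt_id x) hx')
    refine HasDerivAt.congr_deriv (f := f) this ?_
    simp
    ring
  have hinj : InjOn f (Ioi 0) := by
    apply StrictMonoOn.injOn
    intro x hx y hy hxy
    simp only [hf]
    have hx' : 0 < x := hx
    have := div_lt_div_of_pos_left hb hx' hxy
    nlinarith
  have himg : f '' Ioi 0 = univ := by
    refine eq_univ_of_forall fun t => ?_
    -- The positive root of `aμ² - tμ - b = 0`.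
    refine ⟨(t + √(t ^ 2 + 4 * a * b)) / (2 * a), ?_, ?_⟩
    · have : -t < √(t ^ 2 + 4 * a * b) := by
        rcases le_or_gt 0 t with h | h
        · have : 0 < √(t ^ 2 + 4 * a * b) := sqrt_pos.2 (by positivity)
          linarith
        · apply lt_sqrt_of_sq_lt; nlinarith [mul_pos ha hb]
      simp only [mem_Ioi]
      apply div_pos <;> linarith
    · have hs := sq_sqrt (show 0 ≤ t ^ 2 + 4 * a * b by positivity)
      set s := √(t ^ 2 + 4 * a * b)
      have : t + s ≠ 0 := by
        intro h
        have : s = -t := by linarith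
        rw [this] at hs
        nlinarith [mul_pos ha hb]
      simp only [hf]
      field_simp
      linear_combination hs
  have h1 := integral_image_eq_integral_abs_deriv_smul measurableSet_Ioi
    (fun x hx => (hderiv x hx).hasDerivWithinAt) hinj g
  have hint : IntegrableOn (fun x => |a + b / x ^ 2| • g (f x)) (Ioi 0) := by
    rw [← integrableOn_image_iff_integrableOn_abs_deriv_smul measurableSet_Ioi
      (fun x hx => (hderiv x hx).hasDerivWithinAt) hinj g, himg, integrableOn_univ]
    simpa [hg] using integrable_exp_neg_mul_sq one_pos
  rw [himg, setIntegral_univ] at h1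
  have h0 : ∫ x, g x = √π := by
    simpa [hg] using integral_gaussian 1
  -- the involution `μ ↦ b / (a μ)`
  set k : ℝ → ℝ := fun μ => b / (a * μ) with hk
  have hkd : ∀ x ∈ Ioi (0:ℝ), HasDerivWithinAt k (-(b / (a * x ^ 2))) (Ioi 0) x := by
    intro x hx
    have hx' : x ≠ 0 := (mem_Ioi.1 hx).ne'
    have := (hasDerivAt_const x b).div ((hasDerivAt_id x).const_mul a) (mul_ne_zero ha.ne' hx')
    refine (HasDerivAt.hasDerivWithinAt ?_)
    refine HasDerivAt.congr_deriv (f := k) this ?_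
    simp; field_simp
  have hkinj : InjOn k (Ioi 0) := by
    intro x hx y hy h
    have hx' : x ≠ 0 := (mem_Ioi.1 hx).ne'
    have hy' : y ≠ 0 := (mem_Ioi.1 hy).ne'
    simp only [hk] at h
    field_simp at h
    exact h.symm
  have hkimg : k '' Ioi 0 = Ioi 0 := by
    ext t
    constructor
    · rintro ⟨x, hx, rfl⟩
      have hx' : 0 < x := hx
      simp only [hk, mem_Ioi]; positivity
    · intro ht
      have ht' : 0 < t := ht
      refine ⟨b / (a * t), by simp only [mem_Ioi]; positivity, ?_⟩
      simp only [hk]; field_simp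
  have h2 := integral_image_eq_integral_abs_deriv_smul measurableSet_Ioi hkd hkinj (fun x => g (f x))
  rw [hkimg] at h2
  have h3 : ∀ x ∈ Ioi (0:ℝ), |-(b / (a * x ^ 2))| • g (f (k x)) = a⁻¹ * ((b / x ^ 2) * g (f x)) := by
    intro x hx
    have hx' : 0 < x := hx
    rw [abs_neg, abs_of_pos (by positivity)]
    have : f (k x) = - f x := by simp only [hf, hk]; field_simp; ring
    rw [this]
    simp only [hg, smul_eq_mul, neg_sq]
    field_simp
  rw [setIntegral_congr_fun measurableSet_Ioi h3, integral_const_mul] at h2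
  have h4 : ∀ x ∈ Ioi (0:ℝ), |a + b / x ^ 2| • g (f x) = a * g (f x) + (b / x ^ 2) * g (f x) := by
    intro x hx
    have hx' : 0 < x := hx
    rw [abs_of_pos (by positivity)]
    simp only [smul_eq_mul]; ring
  have hint1 : IntegrableOn (fun x => g (f x)) (Ioi 0) := by
    refine (Integrable.const_mul hint (a⁻¹)).mono' ?_ ?_
    · refine (ContinuousOn.aestronglyMeasurable ?_ measurableSet_Ioi)
      intro x hx
      exact ((by fun_prop : Continuous g).continuousAt.comp
        (hderiv x hx).continuousAt).continuousWithinAt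
    · filter_upwards [ae_restrict_mem measurableSet_Ioi] with x hx
      have hx' : 0 < x := hx
      rw [h4 x hx, norm_of_nonneg (by positivity), mul_add, ← mul_assoc, inv_mul_cancel₀ ha.ne',
        one_mul]
      simp only [le_add_iff_nonneg_right]
      positivity
  have hint2 : IntegrableOn (fun x => (b / x ^ 2) * g (f x)) (Ioi 0) := by
    have := Integrable.sub hint (Integrable.const_mul hint1 a)
    refine this.congr ?_
    filter_upwards [ae_restrict_mem measurableSet_Ioi] with x hx
    simp only [Pi.sub_apply]
    rw [h4 x hx]; ring
  rw [setIntegral_congr_fun measurableSet_Ioi h4, integral_add (hint1.const_mul a) hint2,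
    integral_const_mul] at h1
  have h5 : ∫ x in Ioi (0:ℝ), g (f x) = √π / (2 * a) := by
    rw [h0] at h1
    have h6 : ∫ x in Ioi (0:ℝ), b / x ^ 2 * g (f x) = a * ∫ x in Ioi (0:ℝ), g (f x) := by
      rw [h2, ← mul_assoc, mul_inv_cancel₀ ha.ne', one_mul]
    rw [h6] at h1
    rw [eq_div_iff (by positivity)]
    linarith
  have h6 : ∀ x ∈ Ioi (0:ℝ), exp (-(a ^ 2 * x ^ 2) - b ^ 2 / x ^ 2)
      = exp (-(2 * a * b)) * g (f x) := by
    intro x hx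
    have hx' : 0 < x := hx
    simp only [hg, hf, ← exp_add]
    congr 1
    field_simp
    ring
  rw [setIntegral_congr_fun measurableSet_Ioi h6, integral_const_mul, h5, mul_comm]

namespace ILLSS

/-- The Poisson kernel of the half-space of height variable `h > 0`, for a planar boundary. -/
def poisson (h : ℝ) (x : Plane) : ℝ := h / (2 * Real.pi) * ((Real.sqrt (‖x‖ ^ 2 + h ^ 2)) ^ 3)⁻¹

open Real in
theorem integrable_exp_neg_mul_norm {a : ℝ} (ha : 0 < a) :
    Integrable (fun ξ : Plane => exp (-(a * ‖ξ‖))) := by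
  have := (integrable_fun_norm_addHaar (volume : Measure Plane)
    (f := fun r => exp (-(a * r)))).2 ?_
  · exact this
  · have h := integrableOn_rpow_mul_exp_neg_mul_rpow (p := 1) (s := 1) (b := a) (by norm_num) one_pos ha
    refine h.congr_fun (fun x hx => ?_) measurableSet_Ioi
    simp

open Real in
-- Subordination: `e^{-2πh|ξ|}` is an integral over `μ` of Gaussians in `ξ`. After Fubini each
-- Gaussian is transformed explicitly, and the remaining `μ`-integral is a Gamma integral producing
-- the power `-3/2` of `|x|² + h²`.
theorem fourierInv_exp_neg_norm {h : ℝ} (hh : 0 < h) (x : Plane) :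
    𝓕⁻ (fun ξ : Plane => ((exp (-(2 * π * h * ‖ξ‖)) : ℝ) : ℂ)) x = (poisson h x : ℂ) := by
  set G : ℝ × Plane → ℝ := fun q => exp (-(h ^ 2 * q.1 ^ 2) - (π * ‖q.2‖) ^ 2 / q.1 ^ 2) with hG
  set E : Plane → ℂ := fun ξ => Complex.exp (2 * π * Complex.I * (inner ℝ x ξ : ℝ)) with hE
  have hEn : ∀ ξ, ‖E ξ‖ = 1 := by
    intro ξ
    have := Complex.norm_exp_ofReal_mul_I (2 * π * inner ℝ x ξ)
    rw [← this]
    simp only [hE]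
    congr 2
    push_cast; ring
  have hEc : Continuous E := by fun_prop
  have hGm : Measurable G := by fun_prop
  have hmu : ∀ μ ∈ Ioi (0:ℝ), ∀ (ξ : Plane), E ξ * (G (μ, ξ) : ℂ) =
      (exp (-(h ^ 2 * μ ^ 2)) : ℂ) * Complex.exp (-((π ^ 2 / μ ^ 2 : ℝ) : ℂ) * ‖ξ‖ ^ 2
        + (2 * π * Complex.I) * (inner ℝ x ξ : ℝ)) := by
    intro μ hμ ξ
    simp only [hE, hG]
    push_cast
    rw [← Complex.exp_add, ← Complex.exp_add]
    congr 1
    ring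
  have hb : ∀ μ ∈ Ioi (0:ℝ), 0 < π ^ 2 / μ ^ 2 := by
    intro μ hμ
    have : 0 < μ := hμ
    positivity
  have hre : ∀ μ ∈ Ioi (0:ℝ), 0 < ((π ^ 2 / μ ^ 2 : ℝ) : ℂ).re := by
    intro μ hμ
    rw [Complex.ofReal_re]; exact hb μ hμ
  have hint : ∀ μ ∈ Ioi (0:ℝ), Integrable (fun ξ => E ξ * (G (μ, ξ) : ℂ)) := by
    intro μ hμ
    simp_rw [hmu μ hμ]
    exact (GaussianFourier.integrable_cexp_neg_mul_sq_norm_add (hre μ hμ) _ _).const_mul _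
  have hval : ∀ μ ∈ Ioi (0:ℝ), ∫ ξ, E ξ * (G (μ, ξ) : ℂ) =
      ((π⁻¹ * (μ ^ (2:ℝ) * exp (-(‖x‖ ^ 2 + h ^ 2) * μ ^ (2:ℝ))) : ℝ) : ℂ) := by
    intro μ hμ
    have hμ' : 0 < μ := hμ
    simp_rw [hmu μ hμ]
    rw [integral_const_mul, GaussianFourier.integral_cexp_neg_mul_sq_norm_add (hre μ hμ)]
    have : ((Module.finrank ℝ Plane : ℂ) / 2) = 1 := by simp
    rw [this, Complex.cpow_one]
    have hμc : (μ : ℂ) ≠ 0 := by exact_mod_cast hμ'.ne'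
    have hπc : (π : ℂ) ≠ 0 := by exact_mod_cast pi_ne_zero
    have hexp : ((2:ℂ) * π * Complex.I) ^ 2 * ‖x‖ ^ 2 / (4 * (π ^ 2 / μ ^ 2)) = - (‖x‖ ^ 2 * μ ^ 2) := by
      rw [mul_pow, Complex.I_sq]
      field_simp
      ring
    push_cast
    rw [mul_left_comm, ← Complex.exp_add, hexp]
    simp only [rpow_two]
    have : -((h:ℂ) ^ 2 * μ ^ 2) + -(‖x‖ ^ 2 * μ ^ 2) = -(‖x‖ ^ 2 + h ^ 2) * μ ^ 2 := by ring
    rw [this]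
    push_cast
    field_simp
  have hGint : ∀ μ ∈ Ioi (0:ℝ), ∫ ξ, G (μ, ξ) = π⁻¹ * (μ ^ (2:ℝ) * exp (-h ^ 2 * μ ^ (2:ℝ))) := by
    intro μ hμ
    have hμ' : 0 < μ := hμ
    have h1 : ∀ ξ, G (μ, ξ) = exp (-(h ^ 2 * μ ^ 2)) * exp (-(π ^ 2 / μ ^ 2) * ‖ξ‖ ^ 2) := by
      intro ξ
      simp only [hG, ← exp_add]
      congr 1
      ring
    simp_rw [h1]
    rw [integral_const_mul, GaussianFourier.integral_rexp_neg_mul_sq_norm (hb μ hμ)]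
    have : ((Module.finrank ℝ Plane : ℝ) / 2) = 1 := by simp
    rw [this, rpow_one, rpow_two, neg_mul]
    field_simp
  have hprod : Integrable (fun q : ℝ × Plane => E q.2 * (G q : ℂ))
      ((volume.restrict (Ioi (0:ℝ))).prod volume) := by
    rw [integrable_prod_iff (by fun_prop)]
    refine ⟨?_, ?_⟩
    · filter_upwards [ae_restrict_mem measurableSet_Ioi] with μ hμ using hint μ hμ
    · have h2 : IntegrableOn (fun μ : ℝ => π⁻¹ * (μ ^ (2:ℝ) * exp (-h ^ 2 * μ ^ (2:ℝ)))) (Ioi 0) :=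
        (integrableOn_rpow_mul_exp_neg_mul_rpow (by norm_num) (by norm_num) (by positivity)).const_mul _
      refine h2.congr_fun (fun μ hμ => ?_) measurableSet_Ioi
      dsimp only
      rw [← hGint μ hμ]
      refine integral_congr_ae (.of_forall fun ξ => ?_)
      simp only [norm_mul, hEn, one_mul, Complex.norm_real, hG]
      rw [norm_of_nonneg (exp_pos _).le]
  -- The one-dimensional integral with `a = h`, `b = π|ξ|`; the origin is left out because `b` must
  -- be positive, and is a null set.
  have hrep : ∀ ξ : Plane, ξ ≠ 0 → ((exp (-(2 * π * h * ‖ξ‖)) : ℝ) : ℂ) =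
      (2 * h / √π : ℝ) * ∫ μ in Ioi (0:ℝ), (G (μ, ξ) : ℂ) := by
    intro ξ hξ
    have h1 := integral_exp_neg_sq_sub_div hh (b := π * ‖ξ‖) (mul_pos pi_pos (norm_pos_iff.2 hξ))
    have h2 : ∫ μ in Ioi (0:ℝ), (G (μ, ξ) : ℂ) = ((∫ μ in Ioi (0:ℝ), G (μ, ξ) : ℝ) : ℂ) :=
      integral_ofReal
    rw [h2]
    simp only [hG, h1, ← Complex.ofReal_mul]
    congr 1
    have : √π ≠ 0 := (sqrt_pos.2 pi_pos).ne'
    field_simp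
  have hxh : 0 < ‖x‖ ^ 2 + h ^ 2 := by positivity
  calc 𝓕⁻ (fun ξ : Plane => ((exp (-(2 * π * h * ‖ξ‖)) : ℝ) : ℂ)) x
      = ∫ ξ, E ξ * ((exp (-(2 * π * h * ‖ξ‖)) : ℝ) : ℂ) := by
        rw [fourierInv_eq']
        refine integral_congr_ae (.of_forall fun ξ => ?_)
        simp only [hE, smul_eq_mul, real_inner_comm x ξ]
        congr 2
        push_cast; ring
    _ = ∫ ξ, (2 * h / √π : ℝ) * ∫ μ in Ioi (0:ℝ), E ξ * (G (μ, ξ) : ℂ) := by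
        refine integral_congr_ae ?_
        have h0 : ∀ᵐ ξ : Plane, ξ ≠ 0 := by simp [ae_iff]
        filter_upwards [h0] with ξ hξ
        rw [hrep ξ hξ, integral_const_mul]
        ring
    _ = (2 * h / √π : ℝ) * ∫ μ in Ioi (0:ℝ), ∫ ξ, E ξ * (G (μ, ξ) : ℂ) := by
        rw [integral_const_mul]
        congr 1
        exact (integral_integral_swap (f := fun μ ξ => E ξ * (G (μ, ξ) : ℂ)) hprod).symm
    _ = (poisson h x : ℂ) := by
        rw [setIntegral_congr_fun measurableSet_Ioi hval, integral_complex_ofReal, ← Complex.ofReal_mul,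
          integral_const_mul, integral_rpow_mul_exp_neg_mul_rpow (by norm_num) (by norm_num) hxh]
        congr 1
        have hΓ : Gamma ((2 + 1) / 2) = √π / 2 := by
          rw [show ((2:ℝ) + 1) / 2 = 1 / 2 + 1 by norm_num, Gamma_add_one (by norm_num),
            Gamma_one_half_eq]
          ring
        have hr : (‖x‖ ^ 2 + h ^ 2) ^ (-((2:ℝ) + 1) / 2) = ((√(‖x‖ ^ 2 + h ^ 2)) ^ 3)⁻¹ := by
          rw [show -((2:ℝ) + 1) / 2 = -((1 / 2) * 3) by norm_num, rpow_neg hxh.le, rpow_mul hxh.le,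
            ← sqrt_eq_rpow]
          norm_num
        rw [hΓ, hr, poisson]
        have h2 : √π * √π = π := mul_self_sqrt pi_pos.le
        have : √π ≠ 0 := (sqrt_pos.2 pi_pos).ne'
        have : √(‖x‖ ^ 2 + h ^ 2) ≠ 0 := (sqrt_pos.2 hxh).ne'
        field_simp

theorem poisson_nonneg {h : ℝ} (hh : 0 ≤ h) (x : Plane) : 0 ≤ poisson h x := by
  unfold poisson; positivity

theorem poisson_neg (h : ℝ) (x : Plane) : poisson h (-x) = poisson h x := by
  simp [poisson]

theorem sqrt_pos_of_height {h : ℝ} (hh : 0 < h) (x : Plane) : 0 < Real.sqrt (‖x‖ ^ 2 + h ^ 2) :=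
  Real.sqrt_pos.2 (by positivity)

theorem continuous_poisson {h : ℝ} (hh : 0 < h) : Continuous (poisson h) := by
  unfold poisson
  refine continuous_const.mul (Continuous.inv₀ (by fun_prop) fun x => ?_)
  exact (pow_pos (sqrt_pos_of_height hh x) 3).ne'

theorem integrable_poisson {h : ℝ} (hh : 0 < h) : Integrable (poisson h) := by
  -- With this `c`, `|x|² + h² ≥ c² (1 + |x|²)`, so the kernel is dominated by the integrable `(1 +
  -- |x|²)^{-3/2}`.
  set c := min 1 h with hc
  have hc0 : 0 < c := lt_min one_pos hh
  have h1 : Integrable (fun x : Plane => h / (2 * Real.pi) * ((c ^ 3)⁻¹ *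
      (1 + ‖x‖ ^ 2) ^ (-(3:ℝ) / 2))) :=
    ((integrable_rpow_neg_one_add_norm_sq (by simp; norm_num)).const_mul _).const_mul _
  refine h1.mono' (continuous_poisson hh).aestronglyMeasurable (.of_forall fun x => ?_)
  rw [Real.norm_of_nonneg (poisson_nonneg hh.le x), poisson]
  gcongr
  have h2 : (1 + ‖x‖ ^ 2) ^ (-(3:ℝ) / 2) = ((Real.sqrt (1 + ‖x‖ ^ 2)) ^ 3)⁻¹ := by
    rw [show -(3:ℝ) / 2 = -((1 / 2) * 3) by norm_num, Real.rpow_neg (by positivity),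
      Real.rpow_mul (by positivity), ← Real.sqrt_eq_rpow]
    norm_num
  rw [h2, ← mul_inv, ← mul_pow]
  have hs : 0 < Real.sqrt (1 + ‖x‖ ^ 2) := Real.sqrt_pos.2 (by positivity)
  refine inv_anti₀ (by positivity) (pow_le_pow_left₀ (by positivity) ?_ 3)
  rw [← Real.sqrt_sq hc0.le, ← Real.sqrt_mul (by positivity)]
  refine Real.sqrt_le_sqrt ?_
  have hc1 : c ≤ 1 := min_le_left _ _
  have hch : c ≤ h := min_le_right _ _
  nlinarith [sq_nonneg ‖x‖, mul_nonneg (sub_nonneg.2 (pow_le_one₀ (n := 2) hc0.le hc1)) (sq_nonneg ‖x‖)]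

/-- The total mass is the Fourier transform at frequency `0`, where `e^{-2πh|ξ|}` equals `1`.
Evenness of the kernel identifies `𝓕` with `𝓕⁻`, so Fourier inversion applies. -/
theorem integral_poisson {h : ℝ} (hh : 0 < h) : ∫ x, poisson h x = 1 := by
  set f : Plane → ℂ := fun ξ => ((Real.exp (-(2 * Real.pi * h * ‖ξ‖)) : ℝ) : ℂ) with hf
  have hfi : Integrable f :=
    (integrable_exp_neg_mul_norm (a := 2 * Real.pi * h) (by positivity)).ofReal
  have hfc : Continuous f := by fun_prop
  have h1 : 𝓕⁻ f = fun x => (poisson h x : ℂ) := funext fun x => fourierInv_exp_neg_norm hh x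
  have h2 : 𝓕 f = fun x => (poisson h x : ℂ) := by
    funext x
    have := congrFun h1 (-x)
    rw [Real.fourierInv_eq_fourier_neg, neg_neg, poisson_neg] at this
    exact this
  have h3 := hfc.fourierInv_fourier_eq hfi (by rw [h2]; exact (integrable_poisson hh).ofReal)
  have h4 := congrFun h3 0
  rw [h2, Real.fourierInv_eq'] at h4
  simp only [inner_zero_right, mul_zero, Complex.ofReal_zero, zero_mul, Complex.exp_zero, one_smul,
    hf, norm_zero, neg_zero, Real.exp_zero, Complex.ofReal_one] at h4
  rw [integral_complex_ofReal] at h4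
  exact_mod_cast h4

theorem harmExt_neg_eq (u : Plane → Plane) (x : Plane) (h : ℝ) :
    harmExt u (x, -h) = ∫ y, poisson h (x - y) • u y := by
  simp only [harmExt, poisson, neg_neg, neg_sq, ← integral_smul, smul_smul]

end ILLSS

/-! ### Plancherel and Parseval for integral transforms -/

section Parseval
open scoped ComplexConjugate

variable {V F : Type*} [NormedAddCommGroup V]
    [InnerProductSpace ℝ V] [FiniteDimensional ℝ V] [MeasurableSpace V] [BorelSpace V]
    [NormedAddCommGroup F] [InnerProductSpace ℂ F] [CompleteSpace F]

theorem MeasureTheory.memLp_two_fourierInv {f : V → F} (h1 : Integrable f) (h2 : MemLp f 2) :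
    MemLp (𝓕⁻ f) 2 :=
  (memLp_congr_ae (Lp.fourierInv_toLp_ae h1 h2)).1 (Lp.memLp _)

theorem MeasureTheory.lintegral_enorm_sq_fourierInv {f : V → F} (h1 : Integrable f)
    (h2 : MemLp f 2) : ∫⁻ x, ‖𝓕⁻ f x‖ₑ ^ 2 = ∫⁻ ξ, ‖f ξ‖ₑ ^ 2 := by
  have key : ∀ g : V → F, eLpNorm g 2 volume ^ 2 = ∫⁻ x, ‖g x‖ₑ ^ 2 := by
    intro g
    have h := eLpNorm_nnreal_pow_eq_lintegral (f := g) (p := 2) (μ := volume) (by norm_num)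
    simpa using h
  rw [← key, ← key, ← eLpNorm_congr_ae (Lp.fourierInv_toLp_ae h1 h2)]
  have h3 : ‖(𝓕⁻ (h2.toLp f) : Lp F 2 (volume : Measure V))‖ = ‖h2.toLp f‖ :=
    (Lp.fourierTransformₗᵢ V F).symm.norm_map _
  have h4 : ‖(𝓕⁻ (h2.toLp f) : Lp F 2 (volume : Measure V))‖ₑ = ‖h2.toLp f‖ₑ := by
    rw [← ofReal_norm, h3, ofReal_norm]
  rw [Lp.enorm_def, Lp.enorm_def, eLpNorm_congr_ae h2.coeFn_toLp] at h4
  rw [h4]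

/-- Parseval between a scalar and a vector-valued function. Pairing with a fixed vector `c` replaces
`g` by the vector-valued `g • c` and reduces the identity to unitarity of the `L²` transform. -/
theorem MeasureTheory.integral_conj_fourierInv_smul {g : V → ℂ} (h1 : Integrable g)
    (h2 : MemLp g 2) (U : Lp F 2 (volume : Measure V)) :
    ∫ y, conj (𝓕⁻ g y) • U y = ∫ ξ, conj (g ξ) • (𝓕 U : Lp F 2 (volume : Measure V)) ξ := by
  have hi1 : Integrable (fun y => conj (𝓕⁻ g y) • U y) := by
    rw [← memLp_one_iff_integrable]
    exact MemLp.smul (p := 2) (q := 2) (Lp.memLp U) (memLp_two_fourierInv h1 h2).star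
  have hi2 : Integrable (fun ξ => conj (g ξ) • (𝓕 U : Lp F 2 (volume : Measure V)) ξ) := by
    rw [← memLp_one_iff_integrable]
    exact MemLp.smul (p := 2) (q := 2) (Lp.memLp _) h2.star
  refine ext_inner_left ℂ fun c => ?_
  rw [← integral_inner hi1, ← integral_inner hi2]
  have hc1 : Integrable (fun ξ => g ξ • c) := h1.smul_const c
  have hc2 : MemLp (fun ξ => g ξ • c) 2 := by
    have := (ContinuousLinearMap.smulRight (1 : ℂ →L[ℂ] ℂ) c).comp_memLp' h2
    simpa using! this
  have hF : ∀ y, 𝓕⁻ (fun ξ => g ξ • c) y = 𝓕⁻ g y • c := by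
    intro y
    rw [Real.fourierInv_eq', Real.fourierInv_eq', ← integral_smul_const]
    simp only [smul_smul, smul_eq_mul]
  have hinner := Lp.inner_fourier_eq (𝓕⁻ (hc2.toLp _) : Lp F 2 (volume : Measure V)) U
  rw [FourierTransform.fourier_fourierInv_eq, L2.inner_def, L2.inner_def] at hinner
  calc ∫ y, inner ℂ c (conj (𝓕⁻ g y) • U y)
      = ∫ y, inner ℂ ((𝓕⁻ (hc2.toLp _) : Lp F 2 (volume : Measure V)) y) (U y) := by
        refine integral_congr_ae ?_
        filter_upwards [Lp.fourierInv_toLp_ae hc1 hc2] with y hy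
        rw [hy, hF, inner_smul_left, inner_smul_right]
    _ = _ := hinner.symm
    _ = _ := by
        refine integral_congr_ae ?_
        filter_upwards [hc2.coeFn_toLp] with y hy
        rw [hy, inner_smul_left, inner_smul_right]

end Parseval

/-! ### The harmonic extension as a superposition of plane waves -/

namespace ILLSS

theorem integrable_norm_pow_mul_exp {a : ℝ} (ha : 0 < a) (n : ℕ) :
    Integrable (fun ξ : Plane => ‖ξ‖ ^ n * Real.exp (-(a * ‖ξ‖))) := by
  refine (integrable_fun_norm_addHaar (volume : Measure Plane)
    (f := fun r => r ^ n * Real.exp (-(a * r)))).2 ?_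
  have h := integrableOn_rpow_mul_exp_neg_mul_rpow (p := 1) (s := n + 1) (b := a)
    (by have : (0:ℝ) ≤ n := n.cast_nonneg
        linarith) one_pos ha
  refine h.congr_fun (fun x hx => ?_) measurableSet_Ioi
  have : x ^ ((n:ℝ) + 1) = x ^ (n + 1) := by
    rw [← Real.rpow_natCast]; norm_num
  simp [this]
  ring

theorem memLp_norm_pow_mul_exp {a : ℝ} (ha : 0 < a) (n : ℕ) :
    MemLp (fun ξ : Plane => ‖ξ‖ ^ n * Real.exp (-(a * ‖ξ‖))) 2 := by
  rw [memLp_two_iff_integrable_sq (by fun_prop)]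
  refine (integrable_norm_pow_mul_exp (a := 2 * a) (by positivity) (2 * n)).congr
    (.of_forall fun ξ => ?_)
  simp only [mul_pow, ← pow_mul, ← Real.exp_nat_mul]
  congr 2
  · ring
  · push_cast; ring

/-- The inclusion of the real plane into the complex one. -/
def complexMap : Plane →ₗᵢ[ℝ] CPlane where
  toFun v := WithLp.toLp 2 (fun i => (v i : ℂ))
  map_add' v w := by ext i; simp
  map_smul' r v := by ext i; simp
  norm_map' v := by
    simp [EuclideanSpace.norm_eq]

theorem complexify_eq (u : Plane → Plane) : complexify u = fun x => complexMap (u x) := rfl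

/-- The exponent `2πi ⟨x, ξ⟩ + 2π s |ξ|` of a plane wave decaying into the lower half-space, as a
linear function of the point `(x, s)`. -/
def waveExp (ξ : Plane) : Plane × ℝ →L[ℝ] ℂ :=
  (2 * Real.pi * Complex.I : ℂ) •
      (Complex.ofRealCLM.comp ((innerSL ℝ ξ).comp (ContinuousLinearMap.fst ℝ Plane ℝ)))
    + (2 * Real.pi * ‖ξ‖ : ℂ) • (Complex.ofRealCLM.comp (ContinuousLinearMap.snd ℝ Plane ℝ))

theorem waveExp_apply (ξ : Plane) (z : Plane × ℝ) : waveExp ξ z =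
    2 * Real.pi * Complex.I * (inner ℝ ξ z.1 : ℝ) + 2 * Real.pi * ‖ξ‖ * z.2 := by
  simp [waveExp]

theorem continuous_waveExp : Continuous waveExp := by
  unfold waveExp
  fun_prop

theorem norm_waveExp_le (ξ : Plane) : ‖waveExp ξ‖ ≤ 4 * Real.pi * ‖ξ‖ := by
  refine ContinuousLinearMap.opNorm_le_bound _ (by positivity) fun z => ?_
  rw [waveExp_apply]
  refine (norm_add_le _ _).trans ?_
  have h1 : ‖z.1‖ ≤ ‖z‖ := norm_fst_le z
  have h2 : ‖z.2‖ ≤ ‖z‖ := norm_snd_le z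
  have h3 := norm_inner_le_norm (𝕜 := ℝ) ξ z.1
  have hpi := Real.pi_pos.le
  simp only [norm_mul, Complex.norm_real, Complex.norm_I, mul_one, norm_norm, Complex.norm_ofNat,
    Real.norm_of_nonneg hpi]
  have h4 : ‖(inner ℝ ξ z.1 : ℝ)‖ ≤ ‖ξ‖ * ‖z‖ := h3.trans (by gcongr)
  calc 2 * Real.pi * ‖(inner ℝ ξ z.1 : ℝ)‖ + 2 * Real.pi * ‖ξ‖ * ‖z.2‖
      ≤ 2 * Real.pi * (‖ξ‖ * ‖z‖) + 2 * Real.pi * ‖ξ‖ * ‖z‖ := by gcongr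
    _ = _ := by ring

theorem norm_cexp_waveExp (ξ : Plane) (z : Plane × ℝ) :
    ‖Complex.exp (waveExp ξ z)‖ = Real.exp (2 * Real.pi * ‖ξ‖ * z.2) := by
  rw [Complex.norm_exp, waveExp_apply]
  congr 1
  simp

open scoped ComplexConjugate

/-- The (Mathlib-normalized) Fourier transform of an `L²` field. -/
def hat {u : Plane → Plane} (hu : MemLp (complexify u) 2 (volume : Measure Plane)) :
    Lp CPlane 2 (volume : Measure Plane) := 𝓕 hu.toLp

/-- Parseval applied to the Poisson integral: `y ↦ poisson h (x - y)` is the inverse transform of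
the conjugated plane wave, so the convolution turns into an integral over frequencies that can be
differentiated in the point. -/
theorem harmExt_eq_wave {u : Plane → Plane} (hu : MemLp (complexify u) 2 (volume : Measure Plane))
    {z : Plane × ℝ} (hz : z.2 < 0) :
    complexMap (harmExt u z) = ∫ ξ, Complex.exp (waveExp ξ z) • hat hu ξ := by
  obtain ⟨x, s⟩ := z
  obtain ⟨h, rfl⟩ : ∃ h, s = -h := ⟨-s, by simp⟩
  have hh : 0 < h := by simpa using hz
  set g : Plane → ℂ := fun ξ => conj (Complex.exp (waveExp ξ (x, -h))) with hg
  have hgc : Continuous g := by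
    have := continuous_waveExp
    exact Complex.continuous_conj.comp (by fun_prop)
  have hgn : ∀ ξ, ‖g ξ‖ = ‖ξ‖ ^ 0 * Real.exp (-(2 * Real.pi * h * ‖ξ‖)) := by
    intro ξ
    simp only [hg, RCLike.norm_conj, norm_cexp_waveExp]
    rw [pow_zero, one_mul]
    congr 1; ring
  have ha : 0 < 2 * Real.pi * h := by positivity
  have h1 : Integrable g :=
    (integrable_norm_pow_mul_exp ha 0).mono' hgc.aestronglyMeasurable (.of_forall fun ξ => (hgn ξ).le)
  have h2 : MemLp g 2 :=
    (memLp_norm_pow_mul_exp ha 0).of_le hgc.aestronglyMeasurable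
      (.of_forall fun ξ => by rw [hgn]; exact Real.le_norm_self _)
  have hF : ∀ y, 𝓕⁻ g y = (poisson h (x - y) : ℂ) := by
    intro y
    rw [← poisson_neg, neg_sub, ← fourierInv_exp_neg_norm hh, Real.fourierInv_eq', Real.fourierInv_eq']
    refine integral_congr_ae (.of_forall fun ξ => ?_)
    simp only [hg, smul_eq_mul, ← Complex.exp_conj, waveExp_apply, Complex.ofReal_exp,
      ← Complex.exp_add]
    congr 1
    simp [inner_sub_right, map_ofNat]
    ring
  have key := integral_conj_fourierInv_smul h1 h2 hu.toLp
  rw [harmExt_neg_eq, ← LinearIsometry.integral_comp_comm]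
  calc ∫ y, complexMap (poisson h (x - y) • u y)
      = ∫ y, conj (𝓕⁻ g y) • (hu.toLp : Lp CPlane 2 (volume : Measure Plane)) y := by
        refine integral_congr_ae ?_
        filter_upwards [hu.coeFn_toLp] with y hy
        rw [hy, hF, Complex.conj_ofReal, map_smul, complexify_eq]
        ext i
        simp
    _ = _ := by
        rw [key]
        simp only [hg, Complex.conj_conj]
        rfl

theorem integrable_wave (U : Lp CPlane 2 (volume : Measure Plane)) {a : ℝ} (ha : 0 < a) (n : ℕ) :
    Integrable (fun ξ => ‖ξ‖ ^ n * Real.exp (-(a * ‖ξ‖)) * ‖U ξ‖) :=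
  (memLp_norm_pow_mul_exp ha n).integrable_mul (Lp.memLp U).norm

/-- The derivative at `z` of the plane wave with frequency `ξ` and amplitude `v`. -/
def waveDeriv (ξ : Plane) (z : Plane × ℝ) (v : CPlane) : Plane × ℝ →L[ℝ] CPlane :=
  ((ContinuousLinearMap.lsmul ℝ ℂ).flip v).comp (Complex.exp (waveExp ξ z) • waveExp ξ)

theorem waveDeriv_apply (ξ : Plane) (z w : Plane × ℝ) (v : CPlane) :
    waveDeriv ξ z v w = (Complex.exp (waveExp ξ z) * waveExp ξ w) • v := by
  simp [waveDeriv]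

theorem norm_waveDeriv_le (ξ : Plane) (z : Plane × ℝ) (v : CPlane) :
    ‖waveDeriv ξ z v‖ ≤ ‖Complex.exp (waveExp ξ z)‖ * (4 * Real.pi * ‖ξ‖) * ‖v‖ := by
  refine ContinuousLinearMap.opNorm_le_bound _ (by positivity) fun w => ?_
  rw [waveDeriv_apply, norm_smul, norm_mul]
  have h : ‖waveExp ξ w‖ ≤ 4 * Real.pi * ‖ξ‖ * ‖w‖ :=
    (waveExp ξ).le_of_opNorm_le (norm_waveExp_le ξ) w
  calc ‖Complex.exp (waveExp ξ z)‖ * ‖waveExp ξ w‖ * ‖v‖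
      ≤ ‖Complex.exp (waveExp ξ z)‖ * (4 * Real.pi * ‖ξ‖ * ‖w‖) * ‖v‖ := by gcongr
    _ = _ := by ring

theorem continuous_waveDeriv (z : Plane × ℝ) :
    Continuous (fun q : Plane × CPlane => waveDeriv q.1 z q.2) := by
  have hm := continuous_waveExp
  have h1 : Continuous (fun q : Plane × CPlane => Complex.exp (waveExp q.1 z) • waveExp q.1) := by
    fun_prop
  have h2 : Continuous (fun q : Plane × CPlane =>
      (ContinuousLinearMap.lsmul ℝ ℂ : ℂ →L[ℝ] CPlane →L[ℝ] CPlane).flip q.2) :=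
    (ContinuousLinearMap.continuous _).comp continuous_snd
  exact h2.clm_comp h1

theorem aestronglyMeasurable_waveDeriv {V : Plane → CPlane} (hV : AEStronglyMeasurable V volume)
    (z : Plane × ℝ) :
    AEStronglyMeasurable (fun ξ => waveDeriv ξ z (V ξ)) volume := by
  have h4 : AEStronglyMeasurable (fun ξ : Plane => (ξ, V ξ)) volume :=
    continuous_id.aestronglyMeasurable.prodMk hV
  have h5 := continuous_waveDeriv z
  generalize hg : (fun q : Plane × CPlane => waveDeriv q.1 z q.2) = g at h5
  have h6 : AEStronglyMeasurable (fun ξ => g (ξ, V ξ)) volume := h5.comp_aestronglyMeasurable h4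
  rw [← hg] at h6
  exact h6

theorem hasFDerivAt_wave (U : Lp CPlane 2 (volume : Measure Plane)) {z : Plane × ℝ} (hz : z.2 < 0) :
    HasFDerivAt (fun z => ∫ ξ, Complex.exp (waveExp ξ z) • U ξ)
      (∫ ξ, waveDeriv ξ z (U ξ)) z := by
  -- Half the decay rate at `z`: the bound `e^{-a|ξ|}` then holds for every point whose vertical
  -- coordinate lies below `z.2 / 2`, a neighbourhood of `z`.
  set a : ℝ := -(Real.pi * z.2) with ha
  have ha0 : 0 < a := by
    have := mul_pos_of_neg_of_neg hz (neg_lt_zero.2 Real.pi_pos); linarith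
  have hm := continuous_waveExp
  have hb0 : ∀ ξ : Plane, ∀ w : Plane × ℝ, w.2 < z.2 / 2 →
      ‖Complex.exp (waveExp ξ w)‖ ≤ Real.exp (-(a * ‖ξ‖)) := by
    intro ξ w hw
    rw [norm_cexp_waveExp]
    apply Real.exp_le_exp.2
    have h3 : 0 ≤ Real.pi * ‖ξ‖ := mul_nonneg Real.pi_pos.le (norm_nonneg ξ)
    rw [ha]
    nlinarith
  have hmeas : ∀ w : Plane × ℝ, AEStronglyMeasurable (fun ξ => Complex.exp (waveExp ξ w) • U ξ) volume :=
    fun w => (show Continuous (fun ξ => Complex.exp (waveExp ξ w)) by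
      fun_prop).aestronglyMeasurable.smul (Lp.aestronglyMeasurable U)
  have hz2 : z.2 < z.2 / 2 := by linarith
  refine hasFDerivAt_integral_of_dominated_of_fderiv_le (𝕜 := ℝ) (s := {w | w.2 < z.2 / 2})
    (F' := fun z ξ => waveDeriv ξ z (U ξ)) (bound := fun ξ => 4 * Real.pi * (‖ξ‖ ^ 1 * Real.exp (-(a * ‖ξ‖)) * ‖U ξ‖))
    ((isOpen_lt continuous_snd continuous_const).mem_nhds hz2) (.of_forall hmeas) ?_ ?_ ?_ ?_ ?_
  · refine (integrable_wave U ha0 0).mono' (hmeas z) (.of_forall fun ξ => ?_)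
    rw [norm_smul, pow_zero, one_mul]
    gcongr
    exact hb0 ξ z hz2
  · exact aestronglyMeasurable_waveDeriv (Lp.aestronglyMeasurable U) z
  · refine .of_forall fun ξ w hw => (norm_waveDeriv_le ξ w _).trans ?_
    calc ‖Complex.exp (waveExp ξ w)‖ * (4 * Real.pi * ‖ξ‖) * ‖U ξ‖
        ≤ Real.exp (-(a * ‖ξ‖)) * (4 * Real.pi * ‖ξ‖) * ‖U ξ‖ := by
          gcongr
          exact hb0 ξ w hw
      _ = _ := by ring
  · exact (integrable_wave U ha0 1).const_mul _
  · refine .of_forall fun ξ w _ => ?_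
    refine (((waveExp ξ).hasFDerivAt.cexp).smul_const (U ξ)).congr_fderiv ?_
    refine ContinuousLinearMap.ext fun v => ?_
    simp [waveDeriv_apply]

theorem integrable_fderiv_wave (U : Lp CPlane 2 (volume : Measure Plane)) {z : Plane × ℝ}
    (hz : z.2 < 0) :
    Integrable (fun ξ => waveDeriv ξ z (U ξ)) := by
  refine ((integrable_wave U (a := -(2 * Real.pi * z.2)) ?_ 1).const_mul (4 * Real.pi)).mono'
    (aestronglyMeasurable_waveDeriv (Lp.aestronglyMeasurable U) z) (.of_forall fun ξ => (norm_waveDeriv_le ξ z _).trans ?_)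
  · have := mul_pos_of_neg_of_neg hz (neg_lt_zero.2 Real.pi_pos); linarith
  · rw [norm_cexp_waveExp]
    refine le_of_eq ?_
    ring_nf

theorem differentiableAt_harmExt {u : Plane → Plane}
    (hu : MemLp (complexify u) 2 (volume : Measure Plane)) {z : Plane × ℝ} (hz : z.2 < 0) :
    DifferentiableAt ℝ (harmExt u) z ∧ ∀ w, complexMap (fderiv ℝ (harmExt u) z w) =
      ∫ ξ, (Complex.exp (waveExp ξ z) * waveExp ξ w) • hat hu ξ := by
  have h1 := hasFDerivAt_wave (hat hu) hz
  have h2 : HasFDerivAt (fun z => complexMap (harmExt u z))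
      (∫ ξ, waveDeriv ξ z (hat hu ξ)) z := by
    refine h1.congr_of_eventuallyEq ?_
    filter_upwards [(isOpen_lt continuous_snd continuous_const).mem_nhds hz] with w hw
    exact harmExt_eq_wave hu hw
  -- A real-linear left inverse of the complexification carries differentiability back from `CPlane`
  -- to `Plane`.
  obtain ⟨R, hR⟩ : ∃ R : CPlane →L[ℝ] Plane, ∀ v, R (complexMap v) = v := by
    obtain ⟨R, hR⟩ := complexMap.toLinearMap.exists_leftInverse_of_injective
      (LinearMap.ker_eq_bot.2 complexMap.injective)
    exact ⟨LinearMap.toContinuousLinearMap R, fun v => DFunLike.congr_fun hR v⟩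
  have h3 : DifferentiableAt ℝ (harmExt u) z := by
    have := (R.hasFDerivAt.comp z h2).differentiableAt
    refine this.congr_of_eventuallyEq (.of_forall fun w => ?_)
    simp [hR]
  refine ⟨h3, fun w => ?_⟩
  have h4 := (complexMap.toContinuousLinearMap.hasFDerivAt.comp z h3.hasFDerivAt).unique h2
  have h5 := DFunLike.congr_fun h4 w
  rw [ContinuousLinearMap.integral_apply (integrable_fderiv_wave (hat hu) hz)] at h5
  simp only [waveDeriv_apply] at h5
  exact h5

/-! ### The Dirichlet energy in Fourier variables -/

open scoped ComplexConjugate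

theorem norm_mul_exp_le {a : ℝ} (ha : 0 < a) (r : ℝ) : r * Real.exp (-(a * r)) ≤ a⁻¹ := by
  have h1 : a * r ≤ Real.exp (a * r) := by linarith [Real.add_one_le_exp (a * r)]
  rw [Real.exp_neg, ← div_eq_mul_inv, div_le_iff₀ (Real.exp_pos _), inv_mul_eq_div, le_div_iff₀ ha]
  linarith

/-- The Fourier transform, at height `s`, of a derivative of the harmonic extension. -/
def waveAmp (m : Plane → ℂ) (U : Plane → CPlane) (s : ℝ) (ξ : Plane) : CPlane :=
  (m ξ * (Real.exp (2 * Real.pi * ‖ξ‖ * s) : ℂ)) • U ξ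

theorem waveAmp_memLp {m : Plane → ℂ} (hm : Continuous m) {C : ℝ}
    (hC : ∀ ξ, ‖m ξ‖ ≤ C * (1 + ‖ξ‖)) (U : Lp CPlane 2 (volume : Measure Plane)) {s : ℝ}
    (hs : s < 0) : Integrable (waveAmp m U s) ∧ MemLp (waveAmp m U s) 2 := by
  have ha : 0 < -(2 * Real.pi * s) := by
    have := mul_pos_of_neg_of_neg hs (neg_lt_zero.2 Real.pi_pos); linarith
  set a := -(2 * Real.pi * s) with hadef
  have hexp : ∀ ξ : Plane, Real.exp (2 * Real.pi * ‖ξ‖ * s) = Real.exp (-(a * ‖ξ‖)) := by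
    intro ξ; rw [hadef]; ring_nf
  have hmeas : AEStronglyMeasurable (waveAmp m U s) volume := by
    have hc : Continuous (fun ξ : Plane => m ξ * (Real.exp (2 * Real.pi * ‖ξ‖ * s) : ℂ)) := by
      fun_prop
    exact hc.aestronglyMeasurable.smul (Lp.aestronglyMeasurable U)
  have hn : ∀ ξ, ‖waveAmp m U s ξ‖ ≤ C * (‖ξ‖ ^ 0 * Real.exp (-(a * ‖ξ‖)) * ‖U ξ‖) +
      C * (‖ξ‖ ^ 1 * Real.exp (-(a * ‖ξ‖)) * ‖U ξ‖) := by
    intro ξ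
    rw [waveAmp, norm_smul, norm_mul, Complex.norm_real, Real.norm_of_nonneg (Real.exp_pos _).le,
      hexp]
    calc ‖m ξ‖ * Real.exp (-(a * ‖ξ‖)) * ‖U ξ‖
        ≤ C * (1 + ‖ξ‖) * Real.exp (-(a * ‖ξ‖)) * ‖U ξ‖ := by gcongr; exact hC ξ
      _ = _ := by ring
  have hC0 : 0 ≤ C := by simpa using (norm_nonneg _).trans (hC 0)
  refine ⟨(((integrable_wave U ha 0).const_mul C).add ((integrable_wave U ha 1).const_mul C)).mono'
    hmeas (.of_forall hn), ?_⟩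
  refine (Lp.memLp U).of_le_mul (c := C * (1 + a⁻¹)) hmeas (.of_forall fun ξ => (hn ξ).trans ?_)
  have h1 : Real.exp (-(a * ‖ξ‖)) ≤ 1 := Real.exp_le_one_iff.2 (by
    have := mul_nonneg ha.le (norm_nonneg ξ); linarith)
  have h2 := norm_mul_exp_le ha ‖ξ‖
  calc C * (‖ξ‖ ^ 0 * Real.exp (-(a * ‖ξ‖)) * ‖U ξ‖) + C * (‖ξ‖ ^ 1 * Real.exp (-(a * ‖ξ‖)) * ‖U ξ‖)
      = C * (Real.exp (-(a * ‖ξ‖)) + ‖ξ‖ * Real.exp (-(a * ‖ξ‖))) * ‖U ξ‖ := by ring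
    _ ≤ C * (1 + a⁻¹) * ‖U ξ‖ := by gcongr

theorem fourierInv_waveAmp (m : Plane → ℂ) (U : Plane → CPlane) (s : ℝ) (x : Plane) :
    𝓕⁻ (waveAmp m U s) x = ∫ ξ, (Complex.exp (waveExp ξ (x, s)) * m ξ) • U ξ := by
  rw [Real.fourierInv_eq']
  refine integral_congr_ae (.of_forall fun ξ => ?_)
  simp only [waveAmp, smul_smul, waveExp_apply, Complex.ofReal_exp]
  congr 1
  rw [mul_comm (m ξ), ← mul_assoc, ← Complex.exp_add]
  congr 2
  push_cast; ring

/-- Plancherel at the fixed height `s`: differentiation in direction `w` multiplies the wave of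
frequency `ξ` by `waveExp ξ w`. -/
theorem lintegral_fderiv_harmExt_sq {u : Plane → Plane}
    (hu : MemLp (complexify u) 2 (volume : Measure Plane)) {s : ℝ} (hs : s < 0) (w : Plane × ℝ) :
    ∫⁻ x, ‖fderiv ℝ (harmExt u) (x, s) w‖ₑ ^ 2 =
      ∫⁻ ξ, ENNReal.ofReal (‖waveExp ξ w‖ ^ 2 * Real.exp (4 * Real.pi * ‖ξ‖ * s)) *
        ‖hat hu ξ‖ₑ ^ 2 := by
  have hc : Continuous (fun ξ => waveExp ξ w) := by have := continuous_waveExp; fun_prop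
  have hb : ∀ ξ : Plane, ‖waveExp ξ w‖ ≤ 4 * Real.pi * ‖w‖ * (1 + ‖ξ‖) := by
    intro ξ
    refine ((waveExp ξ).le_of_opNorm_le (norm_waveExp_le ξ) w).trans ?_
    have : 0 ≤ 4 * Real.pi * ‖w‖ := by positivity
    linarith
  obtain ⟨h1, h2⟩ := waveAmp_memLp hc hb (hat hu) hs
  calc ∫⁻ x, ‖fderiv ℝ (harmExt u) (x, s) w‖ₑ ^ 2
      = ∫⁻ x, ‖𝓕⁻ (waveAmp (fun ξ => waveExp ξ w) (hat hu) s) x‖ₑ ^ 2 := by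
        refine lintegral_congr fun x => ?_
        rw [fourierInv_waveAmp, ← (differentiableAt_harmExt hu (z := (x, s)) hs).2 w,
          ← ofReal_norm, ← ofReal_norm, LinearIsometry.norm_map]
    _ = _ := by
        rw [lintegral_enorm_sq_fourierInv h1 h2]
        refine lintegral_congr fun ξ => ?_
        rw [waveAmp, enorm_smul, mul_pow, ← ofReal_norm (_ * _), ← ENNReal.ofReal_pow (norm_nonneg _),
          norm_mul, Complex.norm_real, Real.norm_of_nonneg (Real.exp_pos _).le, mul_pow,
          ← Real.exp_nat_mul]
        congr 4
        push_cast; ring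

/-- The two horizontal directions together and the vertical one each contribute `4π²|ξ|²`. -/
theorem sum_norm_waveExp_sq (ξ : Plane) :
    (∑ i : Fin 2, ‖waveExp ξ (EuclideanSpace.single i 1, 0)‖ ^ 2) + ‖waveExp ξ (0, 1)‖ ^ 2 =
      8 * Real.pi ^ 2 * ‖ξ‖ ^ 2 := by
  have h : ‖ξ‖ ^ 2 = ξ 0 ^ 2 + ξ 1 ^ 2 := by
    rw [EuclideanSpace.norm_sq_eq]; simp
  simp only [waveExp_apply, Fin.sum_univ_two]
  simp [mul_pow, h, EuclideanSpace.inner_single_right]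
  ring

theorem lintegral_exp_Iio {c : ℝ} (hc : 0 < c) :
    ∫⁻ s in Iio (0:ℝ), ENNReal.ofReal (Real.exp (c * s)) = ENNReal.ofReal (c⁻¹) := by
  rw [← ofReal_integral_eq_lintegral_ofReal, ← integral_Iic_eq_integral_Iio, integral_exp_mul_Iic hc]
  · simp
  · exact (integrableOn_exp_mul_Iic hc 0).mono_set Iio_subset_Iic_self
  · exact .of_forall fun _ => (Real.exp_pos _).le

/-- By Tonelli, the height integral `∫_{s<0} e^{4π|ξ|s} ds = (4π|ξ|)⁻¹` turns the symbol `8π²|ξ|²`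
into `2π|ξ|`. The frequency `ξ = 0` contributes nothing and is treated apart. -/
theorem dirichletEnergy_eq {u : Plane → Plane}
    (hu : MemLp (complexify u) 2 (volume : Measure Plane)) :
    dirichletEnergy u = ∫⁻ ξ, ENNReal.ofReal (2 * Real.pi * ‖ξ‖) * ‖hat hu ξ‖ₑ ^ 2 := by
  have hset : {z : Plane × ℝ | z.2 < 0} = univ ×ˢ Iio 0 := by ext z; simp
  have hmeas : ∀ w : Plane × ℝ, Measurable (fun z => ‖fderiv ℝ (harmExt u) z w‖ₑ ^ 2) := fun w =>
    (measurable_fderiv_apply_const ℝ (harmExt u) w).enorm.pow_const 2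
  rw [dirichletEnergy, hset, Measure.volume_eq_prod, ← Measure.prod_restrict, Measure.restrict_univ,
    lintegral_prod_symm _ (by fun_prop)]
  have hs : ∀ s ∈ Iio (0:ℝ), ∫⁻ x, ((∑ i : Fin 2,
      ‖fderiv ℝ (harmExt u) (x, s) (EuclideanSpace.single i 1, 0)‖ₑ ^ 2)
      + ‖fderiv ℝ (harmExt u) (x, s) (0, 1)‖ₑ ^ 2) =
      ∫⁻ ξ, ENNReal.ofReal (8 * Real.pi ^ 2 * ‖ξ‖ ^ 2 * Real.exp (4 * Real.pi * ‖ξ‖ * s)) *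
        ‖hat hu ξ‖ₑ ^ 2 := by
    intro s hs
    have hm' : ∀ w, Measurable (fun x => ‖fderiv ℝ (harmExt u) (x, s) w‖ₑ ^ 2) := fun w =>
      (hmeas w).comp (by fun_prop : Measurable fun x : Plane => (x, s))
    have hc : ∀ w, Continuous (fun ξ => waveExp ξ w) := by
      intro w; have := continuous_waveExp; fun_prop
    have hU : AEMeasurable (fun ξ => ‖hat hu ξ‖ₑ ^ 2) volume :=
      (Lp.aestronglyMeasurable (hat hu)).enorm.pow_const 2
    have hm2 : ∀ w, AEMeasurable (fun ξ => ENNReal.ofReal (‖waveExp ξ w‖ ^ 2 *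
        Real.exp (4 * Real.pi * ‖ξ‖ * s)) * ‖hat hu ξ‖ₑ ^ 2) volume := by
      intro w
      refine AEMeasurable.mul (Measurable.aemeasurable ?_) hU
      have := hc w
      fun_prop
    rw [lintegral_add_right _ (hm' _), lintegral_finsetSum _ (fun i _ => hm' _)]
    simp_rw [lintegral_fderiv_harmExt_sq hu hs]
    rw [← lintegral_finsetSum' _ (fun i _ => hm2 _), ← lintegral_add_right' _ (hm2 _)]
    refine lintegral_congr fun ξ => ?_
    rw [← sum_norm_waveExp_sq, ← Finset.sum_mul, ← add_mul, ← ENNReal.ofReal_sum_of_nonneg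
      (fun i _ => by positivity), ← ENNReal.ofReal_add (by positivity) (by positivity), add_mul,
      Finset.sum_mul]
  rw [setLIntegral_congr_fun measurableSet_Iio hs, lintegral_lintegral_swap]
  · refine lintegral_congr fun ξ => ?_
    rw [lintegral_mul_const _ (by fun_prop)]
    congr 1
    have h1 : ∀ s, ENNReal.ofReal (8 * Real.pi ^ 2 * ‖ξ‖ ^ 2 * Real.exp (4 * Real.pi * ‖ξ‖ * s)) =
        ENNReal.ofReal (8 * Real.pi ^ 2 * ‖ξ‖ ^ 2) * ENNReal.ofReal (Real.exp (4 * Real.pi * ‖ξ‖ * s)) :=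
      fun s => ENNReal.ofReal_mul (by positivity)
    simp_rw [h1]
    rw [lintegral_const_mul _ (by fun_prop)]
    rcases eq_or_ne ξ 0 with rfl | hξ
    · simp
    · have : 0 < ‖ξ‖ := norm_pos_iff.2 hξ
      rw [lintegral_exp_Iio (by positivity), ← ENNReal.ofReal_mul (by positivity)]
      congr 1
      field_simp
      ring
  · have hU : AEMeasurable (fun q : ℝ × Plane => ‖hat hu q.2‖ₑ ^ 2)
        ((volume.restrict (Iio 0)).prod volume) :=
      ((Lp.aestronglyMeasurable (hat hu)).enorm.pow_const 2).comp_quasiMeasurePreserving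
        Measure.quasiMeasurePreserving_snd
    refine AEMeasurable.mul (Measurable.aemeasurable ?_) hU
    fun_prop

/-- Change of variable `k = 2πξ`: the weight `|k|` becomes `2π|ξ|`, the weight of the Dirichlet
energy, and the factor `(2π)²` is the Jacobian in the plane. -/
theorem hDotNorm_half_sq {u : Plane → Plane}
    (hu : MemLp (complexify u) 2 (volume : Measure Plane)) :
    hDotNorm (1 / 2) hu.toLp ^ 2 = ENNReal.ofReal ((2 * Real.pi) ^ 2) * dirichletEnergy u := by
  have hpi : (0:ℝ) < 2 * Real.pi := by positivity
  have h := eLpNorm_nnreal_pow_eq_lintegral (p := 2) (μ := volume)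
    (f := (fun k : Plane => (‖k‖ ^ (1 / 2 : ℝ)) • fourierHat hu.toLp k)) (by norm_num)
  have h' : hDotNorm (1 / 2) hu.toLp ^ 2 =
      ∫⁻ k : Plane, ‖(‖k‖ ^ (1 / 2 : ℝ)) • fourierHat hu.toLp k‖ₑ ^ 2 := by
    rw [hDotNorm]; simpa using h
  rw [h', dirichletEnergy_eq hu]
  set G : Plane → ℝ≥0∞ := fun ξ => ENNReal.ofReal (2 * Real.pi * ‖ξ‖) * ‖hat hu ξ‖ₑ ^ 2 with hG
  have h1 : ∀ k : Plane, ‖(‖k‖ ^ (1 / 2 : ℝ)) • fourierHat hu.toLp k‖ₑ ^ 2 =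
      G ((2 * Real.pi)⁻¹ • k) := by
    intro k
    have h2 : 2 * Real.pi * ‖(2 * Real.pi)⁻¹ • k‖ = ‖k‖ := by
      rw [norm_smul, Real.norm_of_nonneg (by positivity)]; field_simp
    simp only [hG, h2]
    rw [enorm_smul, mul_pow, Real.enorm_of_nonneg (by positivity), ← ENNReal.ofReal_pow (by positivity),
      ← Real.rpow_natCast, ← Real.rpow_mul (by positivity)]
    rw [show ((1:ℝ) / 2 * (2:ℕ)) = 1 by norm_num, Real.rpow_one]
    rfl
  simp_rw [h1]
  have hne : (2 * Real.pi)⁻¹ ≠ 0 := by positivity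
  have h3 := lintegral_map_equiv (μ := volume) G
    (Homeomorph.smulOfNeZero _ hne : Plane ≃ₜ Plane).toMeasurableEquiv
  have h4 : Measure.map ((2 * Real.pi)⁻¹ • ·) (volume : Measure Plane) = _ :=
    Measure.map_addHaar_smul volume hne
  have h5 : ∫⁻ ξ, G ξ ∂(Measure.map ((2 * Real.pi)⁻¹ • ·) (volume : Measure Plane)) =
    ∫⁻ k, G ((2 * Real.pi)⁻¹ • k) := h3
  rw [← h5, h4, lintegral_smul_measure, smul_eq_mul]
  congr 2
  rw [abs_of_pos (by positivity)]
  simp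
  field_simp

/-! ### Difference quotients of the Poisson semigroup -/

theorem integral_inner_harmExt {u : Plane → Plane}
    (hu : MemLp (complexify u) 2 (volume : Measure Plane)) {h : ℝ} (hh : 0 < h) :
    ∫ x, inner ℝ (harmExt u (x, -h)) (u x) =
      ∫ ξ, Real.exp (-(2 * Real.pi * h * ‖ξ‖)) * ‖hat hu ξ‖ ^ 2 := by
  have hs : -h < 0 := by linarith
  obtain ⟨h1, h2⟩ := waveAmp_memLp (m := fun _ => 1) continuous_const (C := 1)
    (fun ξ => by simp) (hat hu) hs
  have hv : ∀ x, 𝓕⁻ (waveAmp (fun _ => 1) (hat hu) (-h)) x = complexMap (harmExt u (x, -h)) := by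
    intro x
    rw [fourierInv_waveAmp, harmExt_eq_wave hu (z := (x, -h)) hs]
    simp only [mul_one]
  have hre : ∀ a b : Plane, inner ℂ (complexMap a) (complexMap b) = ((inner ℝ a b : ℝ) : ℂ) := by
    intro a b
    simp [complexMap, PiLp.inner_apply]
  have key := Lp.inner_fourier_eq (𝓕⁻ (h2.toLp _) : Lp CPlane 2 (volume : Measure Plane)) hu.toLp
  rw [FourierTransform.fourier_fourierInv_eq, L2.inner_def, L2.inner_def] at key
  have hL : ∫ x, inner ℂ ((𝓕⁻ (h2.toLp _) : Lp CPlane 2 (volume : Measure Plane)) x)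
      (hu.toLp (complexify u) x) = ((∫ x, inner ℝ (harmExt u (x, -h)) (u x) : ℝ) : ℂ) := by
    rw [← integral_complex_ofReal]
    refine integral_congr_ae ?_
    filter_upwards [Lp.fourierInv_toLp_ae h1 h2, hu.coeFn_toLp] with x hx hx'
    rw [hx, hx', hv, complexify_eq, hre]
  have hR : ∫ x, inner ℂ (h2.toLp (waveAmp (fun _ => 1) (hat hu) (-h)) x) (hat hu x) =
      ((∫ ξ, Real.exp (-(2 * Real.pi * h * ‖ξ‖)) * ‖hat hu ξ‖ ^ 2 : ℝ) : ℂ) := by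
    rw [← integral_complex_ofReal]
    refine integral_congr_ae ?_
    filter_upwards [h2.coeFn_toLp] with x hx
    rw [hx, waveAmp, one_mul, inner_smul_left, inner_self_eq_norm_sq_to_K, Complex.conj_ofReal]
    push_cast
    congr 2
    ring_nf
  rw [hL] at key
  exact_mod_cast key.symm.trans hR

theorem integral_norm_sq_eq {u : Plane → Plane}
    (hu : MemLp (complexify u) 2 (volume : Measure Plane)) :
    ∫ x, ‖u x‖ ^ 2 = ∫ ξ, ‖hat hu ξ‖ ^ 2 := by
  have key := Lp.inner_fourier_eq hu.toLp hu.toLp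
  rw [L2.inner_def, L2.inner_def] at key
  have hL : ∫ x, inner ℂ (hu.toLp (complexify u) x)
      (hu.toLp (complexify u) x) = ((∫ x, ‖u x‖ ^ 2 : ℝ) : ℂ) := by
    rw [← integral_complex_ofReal]
    refine integral_congr_ae ?_
    filter_upwards [hu.coeFn_toLp] with x hx
    rw [hx, inner_self_eq_norm_sq_to_K, complexify_eq, LinearIsometry.norm_map]
    simp
  have hR : ∫ x, inner ℂ (hat hu x) (hat hu x) = ((∫ ξ, ‖hat hu ξ‖ ^ 2 : ℝ) : ℂ) := by
    rw [← integral_complex_ofReal]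
    refine integral_congr_ae (.of_forall fun ξ => ?_)
    dsimp only
    rw [inner_self_eq_norm_sq_to_K]
    simp
  rw [hL] at key
  exact_mod_cast key.symm.trans hR

theorem integrable_energy {u : Plane → Plane}
    (hu : MemLp (complexify u) 2 (volume : Measure Plane)) (hE : dirichletEnergy u < ∞) :
    Integrable (fun ξ => 2 * Real.pi * ‖ξ‖ * ‖hat hu ξ‖ ^ 2) ∧
    (dirichletEnergy u).toReal = ∫ ξ, 2 * Real.pi * ‖ξ‖ * ‖hat hu ξ‖ ^ 2 := by
  have h1 : ∀ ξ, ENNReal.ofReal (2 * Real.pi * ‖ξ‖) * ‖hat hu ξ‖ₑ ^ 2 =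
      ENNReal.ofReal (2 * Real.pi * ‖ξ‖ * ‖hat hu ξ‖ ^ 2) := by
    intro ξ
    rw [ENNReal.ofReal_mul (p := 2 * Real.pi * ‖ξ‖) (by positivity),
      ENNReal.ofReal_pow (norm_nonneg _), ofReal_norm]
  have hm : AEStronglyMeasurable (fun ξ => 2 * Real.pi * ‖ξ‖ * ‖hat hu ξ‖ ^ 2) volume :=
    (show Continuous (fun ξ : Plane => 2 * Real.pi * ‖ξ‖) by fun_prop).aestronglyMeasurable.mul
      ((Lp.aestronglyMeasurable (hat hu)).norm.pow 2)
  have h0 : 0 ≤ᵐ[volume] (fun ξ => 2 * Real.pi * ‖ξ‖ * ‖hat hu ξ‖ ^ 2) :=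
    .of_forall fun ξ => by positivity
  rw [dirichletEnergy_eq hu] at hE ⊢
  simp_rw [h1] at hE ⊢
  refine ⟨⟨hm, ?_⟩, ?_⟩
  · rw [hasFiniteIntegral_iff_ofReal h0]; exact hE
  · rw [integral_eq_lintegral_of_nonneg_ae h0 hm]

/-- On the Fourier side the quotient has symbol `(1 - e^{-hλ})/h` with `λ = 2π|ξ|`. It tends to `λ`
and is bounded by `λ`, so finite energy supplies the dominating function. -/
theorem tendsto_quotient_energy {u : Plane → Plane}
    (hu : MemLp (complexify u) 2 (volume : Measure Plane)) (hE : dirichletEnergy u < ∞) :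
    Tendsto (fun h => h⁻¹ * ((∫ x, inner ℝ (u x) (u x)) - ∫ x, inner ℝ (harmExt u (x, -h)) (u x)))
      (𝓝[>] 0) (𝓝 (dirichletEnergy u).toReal) := by
  obtain ⟨hi, he⟩ := integrable_energy hu hE
  rw [he]
  have hsq : Integrable (fun ξ => ‖hat hu ξ‖ ^ 2) := (Lp.memLp (hat hu)).integrable_norm_pow (by norm_num)
  have hexp : ∀ {h : ℝ}, 0 < h → ∀ ξ : Plane, Real.exp (-(2 * Real.pi * h * ‖ξ‖)) ≤ 1 := by
    intro h hh ξ
    rw [Real.exp_le_one_iff, neg_nonpos]; positivity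
  have h1 : ∀ h ∈ Ioi (0:ℝ), h⁻¹ * ((∫ x, inner ℝ (u x) (u x)) - ∫ x, inner ℝ (harmExt u (x, -h)) (u x)) =
      ∫ ξ, h⁻¹ * (1 - Real.exp (-(2 * Real.pi * h * ‖ξ‖))) * ‖hat hu ξ‖ ^ 2 := by
    intro h hh
    have hh' : 0 < h := hh
    have hi2 : Integrable (fun ξ => Real.exp (-(2 * Real.pi * h * ‖ξ‖)) * ‖hat hu ξ‖ ^ 2) := by
      refine hsq.bdd_mul (c := 1)
        (show Continuous (fun ξ : Plane => Real.exp (-(2 * Real.pi * h * ‖ξ‖))) by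
          fun_prop).aestronglyMeasurable (.of_forall fun ξ => ?_)
      rw [Real.norm_of_nonneg (Real.exp_pos _).le]
      exact hexp hh' ξ
    simp_rw [real_inner_self_eq_norm_sq]
    rw [integral_inner_harmExt hu hh, integral_norm_sq_eq hu, ← integral_sub hsq hi2,
      ← integral_const_mul]
    congr 1
    ext ξ
    ring
  refine Tendsto.congr' (f₁ := fun h => ∫ ξ, h⁻¹ * (1 - Real.exp (-(2 * Real.pi * h * ‖ξ‖))) *
    ‖hat hu ξ‖ ^ 2) ?_ ?_
  · filter_upwards [self_mem_nhdsWithin] with h hh using (h1 h hh).symm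
  refine tendsto_integral_filter_of_dominated_convergence _ ?_ ?_ hi ?_
  · refine .of_forall fun h => ?_
    exact (show Continuous (fun ξ : Plane => h⁻¹ * (1 - Real.exp (-(2 * Real.pi * h * ‖ξ‖)))) by
      fun_prop).aestronglyMeasurable.mul ((Lp.aestronglyMeasurable (hat hu)).norm.pow 2)
  · filter_upwards [self_mem_nhdsWithin] with h hh
    have hh' : 0 < h := hh
    refine .of_forall fun ξ => ?_
    have h2 := hexp hh' ξ
    rw [Real.norm_of_nonneg (by
      have := sub_nonneg.2 h2
      positivity)]
    refine mul_le_mul_of_nonneg_right ?_ (by positivity)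
    rw [inv_mul_le_iff₀ hh']
    have := Real.add_one_le_exp (-(2 * Real.pi * h * ‖ξ‖))
    linarith
  · refine .of_forall fun ξ => ?_
    refine Tendsto.mul_const _ ?_
    have hd : HasDerivAt (fun h : ℝ => Real.exp (-(2 * Real.pi * h * ‖ξ‖))) (-(2 * Real.pi * ‖ξ‖)) 0 := by
      have := (((hasDerivAt_id (0:ℝ)).const_mul (2 * Real.pi)).mul_const ‖ξ‖).neg.exp
      simpa using! this
    have := (hasDerivAt_iff_tendsto_slope_zero.1 hd).mono_left
      (nhdsWithin_mono 0 (show Ioi (0:ℝ) ⊆ {0}ᶜ from fun x hx => (mem_Ioi.1 hx).ne'))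
    have h3 := this.neg
    rw [neg_neg] at h3
    refine h3.congr fun h => ?_
    simp
    ring

theorem memLp_complexify {u : Plane → Plane} (hu : MemLp u 2) :
    MemLp (complexify u) 2 (volume : Measure Plane) :=
  complexMap.toContinuousLinearMap.comp_memLp' hu

/-! ### The Dirichlet energy as a singular double integral -/

/-- The singular kernel `|x - y|⁻³`. -/
def kern (q : Plane × Plane) : ℝ := (‖q.1 - q.2‖ ^ 3)⁻¹

/-- The nonnegative function `|f x - f y|² / |x - y|³`. -/
def gag (f : Plane → Plane) (q : Plane × Plane) : ℝ := kern q * ‖f q.1 - f q.2‖ ^ 2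

theorem kern_nonneg (q : Plane × Plane) : 0 ≤ kern q := by unfold kern; positivity

theorem measurable_kern : Measurable kern := by unfold kern; fun_prop

theorem integrable_poisson_mul {a b : Plane → Plane} (ha : MemLp a 2) (hb : MemLp b 2)
    {h : ℝ} (hh : 0 < h) :
    Integrable (fun q : Plane × Plane => poisson h (q.1 - q.2) * (‖a q.1‖ ^ 2 + ‖b q.2‖ ^ 2)) := by
  have hP := integrable_poisson hh
  have key : ∀ {c : Plane → Plane}, MemLp c 2 →
      Integrable (fun q : Plane × Plane => poisson h (q.1 - q.2) * ‖c q.2‖ ^ 2) := by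
    intro c hc
    have h1 : Integrable (fun x => ‖c x‖ ^ 2) := hc.integrable_norm_pow (by norm_num)
    have h2 := h1.convolution_integrand (ContinuousLinearMap.mul ℝ ℝ) hP
    rw [Measure.volume_eq_prod]
    refine h2.congr (.of_forall fun q => ?_)
    simp [mul_comm]
  have h1 := (key ha).swap
  have h2 := h1.add (key hb)
  refine h2.congr (.of_forall fun q => ?_)
  have : poisson h (q.2 - q.1) = poisson h (q.1 - q.2) := by rw [← neg_sub, poisson_neg]
  simp [this]
  ring

theorem integrable_poisson_inner {a b : Plane → Plane} (ha : MemLp a 2) (hb : MemLp b 2)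
    {h : ℝ} (hh : 0 < h) :
    Integrable (fun q : Plane × Plane => poisson h (q.1 - q.2) * inner ℝ (a q.1) (b q.2)) := by
  refine (integrable_poisson_mul ha hb hh).mono' ?_ (.of_forall fun q => ?_)
  · have := continuous_poisson hh
    refine (show Continuous (fun q : Plane × Plane => poisson h (q.1 - q.2)) by
      fun_prop).aestronglyMeasurable.mul ?_
    exact (ha.1.comp_quasiMeasurePreserving Measure.quasiMeasurePreserving_fst).inner
      (hb.1.comp_quasiMeasurePreserving Measure.quasiMeasurePreserving_snd)
  · rw [norm_mul, Real.norm_of_nonneg (poisson_nonneg hh.le _)]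
    have := poisson_nonneg hh.le (q.1 - q.2)
    gcongr
    refine (norm_inner_le_norm _ _).trans ?_
    nlinarith [sq_nonneg (‖a q.1‖ - ‖b q.2‖), sq_nonneg (‖a q.1‖ + ‖b q.2‖)]

theorem integrable_inner_of_memLp {a b : Plane → Plane} (ha : MemLp a 2) (hb : MemLp b 2) :
    Integrable (fun x => inner ℝ (a x) (b x)) :=
  (ha.norm.integrable_mul hb.norm).mono' (ha.1.inner hb.1)
    (.of_forall fun x => norm_inner_le_norm (a x) (b x))

theorem integrable_poisson_inner_diag {a b : Plane → Plane} (ha : MemLp a 2) (hb : MemLp b 2)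
    {h : ℝ} (hh : 0 < h) :
    Integrable (fun q : Plane × Plane => poisson h (q.1 - q.2) * inner ℝ (a q.2) (b q.2)) := by
  have hP := integrable_poisson hh
  have h1 : Integrable (fun x => inner ℝ (a x) (b x)) := integrable_inner_of_memLp ha hb
  have h2 := h1.convolution_integrand (ContinuousLinearMap.mul ℝ ℝ) hP
  rw [Measure.volume_eq_prod]
  refine h2.congr (.of_forall fun q => ?_)
  simp [mul_comm]

theorem poisson_sub_comm (h : ℝ) (x y : Plane) : poisson h (y - x) = poisson h (x - y) := by
  rw [← neg_sub, poisson_neg]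

theorem integral_poisson_sub {h : ℝ} (hh : 0 < h) (y : Plane) : ∫ x, poisson h (x - y) = 1 := by
  rw [integral_sub_right_eq_self (poisson h) y, integral_poisson hh]

theorem integrable_poisson_smul {u : Plane → Plane} (hu : MemLp u 2) {h : ℝ} (hh : 0 < h)
    (x : Plane) : Integrable (fun y => poisson h (x - y) • u y) := by
  have hP2 : MemLp (poisson h) 2 := by
    rw [memLp_two_iff_integrable_sq (continuous_poisson hh).aestronglyMeasurable]
    have : ∀ x, ‖poisson h x‖ ≤ h / (2 * Real.pi) * (h ^ 3)⁻¹ := by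
      intro x
      rw [Real.norm_of_nonneg (poisson_nonneg hh.le x), poisson]
      gcongr
      exact Real.le_sqrt_of_sq_le (by nlinarith [sq_nonneg ‖x‖])
    simp_rw [sq]
    exact (integrable_poisson hh).bdd_mul (continuous_poisson hh).aestronglyMeasurable
      (.of_forall this)
  have h2 : MemLp (fun y => poisson h (x - y)) 2 :=
    hP2.comp_measurePreserving (Measure.measurePreserving_sub_left volume x)
  rw [← memLp_one_iff_integrable]
  exact MemLp.smul (p := 2) (q := 2) hu h2

/-- The polarized Dirichlet form of the Poisson semigroup, written with differences. -/
theorem poisson_form_eq {u φ : Plane → Plane} (hu : MemLp u 2) (hφ : MemLp φ 2)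
    {h : ℝ} (hh : 0 < h) :
    (∫ x, inner ℝ (u x) (φ x)) - ∫ x, inner ℝ (harmExt u (x, -h)) (φ x) =
      (1 / 2) * ∫ q : Plane × Plane, poisson h (q.1 - q.2) *
        inner ℝ (u q.1 - u q.2) (φ q.1 - φ q.2) := by
  have i1 := integrable_poisson_inner_diag hu hφ hh
  have i2 := integrable_poisson_inner hu hφ hh
  have i1' : Integrable (fun q : Plane × Plane => poisson h (q.1 - q.2) * inner ℝ (u q.1) (φ q.1)) := by
    refine i1.swap.congr (.of_forall fun q => ?_)
    simp [poisson_sub_comm h q.1 q.2]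
  have i2' : Integrable (fun q : Plane × Plane => poisson h (q.1 - q.2) * inner ℝ (u q.2) (φ q.1)) := by
    refine i2.swap.congr (.of_forall fun q => ?_)
    simp [poisson_sub_comm h q.1 q.2]
  have e1 : ∫ q : Plane × Plane, poisson h (q.1 - q.2) * inner ℝ (u q.2) (φ q.2) =
      ∫ x, inner ℝ (u x) (φ x) := by
    rw [Measure.volume_eq_prod] at i1 ⊢
    rw [integral_prod_symm _ i1]
    refine integral_congr_ae (.of_forall fun y => ?_)
    dsimp only
    rw [integral_mul_const, integral_poisson_sub hh, one_mul]
  have e1' : ∫ q : Plane × Plane, poisson h (q.1 - q.2) * inner ℝ (u q.1) (φ q.1) =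
      ∫ x, inner ℝ (u x) (φ x) := by
    rw [← e1, Measure.volume_eq_prod, ← integral_prod_swap]
    refine integral_congr_ae (.of_forall fun q => ?_)
    simp [poisson_sub_comm h q.1 q.2]
  have e2' : ∫ q : Plane × Plane, poisson h (q.1 - q.2) * inner ℝ (u q.2) (φ q.1) =
      ∫ x, inner ℝ (harmExt u (x, -h)) (φ x) := by
    rw [Measure.volume_eq_prod] at i2' ⊢
    rw [integral_prod _ i2']
    refine integral_congr_ae (.of_forall fun x => ?_)
    dsimp only
    rw [harmExt_neg_eq, real_inner_comm, ← integral_inner (integrable_poisson_smul hu hh x)]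
    refine integral_congr_ae (.of_forall fun y => ?_)
    dsimp only
    rw [inner_smul_right, real_inner_comm]
  have e2 : ∫ q : Plane × Plane, poisson h (q.1 - q.2) * inner ℝ (u q.1) (φ q.2) =
      ∫ x, inner ℝ (harmExt u (x, -h)) (φ x) := by
    rw [← e2', Measure.volume_eq_prod, ← integral_prod_swap]
    refine integral_congr_ae (.of_forall fun q => ?_)
    simp [poisson_sub_comm h q.1 q.2]
  -- Expanding the product of differences gives two diagonal terms, each `∫ u·φ` because the kernel
  -- has mass one, and two cross terms, each `∫ P_h u·φ` because the kernel is even. Hence the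
  -- factor `1/2`.
  have e : ∀ q : Plane × Plane, poisson h (q.1 - q.2) * inner ℝ (u q.1 - u q.2) (φ q.1 - φ q.2) =
      (poisson h (q.1 - q.2) * inner ℝ (u q.1) (φ q.1) +
        poisson h (q.1 - q.2) * inner ℝ (u q.2) (φ q.2)) -
      (poisson h (q.1 - q.2) * inner ℝ (u q.1) (φ q.2) +
        poisson h (q.1 - q.2) * inner ℝ (u q.2) (φ q.1)) := by
    intro q
    simp only [inner_sub_left, inner_sub_right]
    ring
  simp_rw [e]
  have e3 := integral_sub (i1'.add i1) (i2.add i2')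
  simp only [Pi.add_apply] at e3
  rw [e3, integral_add i1' i1, integral_add i2 i2', e1, e1', e2,
    e2']
  ring

theorem poisson_div_le {h : ℝ} (hh : 0 < h) (q : Plane × Plane) (hq : q.1 ≠ q.2) :
    h⁻¹ * poisson h (q.1 - q.2) ≤ (2 * Real.pi)⁻¹ * kern q := by
  have hn : 0 < ‖q.1 - q.2‖ := norm_pos_iff.2 (sub_ne_zero.2 hq)
  rw [poisson, kern, div_mul_eq_mul_div, ← mul_div_assoc, inv_mul_cancel_left₀ hh.ne', inv_mul_eq_div]
  gcongr
  exact Real.le_sqrt_of_sq_le (by nlinarith [sq_nonneg h])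

theorem tendsto_poisson_div (q : Plane × Plane) (hq : q.1 ≠ q.2) :
    Tendsto (fun h => h⁻¹ * poisson h (q.1 - q.2)) (𝓝[>] 0) (𝓝 ((2 * Real.pi)⁻¹ * kern q)) := by
  have hn : 0 < ‖q.1 - q.2‖ := norm_pos_iff.2 (sub_ne_zero.2 hq)
  have h1 : Tendsto (fun h : ℝ => (2 * Real.pi)⁻¹ * ((Real.sqrt (‖q.1 - q.2‖ ^ 2 + h ^ 2)) ^ 3)⁻¹)
      (𝓝 0) (𝓝 ((2 * Real.pi)⁻¹ * ((Real.sqrt (‖q.1 - q.2‖ ^ 2 + 0 ^ 2)) ^ 3)⁻¹)) := by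
    refine ContinuousAt.tendsto ?_
    refine continuousAt_const.mul (ContinuousAt.inv₀ (by fun_prop) ?_)
    have : 0 < Real.sqrt (‖q.1 - q.2‖ ^ 2 + 0 ^ 2) := Real.sqrt_pos.2 (by positivity)
    positivity
  have h2 : Real.sqrt (‖q.1 - q.2‖ ^ 2 + 0 ^ 2) = ‖q.1 - q.2‖ := by
    simp [Real.sqrt_sq hn.le]
  rw [h2] at h1
  refine (h1.mono_left nhdsWithin_le_nhds).congr' ?_
  filter_upwards [self_mem_nhdsWithin] with h hh
  have hh' : h ≠ 0 := (mem_Ioi.1 hh).ne'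
  rw [poisson, div_mul_eq_mul_div, ← mul_div_assoc, inv_mul_cancel_left₀ hh', inv_mul_eq_div]

theorem aestronglyMeasurable_diff {f : Plane → Plane} (hf : AEStronglyMeasurable f volume) :
    AEStronglyMeasurable (fun q : Plane × Plane => f q.1 - f q.2) volume :=
  (hf.comp_quasiMeasurePreserving Measure.quasiMeasurePreserving_fst).sub
      (hf.comp_quasiMeasurePreserving Measure.quasiMeasurePreserving_snd)

theorem aestronglyMeasurable_gag {f : Plane → Plane} (hf : AEStronglyMeasurable f volume) :
    AEStronglyMeasurable (gag f) volume :=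
  measurable_kern.aestronglyMeasurable.mul ((aestronglyMeasurable_diff hf).norm.pow 2)

theorem gag_nonneg (f : Plane → Plane) (q : Plane × Plane) : 0 ≤ gag f q :=
  mul_nonneg (kern_nonneg q) (by positivity)

/-- Fatou along a sequence of heights `t n → 0`: `2π (t n)⁻¹ poisson (t n)` tends to the singular
kernel off the diagonal, while the approximating integrals are `4π` times the difference quotients
and converge to `4π` times the energy. -/
theorem integrable_gag {u : Plane → Plane} (hu : MemLp u 2) (hE : dirichletEnergy u < ∞) :
    Integrable (gag u) := by
  refine ⟨aestronglyMeasurable_gag hu.1, ?_⟩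
  rw [hasFiniteIntegral_iff_ofReal (.of_forall (gag_nonneg u))]
  set t : ℕ → ℝ := fun n => 1 / ((n:ℝ) + 1) with ht
  have ht0 : ∀ n, 0 < t n := fun n => by simp only [ht]; positivity
  have htl : Tendsto t atTop (𝓝[>] 0) :=
    tendsto_nhdsWithin_iff.2 ⟨tendsto_one_div_add_atTop_nhds_zero_nat, .of_forall ht0⟩
  set G : ℕ → Plane × Plane → ℝ := fun n q =>
    2 * Real.pi * ((t n)⁻¹ * poisson (t n) (q.1 - q.2)) * ‖u q.1 - u q.2‖ ^ 2 with hG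
  have hG0 : ∀ n q, 0 ≤ G n q := by
    intro n q
    have := poisson_nonneg (ht0 n).le (q.1 - q.2)
    have := (ht0 n).le
    simp only [hG]; positivity
  have hlim : ∀ q, Tendsto (fun n => ENNReal.ofReal (G n q)) atTop (𝓝 (ENNReal.ofReal (gag u q))) := by
    intro q
    refine (ENNReal.continuous_ofReal.tendsto _).comp ?_
    rcases eq_or_ne q.1 q.2 with h | h
    · simp [hG, gag, h]
    · have h1 := (((tendsto_poisson_div q h).comp htl).const_mul (2 * Real.pi)).mul_const
        (‖u q.1 - u q.2‖ ^ 2)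
      rw [mul_inv_cancel_left₀ (by positivity)] at h1
      exact h1
  have hGi : ∀ n, Integrable (G n) ∧ ∫ q, G n q = 4 * Real.pi * ((t n)⁻¹ *
      ((∫ x, inner ℝ (u x) (u x)) - ∫ x, inner ℝ (harmExt u (x, -(t n))) (u x))) := by
    intro n
    have h1 := poisson_form_eq hu hu (ht0 n)
    have hGe : G n = fun q => (2 * Real.pi * (t n)⁻¹) * (poisson (t n) (q.1 - q.2) *
        inner ℝ (u q.1 - u q.2) (u q.1 - u q.2)) := by
      ext q
      simp only [hG, real_inner_self_eq_norm_sq]; ring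
    refine ⟨?_, ?_⟩
    · rw [hGe]
      refine Integrable.const_mul ?_ _
      refine ((integrable_poisson_mul hu hu (ht0 n)).const_mul 2).mono' ?_ (.of_forall fun q => ?_)
      · have := continuous_poisson (ht0 n)
        exact (show Continuous (fun q : Plane × Plane => poisson (t n) (q.1 - q.2)) by
          fun_prop).aestronglyMeasurable.mul
            ((aestronglyMeasurable_diff hu.1).inner (aestronglyMeasurable_diff hu.1))
      · have h0 := poisson_nonneg (ht0 n).le (q.1 - q.2)
        rw [real_inner_self_eq_norm_sq, Real.norm_of_nonneg (by positivity)]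
        have : ‖u q.1 - u q.2‖ ^ 2 ≤ 2 * (‖u q.1‖ ^ 2 + ‖u q.2‖ ^ 2) := by
          have := norm_sub_le (u q.1) (u q.2)
          nlinarith [norm_nonneg (u q.1 - u q.2), sq_nonneg (‖u q.1‖ - ‖u q.2‖)]
        nlinarith
    · rw [hGe, integral_const_mul, h1]; ring
  have hconv := ((tendsto_quotient_energy (memLp_complexify hu) hE).comp htl).const_mul (4 * Real.pi)
  calc ∫⁻ q, ENNReal.ofReal (gag u q)
      = ∫⁻ q, liminf (fun n => ENNReal.ofReal (G n q)) atTop :=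
        lintegral_congr fun q => (hlim q).liminf_eq.symm
    _ ≤ liminf (fun n => ∫⁻ q, ENNReal.ofReal (G n q)) atTop :=
        lintegral_liminf_le' fun n => (hGi n).1.1.aemeasurable.ennreal_ofReal
    _ = ENNReal.ofReal (4 * Real.pi * (dirichletEnergy u).toReal) := by
        refine Tendsto.liminf_eq ?_
        refine ((ENNReal.continuous_ofReal.tendsto _).comp hconv).congr fun n => ?_
        rw [← ofReal_integral_eq_lintegral_ofReal (hGi n).1 (.of_forall (hG0 n)), (hGi n).2]
        rfl
    _ < ∞ := ENNReal.ofReal_lt_top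

/-- The bilinear form `(1 / 4π) ∬ (u x - u y) · (φ x - φ y) / |x - y|³`. -/
def bform (u φ : Plane → Plane) : ℝ :=
  (4 * Real.pi)⁻¹ * ∫ q : Plane × Plane, kern q * inner ℝ (u q.1 - u q.2) (φ q.1 - φ q.2)

theorem norm_kern_inner_le (u φ : Plane → Plane) (q : Plane × Plane) :
    ‖kern q * inner ℝ (u q.1 - u q.2) (φ q.1 - φ q.2)‖ ≤ gag u q + gag φ q := by
  rw [norm_mul, Real.norm_of_nonneg (kern_nonneg q), gag, gag, ← mul_add]
  refine mul_le_mul_of_nonneg_left ((norm_inner_le_norm _ _).trans ?_) (kern_nonneg q)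
  nlinarith [sq_nonneg (‖u q.1 - u q.2‖ - ‖φ q.1 - φ q.2‖), sq_nonneg (‖u q.1 - u q.2‖),
    sq_nonneg (‖φ q.1 - φ q.2‖)]

/-- Since `h⁻¹ poisson h` stays below its limit `(2π)⁻¹ |x - y|⁻³`, the integrands are dominated by
a multiple of `gag u + gag φ`. -/
theorem tendsto_quotient_bform {u φ : Plane → Plane} (hu : MemLp u 2) (hφ : MemLp φ 2)
    (hgu : Integrable (gag u)) (hgφ : Integrable (gag φ)) :
    Tendsto (fun h => h⁻¹ * ((∫ x, inner ℝ (u x) (φ x)) - ∫ x, inner ℝ (harmExt u (x, -h)) (φ x)))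
      (𝓝[>] 0) (𝓝 (bform u φ)) := by
  have hd : AEStronglyMeasurable (fun q : Plane × Plane =>
      inner ℝ (u q.1 - u q.2) (φ q.1 - φ q.2)) volume :=
    (aestronglyMeasurable_diff hu.1).inner (aestronglyMeasurable_diff hφ.1)
  have h1 : ∀ h ∈ Ioi (0:ℝ), h⁻¹ * ((∫ x, inner ℝ (u x) (φ x)) -
      ∫ x, inner ℝ (harmExt u (x, -h)) (φ x)) =
      ∫ q : Plane × Plane, (1 / 2) * (h⁻¹ * poisson h (q.1 - q.2)) *
        inner ℝ (u q.1 - u q.2) (φ q.1 - φ q.2) := by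
    intro h hh
    rw [poisson_form_eq hu hφ hh, ← integral_const_mul, ← integral_const_mul]
    congr 1
    ext q
    ring
  have h2 : bform u φ = ∫ q : Plane × Plane, (1 / 2) * ((2 * Real.pi)⁻¹ * kern q) *
        inner ℝ (u q.1 - u q.2) (φ q.1 - φ q.2) := by
    rw [bform, ← integral_const_mul]
    congr 1
    ext q
    field_simp
    ring
  rw [h2]
  refine Tendsto.congr' (f₁ := fun h => ∫ q : Plane × Plane, (1 / 2) * (h⁻¹ * poisson h (q.1 - q.2)) *
        inner ℝ (u q.1 - u q.2) (φ q.1 - φ q.2)) ?_ ?_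
  · filter_upwards [self_mem_nhdsWithin] with h hh using (h1 h hh).symm
  refine tendsto_integral_filter_of_dominated_convergence
    (fun q => (1 / 2) * (2 * Real.pi)⁻¹ * (gag u q + gag φ q)) ?_ ?_ ((hgu.add hgφ).const_mul _) ?_
  · filter_upwards [self_mem_nhdsWithin] with h hh
    have := continuous_poisson hh
    exact (show Continuous (fun q : Plane × Plane => (1 / 2) * (h⁻¹ * poisson h (q.1 - q.2))) by
      fun_prop).aestronglyMeasurable.mul hd
  · filter_upwards [self_mem_nhdsWithin] with h hh
    refine .of_forall fun q => ?_
    rcases eq_or_ne q.1 q.2 with hq | hq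
    · rw [hq]
      have := gag_nonneg u q
      have := gag_nonneg φ q
      simp only [sub_self, inner_zero_left, mul_zero, norm_zero]
      positivity
    · have h3 := poisson_div_le hh q hq
      have h4 := poisson_nonneg (mem_Ioi.1 hh).le (q.1 - q.2)
      have h5 : 0 ≤ h⁻¹ := inv_nonneg.2 (mem_Ioi.1 hh).le
      have h6 := norm_kern_inner_le u φ q
      rw [norm_mul, Real.norm_of_nonneg (kern_nonneg q)] at h6
      rw [norm_mul, Real.norm_of_nonneg (by positivity)]
      calc 1 / 2 * (h⁻¹ * poisson h (q.1 - q.2)) * ‖inner ℝ (u q.1 - u q.2) (φ q.1 - φ q.2)‖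
          ≤ 1 / 2 * ((2 * Real.pi)⁻¹ * kern q) * ‖inner ℝ (u q.1 - u q.2) (φ q.1 - φ q.2)‖ := by
            gcongr
        _ = 1 / 2 * (2 * Real.pi)⁻¹ * (kern q * ‖inner ℝ (u q.1 - u q.2) (φ q.1 - φ q.2)‖) := by ring
        _ ≤ _ := by gcongr
  · refine .of_forall fun q => ?_
    rcases eq_or_ne q.1 q.2 with hq | hq
    · simp [hq]
    · exact ((tendsto_poisson_div q hq).const_mul _).mul_const _

theorem bform_self {u : Plane → Plane} (hu : MemLp u 2) (hE : dirichletEnergy u < ∞) :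
    bform u u = (dirichletEnergy u).toReal :=
  tendsto_nhds_unique (tendsto_quotient_bform hu hu (integrable_gag hu hE) (integrable_gag hu hE))
    (tendsto_quotient_energy (memLp_complexify hu) hE)

/-! ### Cutoffs in the singular form -/

theorem gag_cutoff_le {χ : Plane → ℝ} (h0 : ∀ x, 0 ≤ χ x) (h1 : ∀ x, χ x ≤ 1) (u : Plane → Plane)
    (q : Plane × Plane) :
    gag (fun x => χ x • u x) q ≤
      2 * gag u q + 2 * (kern q * (χ q.1 - χ q.2) ^ 2 * ‖u q.2‖ ^ 2) := by
  have e : χ q.1 • u q.1 - χ q.2 • u q.2 = χ q.1 • (u q.1 - u q.2) + (χ q.1 - χ q.2) • u q.2 := by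
    module
  have hn : ‖χ q.1 • u q.1 - χ q.2 • u q.2‖ ≤ ‖u q.1 - u q.2‖ + |χ q.1 - χ q.2| * ‖u q.2‖ := by
    rw [e]
    refine (norm_add_le _ _).trans ?_
    rw [norm_smul, norm_smul, Real.norm_of_nonneg (h0 _), Real.norm_eq_abs]
    gcongr
    exact mul_le_of_le_one_left (norm_nonneg _) (h1 _)
  have hsq : ‖χ q.1 • u q.1 - χ q.2 • u q.2‖ ^ 2 ≤
      2 * ‖u q.1 - u q.2‖ ^ 2 + 2 * ((χ q.1 - χ q.2) ^ 2 * ‖u q.2‖ ^ 2) := by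
    have h3 : (|χ q.1 - χ q.2| * ‖u q.2‖) ^ 2 = (χ q.1 - χ q.2) ^ 2 * ‖u q.2‖ ^ 2 := by
      rw [mul_pow, sq_abs]
    rw [← h3]
    refine (pow_le_pow_left₀ (norm_nonneg _) hn 2).trans ?_
    nlinarith [sq_nonneg (‖u q.1 - u q.2‖ - |χ q.1 - χ q.2| * ‖u q.2‖)]
  simp only [gag]
  calc kern q * ‖χ q.1 • u q.1 - χ q.2 • u q.2‖ ^ 2
      ≤ kern q * (2 * ‖u q.1 - u q.2‖ ^ 2 + 2 * ((χ q.1 - χ q.2) ^ 2 * ‖u q.2‖ ^ 2)) :=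
        mul_le_mul_of_nonneg_left hsq (kern_nonneg q)
    _ = _ := by ring

/-- The commutator energies of the cutoffs are only assumed bounded. The integrand of the error
vanishes where both values of `χ n` are `1`; elsewhere Young's inequality with a parameter `l`
bounds it by `(1 + l⁻¹) gag u` plus `l` times the commutator density. The first integral tends to
`0` by dominated convergence, the second is at most `l C`, and `l` is arbitrary. -/
theorem tendsto_bform_cutoff {u : Plane → Plane} (hu : MemLp u 2) (hg : Integrable (gag u))
    {χ : ℕ → Plane → ℝ} (hχm : ∀ n, Measurable (χ n)) (h0 : ∀ n x, 0 ≤ χ n x)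
    (h1 : ∀ n x, χ n x ≤ 1) {C : ℝ} (hC0 : 0 ≤ C)
    (hC : ∀ n, ∫⁻ q : Plane × Plane,
      ENNReal.ofReal (kern q * (χ n q.1 - χ n q.2) ^ 2 * ‖u q.2‖ ^ 2) ≤ ENNReal.ofReal C)
    (hae : ∀ᵐ x, ∀ᶠ n in atTop, χ n x = 1) :
    (∀ n, MemLp (fun x => χ n x • u x) 2 ∧ Integrable (gag (fun x => χ n x • u x))) ∧
      Tendsto (fun n => bform u (fun x => χ n x • u x)) atTop (𝓝 (bform u u)) := by
  have hmem : ∀ n, MemLp (fun x => χ n x • u x) 2 := by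
    intro n
    refine hu.of_le ((hχm n).aestronglyMeasurable.smul hu.1) (.of_forall fun x => ?_)
    rw [norm_smul, Real.norm_of_nonneg (h0 n x)]
    exact mul_le_of_le_one_left (norm_nonneg _) (h1 n x)
  set R : ℕ → Plane × Plane → ℝ := fun n q => kern q * (χ n q.1 - χ n q.2) ^ 2 * ‖u q.2‖ ^ 2 with hR
  have hR0 : ∀ n q, 0 ≤ R n q := fun n q => by
    have := kern_nonneg q
    simp only [hR]; positivity
  have hRm : ∀ n, AEStronglyMeasurable (R n) volume := by
    intro n
    have h3 : Measurable (fun q : Plane × Plane => kern q * (χ n q.1 - χ n q.2) ^ 2) := by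
      have := measurable_kern
      have := hχm n
      fun_prop
    exact h3.aestronglyMeasurable.mul
      ((hu.1.comp_quasiMeasurePreserving Measure.quasiMeasurePreserving_snd).norm.pow 2)
  have hRi : ∀ n, Integrable (R n) ∧ ∫ q, R n q ≤ C := by
    intro n
    refine ⟨⟨hRm n, ?_⟩, ?_⟩
    · rw [hasFiniteIntegral_iff_ofReal (.of_forall (hR0 n))]
      exact (hC n).trans_lt ENNReal.ofReal_lt_top
    · rw [integral_eq_lintegral_of_nonneg_ae (.of_forall (hR0 n)) (hRm n)]
      exact ENNReal.toReal_le_of_le_ofReal hC0 (hC n)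
  have hgag : ∀ n, Integrable (gag (fun x => χ n x • u x)) := by
    intro n
    refine ((hg.const_mul 2).add ((hRi n).1.const_mul 2)).mono' (aestronglyMeasurable_gag (hmem n).1)
      (.of_forall fun q => ?_)
    rw [Real.norm_of_nonneg (gag_nonneg _ q)]
    exact gag_cutoff_le (h0 n) (h1 n) u q
  refine ⟨fun n => ⟨hmem n, hgag n⟩, ?_⟩
  -- The pairs at which at least one value of the cutoff differs from `1`; almost every pair
  -- eventually leaves these sets.
  set S : ℕ → Set (Plane × Plane) := fun n => {q | χ n q.1 = 1 ∧ χ n q.2 = 1}ᶜ with hS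
  have hSm : ∀ n, MeasurableSet (S n) := by
    intro n
    have := hχm n
    refine MeasurableSet.compl ?_
    exact ((measurableSet_singleton (1:ℝ)).preimage (by fun_prop : Measurable
      fun q : Plane × Plane => χ n q.1)).inter ((measurableSet_singleton (1:ℝ)).preimage
        (by fun_prop : Measurable fun q : Plane × Plane => χ n q.2))
  set I : ℕ → ℝ := fun n => ∫ q, (S n).indicator (gag u) q with hI
  have hII : ∀ n, Integrable ((S n).indicator (gag u)) := fun n => hg.indicator (hSm n)
  have hItend : Tendsto I atTop (𝓝 0) := by
    have : Tendsto I atTop (𝓝 (∫ q : Plane × Plane, (0:ℝ))) := by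
      refine tendsto_integral_of_dominated_convergence (gag u) (fun n => (hII n).1) hg
        (fun n => .of_forall fun q => ?_) ?_
      · rw [Real.norm_of_nonneg (indicator_nonneg (fun q _ => gag_nonneg u q) q)]
        exact indicator_le_self' (fun q _ => gag_nonneg u q) q
      · have e1 := Measure.quasiMeasurePreserving_fst (μ := (volume : Measure Plane))
          (ν := (volume : Measure Plane)) |>.ae hae
        have e2 := Measure.quasiMeasurePreserving_snd (μ := (volume : Measure Plane))
          (ν := (volume : Measure Plane)) |>.ae hae
        rw [Measure.volume_eq_prod]
        filter_upwards [e1, e2] with q hq1 hq2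
        refine tendsto_const_nhds.congr' ?_
        filter_upwards [hq1, hq2] with n hn1 hn2
        rw [indicator_of_notMem]
        simp [hS, hn1, hn2]
    simpa using this
  have hpt : ∀ n (l : ℝ), 0 < l → ∀ q : Plane × Plane,
      ‖kern q * inner ℝ (u q.1 - u q.2) (u q.1 - u q.2) -
        kern q * inner ℝ (u q.1 - u q.2) (χ n q.1 • u q.1 - χ n q.2 • u q.2)‖ ≤
      (1 + l⁻¹) * (S n).indicator (gag u) q + l * R n q := by
    intro n l hl q
    by_cases hq : q ∈ S n
    · rw [indicator_of_mem hq, ← mul_sub, ← inner_sub_right, norm_mul,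
        Real.norm_of_nonneg (kern_nonneg q)]
      have e : u q.1 - u q.2 - (χ n q.1 • u q.1 - χ n q.2 • u q.2) =
          (1 - χ n q.1) • (u q.1 - u q.2) - (χ n q.1 - χ n q.2) • u q.2 := by module
      have hd : ‖u q.1 - u q.2 - (χ n q.1 • u q.1 - χ n q.2 • u q.2)‖ ≤
          ‖u q.1 - u q.2‖ + |χ n q.1 - χ n q.2| * ‖u q.2‖ := by
        rw [e]
        refine (norm_sub_le _ _).trans ?_
        rw [norm_smul, norm_smul, Real.norm_of_nonneg (sub_nonneg.2 (h1 _ _)), Real.norm_eq_abs]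
        gcongr
        exact mul_le_of_le_one_left (norm_nonneg _) (by linarith [h0 n q.1])
      set d := ‖u q.1 - u q.2‖
      set r := |χ n q.1 - χ n q.2| * ‖u q.2‖ with hr
      have hRr : R n q = kern q * r ^ 2 := by
        simp only [hR, hr, mul_pow, sq_abs]; ring
      have hyoung : d * r ≤ l⁻¹ * d ^ 2 + l * r ^ 2 := by
        have h3 : 0 ≤ (l⁻¹ * d - r) ^ 2 * l := by positivity
        have h4 : (l⁻¹ * d - r) ^ 2 * l = l⁻¹ * d ^ 2 - 2 * (d * r) + l * r ^ 2 := by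
          field_simp
          ring
        have h5 : 0 ≤ l⁻¹ * d ^ 2 := by positivity
        have h6 : 0 ≤ l * r ^ 2 := by positivity
        linarith
      rw [hRr, gag]
      calc kern q * ‖(inner ℝ (u q.1 - u q.2)
            (u q.1 - u q.2 - (χ n q.1 • u q.1 - χ n q.2 • u q.2)) : ℝ)‖
          ≤ kern q * (d * (d + r)) := by
            refine mul_le_mul_of_nonneg_left ((norm_inner_le_norm _ _).trans ?_) (kern_nonneg q)
            exact mul_le_mul_of_nonneg_left hd (norm_nonneg _)
        _ ≤ kern q * ((1 + l⁻¹) * d ^ 2 + l * r ^ 2) :=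
            mul_le_mul_of_nonneg_left (by linarith) (kern_nonneg q)
        _ = _ := by ring
    · have hq' : χ n q.1 = 1 ∧ χ n q.2 = 1 := by simpa [hS] using hq
      rw [hq'.1, hq'.2, one_smul, one_smul, sub_self, norm_zero, indicator_of_notMem hq]
      have := hR0 n q
      positivity
  have hint : ∀ {φ : Plane → Plane}, MemLp φ 2 → Integrable (gag φ) →
      Integrable (fun q : Plane × Plane => kern q * inner ℝ (u q.1 - u q.2) (φ q.1 - φ q.2)) := by
    intro φ hφ hgφ
    refine (hg.add hgφ).mono' ?_ (.of_forall (norm_kern_inner_le u φ))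
    exact measurable_kern.aestronglyMeasurable.mul
      ((aestronglyMeasurable_diff hu.1).inner (aestronglyMeasurable_diff hφ.1))
  have hbd : ∀ n (l : ℝ), 0 < l → |bform u u - bform u (fun x => χ n x • u x)| ≤
      (4 * Real.pi)⁻¹ * ((1 + l⁻¹) * I n + l * C) := by
    intro n l hl
    rw [bform, bform, ← mul_sub, ← integral_sub (hint hu hg) (hint (hmem n) (hgag n)), abs_mul,
      abs_of_pos (by positivity)]
    gcongr
    rw [← Real.norm_eq_abs]
    refine (norm_integral_le_integral_norm _).trans ?_
    refine (integral_mono_of_nonneg (.of_forall fun q => norm_nonneg _)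
      (((hII n).const_mul (1 + l⁻¹)).add ((hRi n).1.const_mul l)) (.of_forall (hpt n l hl))).trans ?_
    simp only [Pi.add_apply]
    rw [integral_add ((hII n).const_mul (1 + l⁻¹)) ((hRi n).1.const_mul l), integral_const_mul,
      integral_const_mul]
    gcongr
    exact (hRi n).2
  rw [tendsto_iff_dist_tendsto_zero]
  rw [Metric.tendsto_atTop]
  intro ε hε
  -- The parameter is fixed before `n`: first `l C` is made small, then `I n` with the large factor
  -- `1 + l⁻¹`.
  obtain ⟨l, hl, hlC⟩ : ∃ l : ℝ, 0 < l ∧ (4 * Real.pi)⁻¹ * (l * C) < ε / 2 := by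
    refine ⟨ε / 2 / ((4 * Real.pi)⁻¹ * (C + 1)), by positivity, ?_⟩
    rw [← mul_assoc, mul_comm _ C, mul_div_assoc', mul_div_assoc', div_lt_iff₀ (by positivity)]
    have : 0 < (4 * Real.pi)⁻¹ * (ε / 2) := by positivity
    nlinarith
  have ht : Tendsto (fun n => (4 * Real.pi)⁻¹ * ((1 + l⁻¹) * I n)) atTop (𝓝 0) := by
    simpa using (hItend.const_mul (1 + l⁻¹)).const_mul ((4 * Real.pi)⁻¹)
  obtain ⟨N, hN⟩ := (eventually_atTop.1 (ht.eventually (gt_mem_nhds (half_pos hε))))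
  refine ⟨N, fun n hn => ?_⟩
  have := hN n hn
  have h3 := hbd n l hl
  rw [Real.dist_eq, sub_zero, abs_of_nonneg dist_nonneg, dist_comm, Real.dist_eq]
  rw [mul_add] at h3
  linarith

/-- Both bounds on the increment give the integrand `|z|⁻³ min(L|z|, 1)²`, integrable in the plane
at the origin and at infinity. Rescaling by `L` produces `L³ · L⁻² = L`, which is why the bound is
linear in the slope. -/
theorem exists_kern_lipschitz_bound : ∃ K : ℝ, 0 ≤ K ∧ ∀ (L : ℝ), 0 < L → ∀ χ : Plane → ℝ,
    (∀ x y, |χ x - χ y| ≤ 1) → (∀ x y, |χ x - χ y| ≤ L * ‖x - y‖) → ∀ y,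
    ∫⁻ x, ENNReal.ofReal (kern (x, y) * (χ x - χ y) ^ 2) ≤ ENNReal.ofReal (K * L) := by
  set f : ℝ → ℝ := fun r => (r ^ 3)⁻¹ * (min r 1) ^ 2 with hf
  have hfi : Integrable (fun z : Plane => f ‖z‖) := by
    refine (integrable_fun_norm_addHaar (volume : Measure Plane) (f := f)).2 ?_
    rw [← Ioc_union_Ioi_eq_Ioi zero_le_one]
    refine IntegrableOn.union ?_ ?_
    · refine (integrableOn_const (C := (1:ℝ)) (by simp)).congr_fun (fun r hr => ?_) measurableSet_Ioc
      have : 0 < r := hr.1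
      simp only [hf, min_eq_left hr.2, finrank_euclideanSpace, Fintype.card_fin, smul_eq_mul]
      field_simp
      norm_num
    · refine (integrableOn_Ioi_rpow_of_lt (by norm_num : (-2:ℝ) < -1) one_pos).congr_fun
        (fun r hr => ?_) measurableSet_Ioi
      have h1 : 1 < r := hr
      have : 0 < r := by linarith
      simp only [hf, min_eq_right h1.le, finrank_euclideanSpace, Fintype.card_fin, smul_eq_mul]
      rw [Real.rpow_neg this.le, Real.rpow_two]
      field_simp
      norm_num
  have hf0 : ∀ z : Plane, 0 ≤ f ‖z‖ := fun z => by simp only [hf]; positivity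
  refine ⟨∫ z : Plane, f ‖z‖, integral_nonneg hf0, fun L hL χ hχ1 hχL y => ?_⟩
  have hpt : ∀ x, kern (x, y) * (χ x - χ y) ^ 2 ≤ L ^ 3 * f ‖L • (x - y)‖ := by
    intro x
    rw [norm_smul, Real.norm_of_nonneg hL.le, kern, ← sq_abs]
    simp only [hf]
    rw [← mul_assoc, mul_pow, mul_inv, mul_inv_cancel_left₀ (by positivity)]
    gcongr
    exact le_min (hχL x y) (hχ1 x y)
  have hi : Integrable (fun x => L ^ 3 * f ‖L • (x - y)‖) := by
    have := (hfi.comp_smul hL.ne').comp_sub_right y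
    exact this.const_mul _
  have hv : ∫ x, L ^ 3 * f ‖L • (x - y)‖ = (∫ z : Plane, f ‖z‖) * L := by
    rw [integral_const_mul, integral_sub_right_eq_self (fun x => f ‖L • x‖) y,
      Measure.integral_comp_smul volume (fun x => f ‖x‖) L, finrank_euclideanSpace, Fintype.card_fin,
      abs_of_pos (by positivity), smul_eq_mul]
    field_simp
  rw [← hv, ofReal_integral_eq_lintegral_ofReal hi
    (.of_forall fun x => mul_nonneg (by positivity) (hf0 _))]
  exact lintegral_mono fun x => ENNReal.ofReal_le_ofReal (hpt x)

/-- The weighted energy of a cutoff `a * b`, where `a` is a steep cutoff that is constant off a small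
set `N` and `b` is a gentle one. -/
theorem exists_cutoff_bound : ∃ K : ℝ, 0 ≤ K ∧ ∀ (u : Plane → Plane) (M : ℝ), 0 ≤ M → MemLp u 2 →
    (∀ᵐ x, ‖u x‖ ≤ M) → ∀ (a b : Plane → ℝ) (L l : ℝ), 0 < L → 0 < l →
    (∀ x, 0 ≤ a x) → (∀ x, a x ≤ 1) → (∀ x, 0 ≤ b x) → (∀ x, b x ≤ 1) →
    (∀ x y, |a x - a y| ≤ L * ‖x - y‖) → (∀ x y, |b x - b y| ≤ l * ‖x - y‖) →
    ∀ N : Set Plane, MeasurableSet N → (∀ x ∉ N, a x = 1) →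
    ∫⁻ q : Plane × Plane, ENNReal.ofReal (kern q * (a q.1 * b q.1 - a q.2 * b q.2) ^ 2 *
      ‖u q.2‖ ^ 2) ≤ ENNReal.ofReal (4 * M ^ 2 * K * L) * volume N +
        ENNReal.ofReal (2 * K * l * ∫ x, ‖u x‖ ^ 2) := by
  obtain ⟨K, hK0, hK⟩ := exists_kern_lipschitz_bound
  refine ⟨K, hK0, fun u M hM hu huM a b L l hL hl ha0 ha1 hb0 hb1 haL hbL N hN haN => ?_⟩
  have hdiff : ∀ {c : Plane → ℝ}, (∀ x, 0 ≤ c x) → (∀ x, c x ≤ 1) → ∀ x y, |c x - c y| ≤ 1 := by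
    intro c h0 h1 x y
    rw [abs_le]
    constructor <;> linarith [h0 x, h1 x, h0 y, h1 y]
  have hcont : ∀ {c : Plane → ℝ} {r : ℝ}, 0 < r → (∀ x y, |c x - c y| ≤ r * ‖x - y‖) → Continuous c := by
    intro c r hr h
    refine (LipschitzWith.of_dist_le_mul (K := r.toNNReal) fun x y => ?_).continuous
    rw [Real.dist_eq, dist_eq_norm, Real.coe_toNNReal r hr.le]
    exact h x y
  have hac := hcont hL haL
  have hbc := hcont hl hbL
  have hmk := measurable_kern
  set A : Plane × Plane → ℝ≥0∞ := fun q => ENNReal.ofReal (kern q * (a q.1 - a q.2) ^ 2) with hA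
  set B : Plane × Plane → ℝ≥0∞ := fun q => ENNReal.ofReal (kern q * (b q.1 - b q.2) ^ 2) with hB
  have hAm : Measurable A := by fun_prop
  have hBm : Measurable B := by fun_prop
  have hum : AEMeasurable (fun x => ‖u x‖ₑ ^ 2) volume := hu.1.enorm.pow_const 2
  have hum2 : AEMeasurable (fun q : Plane × Plane => ‖u q.2‖ₑ ^ 2) (volume.prod volume) :=
    hum.comp_quasiMeasurePreserving Measure.quasiMeasurePreserving_snd
  have hkern_symm : ∀ x y, kern (x, y) = kern (y, x) := fun x y => by
    simp only [kern, norm_sub_rev]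
  have hAy : ∀ y, ∫⁻ x, A (x, y) ≤ ENNReal.ofReal (K * L) := fun y =>
    hK L hL a (hdiff ha0 ha1) haL y
  have hAx : ∀ x, ∫⁻ y, A (x, y) ≤ ENNReal.ofReal (K * L) := by
    intro x
    refine le_of_eq_of_le (lintegral_congr fun y => ?_) (hAy x)
    simp only [hA]
    rw [hkern_symm, ← neg_sub (a y), neg_sq]
  have hBy : ∀ y, ∫⁻ x, B (x, y) ≤ ENNReal.ofReal (K * l) := fun y =>
    hK l hl b (hdiff hb0 hb1) hbL y
  have hI1 : Measurable (fun q : Plane × Plane => N.indicator (1 : Plane → ℝ≥0∞) q.1) :=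
    (measurable_one.indicator hN).comp measurable_fst
  have hI2 : Measurable (fun q : Plane × Plane => N.indicator (1 : Plane → ℝ≥0∞) q.2) :=
    (measurable_one.indicator hN).comp measurable_snd
  -- An increment of `a` is nonzero only if one of the two points lies in `N`, and there `|u|` is
  -- bounded by `M`: this yields slope times area. The increment of `b` is paired with the `L²` norm
  -- of `u`.
  have hpt : ∀ᵐ q : Plane × Plane ∂(volume.prod volume), ENNReal.ofReal (kern q *
      (a q.1 * b q.1 - a q.2 * b q.2) ^ 2 * ‖u q.2‖ ^ 2) ≤
      ENNReal.ofReal (2 * M ^ 2) * (N.indicator 1 q.1 * A q) +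
      ENNReal.ofReal (2 * M ^ 2) * (N.indicator 1 q.2 * A q) + 2 * (B q * ‖u q.2‖ₑ ^ 2) := by
    filter_upwards [Measure.quasiMeasurePreserving_snd (μ := (volume : Measure Plane))
          (ν := (volume : Measure Plane)) |>.ae huM] with q hq
    have hk := kern_nonneg q
    have hsq : (a q.1 * b q.1 - a q.2 * b q.2) ^ 2 ≤
        2 * (a q.1 - a q.2) ^ 2 + 2 * (b q.1 - b q.2) ^ 2 := by
      have e : a q.1 * b q.1 - a q.2 * b q.2 = (a q.1 - a q.2) * b q.1 + a q.2 * (b q.1 - b q.2) := by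
        ring
      have e1 : ((a q.1 - a q.2) * b q.1) ^ 2 ≤ (a q.1 - a q.2) ^ 2 := by
        rw [mul_pow]
        exact mul_le_of_le_one_right (sq_nonneg _) (pow_le_one₀ (hb0 _) (hb1 _))
      have e2 : (a q.2 * (b q.1 - b q.2)) ^ 2 ≤ (b q.1 - b q.2) ^ 2 := by
        rw [mul_pow]
        exact mul_le_of_le_one_left (sq_nonneg _) (pow_le_one₀ (ha0 _) (ha1 _))
      rw [e]
      nlinarith [sq_nonneg ((a q.1 - a q.2) * b q.1 - a q.2 * (b q.1 - b q.2))]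
    have hreal : kern q * (a q.1 * b q.1 - a q.2 * b q.2) ^ 2 * ‖u q.2‖ ^ 2 ≤
        2 * M ^ 2 * (kern q * (a q.1 - a q.2) ^ 2) +
          2 * (kern q * (b q.1 - b q.2) ^ 2 * ‖u q.2‖ ^ 2) := by
      calc kern q * (a q.1 * b q.1 - a q.2 * b q.2) ^ 2 * ‖u q.2‖ ^ 2
          ≤ kern q * (2 * (a q.1 - a q.2) ^ 2 + 2 * (b q.1 - b q.2) ^ 2) * ‖u q.2‖ ^ 2 := by gcongr
        _ = 2 * ‖u q.2‖ ^ 2 * (kern q * (a q.1 - a q.2) ^ 2) +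
          2 * (kern q * (b q.1 - b q.2) ^ 2 * ‖u q.2‖ ^ 2) := by ring
        _ ≤ _ := by gcongr
    refine (ENNReal.ofReal_le_ofReal hreal).trans ?_
    rw [ENNReal.ofReal_add (by positivity) (by positivity), ENNReal.ofReal_mul (p := 2 * M ^ 2) (by positivity),
      ENNReal.ofReal_mul (p := 2) (q := kern q * _ * _) (by norm_num),
      ENNReal.ofReal_mul (p := kern q * (b q.1 - b q.2) ^ 2) (by positivity),
      ENNReal.ofReal_pow (norm_nonneg _), ofReal_norm, ENNReal.ofReal_ofNat, ← mul_add]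
    gcongr
    rw [← add_mul]
    by_cases h1 : q.1 ∈ N
    · rw [indicator_of_mem h1]
      refine le_mul_of_one_le_left (by positivity) ?_
      simp
    · by_cases h2 : q.2 ∈ N
      · rw [indicator_of_mem h2]
        refine le_mul_of_one_le_left (by positivity) ?_
        simp
      · simp [haN _ h1, haN _ h2]
  rw [Measure.volume_eq_prod]
  refine (lintegral_mono_ae hpt).trans ?_
  have hBu : AEMeasurable (fun q : Plane × Plane => B q * ‖u q.2‖ₑ ^ 2) (volume.prod volume) :=
    hBm.aemeasurable.mul hum2
  rw [lintegral_add_right' _ (hBu.const_mul _),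
    lintegral_add_right _ (by fun_prop), lintegral_const_mul _ (by fun_prop),
    lintegral_const_mul _ (by fun_prop), lintegral_const_mul'' _ hBu]
  have t1 : ∫⁻ q, N.indicator 1 q.1 * A q ∂(volume.prod volume) ≤ ENNReal.ofReal (K * L) * volume N := by
    rw [lintegral_prod _ (by fun_prop)]
    calc ∫⁻ x, ∫⁻ y, N.indicator 1 x * A (x, y) = ∫⁻ x, N.indicator 1 x * ∫⁻ y, A (x, y) :=
          lintegral_congr fun x => lintegral_const_mul _ (by fun_prop)
      _ ≤ ∫⁻ x, N.indicator 1 x * ENNReal.ofReal (K * L) := by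
          gcongr with x
          exact hAx x
      _ = _ := by
          rw [lintegral_mul_const _ (measurable_one.indicator hN), lintegral_indicator_one hN, mul_comm]
  have t2 : ∫⁻ q, N.indicator 1 q.2 * A q ∂(volume.prod volume) ≤ ENNReal.ofReal (K * L) * volume N := by
    rw [lintegral_prod_symm _ (by fun_prop)]
    calc ∫⁻ y, ∫⁻ x, N.indicator 1 y * A (x, y) = ∫⁻ y, N.indicator 1 y * ∫⁻ x, A (x, y) :=
          lintegral_congr fun y => lintegral_const_mul _ (by fun_prop)
      _ ≤ ∫⁻ y, N.indicator 1 y * ENNReal.ofReal (K * L) := by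
          gcongr with y
          exact hAy y
      _ = _ := by
          rw [lintegral_mul_const _ (measurable_one.indicator hN), lintegral_indicator_one hN, mul_comm]
  have hsqn : ∫⁻ y, ‖u y‖ₑ ^ 2 = ENNReal.ofReal (∫ x, ‖u x‖ ^ 2) := by
    rw [ofReal_integral_eq_lintegral_ofReal (hu.integrable_norm_pow (by norm_num))
      (.of_forall fun x => by positivity)]
    refine lintegral_congr fun x => ?_
    rw [ENNReal.ofReal_pow (norm_nonneg _), ofReal_norm]
  have t3 : ∫⁻ q, B q * ‖u q.2‖ₑ ^ 2 ∂(volume.prod volume) ≤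
      ENNReal.ofReal (K * l) * ENNReal.ofReal (∫ x, ‖u x‖ ^ 2) := by
    rw [lintegral_prod_symm _ hBu]
    calc ∫⁻ y, ∫⁻ x, B (x, y) * ‖u y‖ₑ ^ 2 = ∫⁻ y, (∫⁻ x, B (x, y)) * ‖u y‖ₑ ^ 2 :=
          lintegral_congr fun y => lintegral_mul_const _ (by fun_prop)
      _ ≤ ∫⁻ y, ENNReal.ofReal (K * l) * ‖u y‖ₑ ^ 2 := by
          gcongr with y
          exact hBy y
      _ = _ := by rw [lintegral_const_mul'' _ hum, hsqn]
  have hu0 : 0 ≤ ∫ x, ‖u x‖ ^ 2 := integral_nonneg fun x => by positivity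
  calc _ ≤ ENNReal.ofReal (2 * M ^ 2) * (ENNReal.ofReal (K * L) * volume N) +
        ENNReal.ofReal (2 * M ^ 2) * (ENNReal.ofReal (K * L) * volume N) +
        2 * (ENNReal.ofReal (K * l) * ENNReal.ofReal (∫ x, ‖u x‖ ^ 2)) := by gcongr
    _ = _ := by
      have h2 : ∀ r : ℝ, (2 : ℝ≥0∞) * ENNReal.ofReal r = ENNReal.ofReal (2 * r) := fun r => by
        rw [ENNReal.ofReal_mul (by norm_num), ENNReal.ofReal_ofNat]
      rw [← two_mul, ← mul_assoc (ENNReal.ofReal (2 * M ^ 2)), ← mul_assoc,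
        ← ENNReal.ofReal_mul (by positivity), ← ENNReal.ofReal_mul (by positivity), h2, h2]
      rw [show 2 * (2 * M ^ 2 * (K * L)) = 4 * M ^ 2 * K * L by ring, ← mul_assoc 2, ← mul_assoc 2]

/-! ### Boundary behaviour of the extension and the Dirichlet-to-Neumann operator -/

theorem harmExt_neg_eq_smul (u : Plane → Plane) (x : Plane) {h : ℝ} (hh : 0 < h) :
    harmExt u (x, -h) = ∫ z, poisson 1 z • u (x - h • z) := by
  rw [harmExt_neg_eq]
  have h1 : ∫ y, poisson h (x - y) • u y = ∫ z, poisson h z • u (x - z) := by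
    rw [← integral_sub_left_eq_self (fun z => poisson h z • u (x - z)) volume x]
    simp
  rw [h1]
  have h2 := Measure.integral_comp_smul (volume : Measure Plane)
    (fun z => poisson h z • u (x - z)) h
  rw [finrank_euclideanSpace, Fintype.card_fin, abs_of_pos (by positivity)] at h2
  have h3 : ∫ z, poisson h z • u (x - z) = h ^ 2 • ∫ z, poisson h (h • z) • u (x - h • z) := by
    rw [h2, smul_smul, mul_inv_cancel₀ (by positivity), one_smul]
  rw [h3, ← integral_smul]
  refine integral_congr_ae (.of_forall fun z => ?_)
  dsimp only
  rw [smul_smul]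
  congr 1
  have h4 : Real.sqrt (‖h • z‖ ^ 2 + h ^ 2) = h * Real.sqrt (‖z‖ ^ 2 + 1 ^ 2) := by
    rw [norm_smul, Real.norm_of_nonneg hh.le, mul_pow, ← Real.sqrt_sq hh.le,
      ← Real.sqrt_mul (by positivity), Real.sqrt_sq hh.le]
    congr 1; ring
  rw [poisson, poisson, h4]
  have := sqrt_pos_of_height one_pos z
  field_simp

/-- Rescaling the variable puts the height into the argument of `u` and leaves the fixed weight
`poisson 1` of mass one, so dominated convergence applies at a continuity point. -/
theorem tendsto_harmExt {u : Plane → Plane} (hu : AEStronglyMeasurable u volume) {M : ℝ}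
    (huM : ∀ᵐ x, ‖u x‖ ≤ M) {x : Plane} (hx : ContinuousAt u x) :
    Tendsto (fun h => harmExt u (x, -h)) (𝓝[>] 0) (𝓝 (u x)) := by
  have h1 : u x = ∫ z, poisson 1 z • u x := by
    rw [integral_smul_const, integral_poisson one_pos, one_smul]
  have hqmp : ∀ {h : ℝ}, h ≠ 0 →
      Measure.QuasiMeasurePreserving (fun z : Plane => x - h • z) volume volume := by
    intro h hh
    exact (Measure.measurePreserving_sub_left volume x).quasiMeasurePreserving.comp
      (Measure.quasiMeasurePreserving_smul volume hh)
  rw [h1]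
  refine Tendsto.congr' (f₁ := fun h => ∫ z, poisson 1 z • u (x - h • z)) ?_ ?_
  · filter_upwards [self_mem_nhdsWithin] with h hh using (harmExt_neg_eq_smul u x hh).symm
  refine tendsto_integral_filter_of_dominated_convergence (fun z => poisson 1 z * M) ?_ ?_
    ((integrable_poisson one_pos).mul_const _) ?_
  · filter_upwards [self_mem_nhdsWithin] with h hh
    exact (continuous_poisson one_pos).aestronglyMeasurable.smul
      (hu.comp_quasiMeasurePreserving (hqmp (mem_Ioi.1 hh).ne'))
  · filter_upwards [self_mem_nhdsWithin] with h hh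
    filter_upwards [(hqmp (mem_Ioi.1 hh).ne').ae huM] with z hz
    rw [norm_smul, Real.norm_of_nonneg (poisson_nonneg zero_le_one z)]
    exact mul_le_mul_of_nonneg_left hz (poisson_nonneg zero_le_one z)
  · refine .of_forall fun z => Tendsto.const_smul ?_ _
    have h2 : Tendsto (fun h : ℝ => x - h • z) (𝓝[>] 0) (𝓝 x) := by
      have : Tendsto (fun h : ℝ => x - h • z) (𝓝 0) (𝓝 (x - (0:ℝ) • z)) :=
        Continuous.tendsto (by fun_prop) 0
      rw [zero_smul, sub_zero] at this
      exact this.mono_left nhdsWithin_le_nhds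
    exact hx.tendsto.comp h2

theorem differentiableAt_harmExt_height {u : Plane → Plane} (hu : MemLp u 2) (x : Plane) {s : ℝ}
    (hs : s < 0) : DifferentiableAt ℝ (fun s => harmExt u (x, s)) s :=
  (differentiableAt_harmExt (memLp_complexify hu) (z := (x, s)) hs).1.comp s (by fun_prop)

/-- Continued by `u x` at height `0`, the vertical profile is continuous, and its derivative has the
limit `w`. It therefore has one-sided derivative `w` at the boundary. -/
theorem tendsto_harmExt_quotient {u : Plane → Plane} (hu : MemLp u 2) {M : ℝ}
    (huM : ∀ᵐ x, ‖u x‖ ≤ M) {x w : Plane} (hx : ContinuousAt u x) (hw : HasDtN u x w) :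
    Tendsto (fun h : ℝ => h⁻¹ • (u x - harmExt u (x, -h))) (𝓝[>] 0) (𝓝 w) := by
  set f : ℝ → Plane := fun s => if s < 0 then harmExt u (x, s) else u x with hf
  have hfeq : ∀ s ∈ Iio (0:ℝ), f =ᶠ[𝓝 s] fun s => harmExt u (x, s) := by
    intro s hs
    filter_upwards [isOpen_Iio.mem_nhds hs] with r hr
    simp only [hf, if_pos (mem_Iio.1 hr)]
  have hneg : Tendsto (fun s : ℝ => -s) (𝓝[<] 0) (𝓝[>] 0) := by
    have := tendsto_neg_nhdsLT (a := (0:ℝ))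
    simpa using this
  have hlim := (tendsto_harmExt hu.1 huM hx).comp hneg
  have hf0 : f 0 = u x := by simp [hf]
  have hcont : ContinuousWithinAt f (Iio 0) 0 := by
    rw [ContinuousWithinAt, hf0]
    refine hlim.congr' ?_
    filter_upwards [self_mem_nhdsWithin] with s hs
    simp only [hf, if_pos (mem_Iio.1 hs), Function.comp_apply, neg_neg]
  have hderiv : Tendsto (fun s => deriv f s) (𝓝[<] 0) (𝓝 w) := by
    have h1 : Tendsto (fun s : ℝ => (x, s)) (𝓝[<] 0) (𝓝 x ×ˢ 𝓝[<] 0) :=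
      tendsto_const_nhds.prodMk tendsto_id
    refine (Tendsto.comp hw h1).congr' ?_
    filter_upwards [self_mem_nhdsWithin] with s hs
    exact ((hfeq s hs).deriv_eq).symm
  have hd := hasDerivWithinAt_Iic_of_tendsto_deriv (s := Iio 0) (a := 0) (f := f) (e := w)
    (fun s hs => ((hfeq s hs).differentiableAt_iff.2
      (differentiableAt_harmExt_height hu x hs)).differentiableWithinAt) hcont
    self_mem_nhdsWithin hderiv
  rw [hasDerivWithinAt_iff_tendsto_slope] at hd
  have hneg' : Tendsto (fun h : ℝ => -h) (𝓝[>] 0) (𝓝[Iic 0 \ {0}] 0) := by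
    have h1 : Tendsto (fun h : ℝ => -h) (𝓝[>] 0) (𝓝[<] 0) := by
      have := tendsto_neg_nhdsGT (a := (0:ℝ))
      simpa using this
    rwa [Iic_sdiff_right]
  refine (hd.comp hneg').congr' ?_
  filter_upwards [self_mem_nhdsWithin] with h hh
  have hh' : 0 < h := hh
  simp only [Function.comp_apply, slope_def_module, hf0]
  simp only [hf, sub_zero, if_pos (neg_lt_zero.2 hh'), inv_neg, neg_smul]
  rw [← smul_neg, neg_sub]

/-- The limit in `HasDtN` is joint in the base point and the height, so the vertical derivative is
bounded near each point of `K`; compactness makes the bound uniform. -/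
theorem exists_dtn_bound {u w : Plane → Plane} {K : Set Plane} (hK : IsCompact K)
    (hw : ∀ x ∈ K, HasDtN u x (w x)) :
    ∃ δ > 0, ∃ B ≥ 0, ∀ x ∈ K, ∀ s ∈ Ioo (-δ) 0, ‖deriv (fun s => harmExt u (x, s)) s‖ ≤ B := by
  refine hK.induction_on (p := fun S => ∃ δ > 0, ∃ B ≥ 0, ∀ x ∈ S, ∀ s ∈ Ioo (-δ) 0,
    ‖deriv (fun s => harmExt u (x, s)) s‖ ≤ B) ⟨1, one_pos, 0, le_rfl, by simp⟩ ?_ ?_ ?_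
  · rintro S T hST ⟨δ, hδ, B, hB, h⟩
    exact ⟨δ, hδ, B, hB, fun x hx => h x (hST hx)⟩
  · rintro S T ⟨δ, hδ, B, hB, h⟩ ⟨δ', hδ', B', hB', h'⟩
    refine ⟨min δ δ', lt_min hδ hδ', max B B', le_max_of_le_left hB, ?_⟩
    rintro x (hx | hx) s hs
    · exact (h x hx s ⟨by linarith [min_le_left δ δ', hs.1], hs.2⟩).trans (le_max_left _ _)
    · exact (h' x hx s ⟨by linarith [min_le_right δ δ', hs.1], hs.2⟩).trans (le_max_right _ _)
  · intro x hx
    have h1 := (hw x hx).norm.eventually (gt_mem_nhds (lt_add_one ‖w x‖))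
    obtain ⟨pa, hpa, pb, hpb, hp⟩ := eventually_prod_iff.1 h1
    obtain ⟨l, hl, hls⟩ := mem_nhdsLT_iff_exists_Ioo_subset.1 hpb
    refine ⟨{y | pa y}, mem_nhdsWithin_of_mem_nhds hpa, -l, neg_pos.2 hl, ‖w x‖ + 1, by positivity, ?_⟩
    intro y hy s hs
    rw [neg_neg] at hs
    exact (hp hy (hls hs)).le

/-- Mean value inequality between the heights `-h` and `-r`, followed by `r → 0`. -/
theorem norm_harmExt_quotient_le {u : Plane → Plane} (hu : MemLp u 2) {M : ℝ}
    (huM : ∀ᵐ x, ‖u x‖ ≤ M) {x : Plane} (hx : ContinuousAt u x) {δ B : ℝ} (hB : 0 ≤ B)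
    (hBd : ∀ s ∈ Ioo (-δ) 0, ‖deriv (fun s => harmExt u (x, s)) s‖ ≤ B) {h : ℝ}
    (hh : h ∈ Ioo 0 δ) : ‖h⁻¹ • (u x - harmExt u (x, -h))‖ ≤ B := by
  have h1 : ∀ᶠ r in 𝓝[>] (0:ℝ), ‖harmExt u (x, -r) - harmExt u (x, -h)‖ ≤ B * h := by
    filter_upwards [Ioo_mem_nhdsGT hh.1] with r hr
    have h2 := (convex_Ioo (-δ) 0).norm_image_sub_le_of_norm_deriv_le
      (f := fun s => harmExt u (x, s)) (C := B) (x := -h) (y := -r)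
      (fun s hs => differentiableAt_harmExt_height hu x hs.2) hBd
      ⟨by linarith [hh.2], by linarith [hh.1]⟩ ⟨by linarith [hr.2, hh.2], by linarith [hr.1]⟩
    refine h2.trans (mul_le_mul_of_nonneg_left ?_ hB)
    rw [Real.norm_eq_abs, abs_of_nonneg (by linarith [hr.2])]
    linarith [hr.1]
  have h3 := le_of_tendsto ((tendsto_harmExt hu.1 huM hx).sub_const _).norm h1
  rw [norm_smul, norm_inv, Real.norm_of_nonneg hh.1.le, inv_mul_le_iff₀ hh.1, mul_comm h]
  exact h3

/-- Identifies the limit of the difference quotients with the pointwise operator when the test field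
has compact support off the singular set; the uniform bound on that support is the domination. -/
theorem tendsto_dtn_pairing {u w : Plane → Plane} (hu : MemLp u 2) {M : ℝ}
    (huM : ∀ᵐ x, ‖u x‖ ≤ M) {Ω : Set Plane} (hux : ∀ x ∈ Ω, ContinuousAt u x)
    (hw : ∀ x ∈ Ω, HasDtN u x (w x)) {χ : Plane → ℝ} (hχ : Continuous χ)
    (hχc : HasCompactSupport χ) (hχΩ : tsupport χ ⊆ Ω) :
    Tendsto (fun h => h⁻¹ * ((∫ x, inner ℝ (u x) (χ x • u x)) -
      ∫ x, inner ℝ (harmExt u (x, -h)) (χ x • u x))) (𝓝[>] 0) (𝓝 (∫ x, inner ℝ (w x) (χ x • u x))) := by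
  obtain ⟨δ, hδ, B, hB, hBd⟩ := exists_dtn_bound (K := tsupport χ) hχc
    (fun x hx => hw x (hχΩ hx))
  have hχu : MemLp (fun x => χ x • u x) 2 := by
    obtain ⟨b, hb⟩ := hχc.exists_bound_of_continuous hχ
    refine hu.of_le_mul (c := b) (hχ.aestronglyMeasurable.smul hu.1) (.of_forall fun x => ?_)
    rw [norm_smul]
    gcongr
    exact hb x
  have hvc : ∀ {h : ℝ}, 0 < h → Continuous (fun x => harmExt u (x, -h)) := by
    intro h hh
    refine continuous_iff_continuousAt.2 fun x => ?_
    exact (differentiableAt_harmExt (memLp_complexify hu) (z := (x, -h))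
      (neg_lt_zero.2 hh)).1.continuousAt.comp (f := fun x => (x, -h)) (by fun_prop)
  have hvi : ∀ {h : ℝ}, 0 < h → Integrable (fun x => inner ℝ (harmExt u (x, -h)) (χ x • u x)) := by
    intro h hh
    have h1 : MemLp (fun x => χ x • harmExt u (x, -h)) 2 :=
      (hχ.smul (hvc hh)).memLp_of_hasCompactSupport hχc.smul_right
    refine (integrable_inner_of_memLp h1 hu).congr (.of_forall fun x => ?_)
    simp only [inner_smul_left, inner_smul_right, RCLike.conj_to_real]
  refine Tendsto.congr' (f₁ := fun h => ∫ x, inner ℝ (h⁻¹ • (u x - harmExt u (x, -h))) (χ x • u x)) ?_ ?_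
  · filter_upwards [self_mem_nhdsWithin] with h hh
    rw [← integral_sub (integrable_inner_of_memLp hu hχu) (hvi hh), ← integral_const_mul]
    congr 1
    ext x
    rw [inner_smul_left, inner_sub_left]
    simp
  have hχi : Integrable (fun x => ‖χ x • u x‖) := by
    obtain ⟨b, hb⟩ := hχc.exists_bound_of_continuous hχ
    have h1 : MemLp χ 2 := hχ.memLp_of_hasCompactSupport hχc
    refine (h1.norm.integrable_mul hu.norm).congr (.of_forall fun x => ?_)
    simp [norm_smul]
  refine tendsto_integral_filter_of_dominated_convergence (fun x => B * ‖χ x • u x‖) ?_ ?_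
    (hχi.const_mul _) ?_
  · filter_upwards [self_mem_nhdsWithin] with h hh
    have h1 : AEStronglyMeasurable (fun x => h⁻¹ • (u x - harmExt u (x, -h))) volume :=
      (hu.1.sub (hvc hh).aestronglyMeasurable).const_smul h⁻¹
    exact h1.inner hχu.1
  · have hδ' : Ioo 0 δ ∈ 𝓝[>] (0:ℝ) := Ioo_mem_nhdsGT hδ
    filter_upwards [hδ'] with h hh
    refine .of_forall fun x => (norm_inner_le_norm _ _).trans ?_
    by_cases hx : x ∈ tsupport χ
    · exact mul_le_mul_of_nonneg_right (norm_harmExt_quotient_le hu huM (hux x (hχΩ hx)) hB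
        (hBd x hx) hh) (norm_nonneg _)
    · rw [image_eq_zero_of_notMem_tsupport hx]
      simp
  · refine .of_forall fun x => ?_
    by_cases hx : x ∈ tsupport χ
    · exact (tendsto_harmExt_quotient hu huM (hux x (hχΩ hx)) (hw x (hχΩ hx))).inner
        tendsto_const_nhds
    · rw [image_eq_zero_of_notMem_tsupport hx]
      simp

/-! ### Frenet formulas and normal coordinates -/

/-- Clockwise rotation by a right angle. -/
def rot : Plane →L[ℝ] Plane :=
  LinearMap.toContinuousLinearMap
    { toFun := fun v => !₂[v 1, -v 0]
      map_add' := fun v w => by ext i; fin_cases i <;> simp; ring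
      map_smul' := fun r v => by ext i; fin_cases i <;> simp }

theorem rot_apply (v : Plane) : rot v = !₂[v 1, -v 0] := rfl

theorem norm_rot (v : Plane) : ‖rot v‖ = ‖v‖ := by
  simp [rot_apply, EuclideanSpace.norm_eq, add_comm]

theorem inner_rot_self (v : Plane) : inner ℝ (rot v) v = (0:ℝ) := by
  simp [rot_apply, PiLp.inner_apply]; ring

theorem eq_inner_smul_add {t : Plane} (ht : ‖t‖ = 1) (v : Plane) :
    v = (inner ℝ v t : ℝ) • t + (inner ℝ v (rot t) : ℝ) • rot t := by
  have h : t 0 ^ 2 + t 1 ^ 2 = 1 := by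
    have := EuclideanSpace.norm_sq_eq t
    rw [ht] at this
    simpa using this.symm
  ext i
  fin_cases i
  · simp [rot_apply, PiLp.inner_apply]
    linear_combination (-v 0) * h
  · simp [rot_apply, PiLp.inner_apply]
    linear_combination (-v 1) * h

theorem normal_eq (c : ℝ → Plane) (x : ℝ) : normal c x = rot (tangent c x) := rfl

namespace IsC2Jordan

variable {c : ℝ → Plane} (hc : IsC2Jordan c)
include hc

theorem contDiff_deriv : ContDiff ℝ 1 (deriv c) :=
  ((contDiff_succ_iff_deriv (n := 1)).1 hc.contDiff).2.2

theorem differentiable : Differentiable ℝ c := hc.contDiff.differentiable (by norm_num)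

theorem norm_deriv_pos (x : ℝ) : 0 < ‖deriv c x‖ := norm_pos_iff.2 (hc.regular x)

theorem contDiff_tangent : ContDiff ℝ 1 (tangent c) := by
  have h := hc.contDiff_deriv
  exact ((h.norm ℝ hc.regular).inv fun x => (hc.norm_deriv_pos x).ne').smul h

theorem contDiff_normal : ContDiff ℝ 1 (normal c) :=
  rot.contDiff.comp hc.contDiff_tangent

theorem norm_tangent (x : ℝ) : ‖tangent c x‖ = 1 := by
  rw [tangent, norm_smul, norm_inv, norm_norm, inv_mul_cancel₀ (hc.norm_deriv_pos x).ne']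

theorem norm_normal (x : ℝ) : ‖normal c x‖ = 1 := by
  rw [normal_eq, norm_rot, hc.norm_tangent]

theorem deriv_eq_smul_tangent (x : ℝ) : deriv c x = ‖deriv c x‖ • tangent c x := by
  rw [tangent, smul_smul, mul_inv_cancel₀ (hc.norm_deriv_pos x).ne', one_smul]

theorem inner_normal_deriv (x : ℝ) : inner ℝ (normal c x) (deriv c x) = (0:ℝ) := by
  rw [hc.deriv_eq_smul_tangent, inner_smul_right, normal_eq, inner_rot_self, mul_zero]

theorem hasDerivAt (x : ℝ) : HasDerivAt c (deriv c x) x := (hc.differentiable x).hasDerivAt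

theorem hasDerivAt_deriv (x : ℝ) : HasDerivAt (deriv c) (deriv (deriv c) x) x :=
  (hc.contDiff_deriv.differentiable one_ne_zero x).hasDerivAt

/-- Differentiating `|ν|² = 1` removes the normal component of `ν'`; differentiating `ν · c' = 0`
gives its tangential component in terms of `ν · c''`, that is, of the curvature. -/
theorem hasDerivAt_normal (x : ℝ) :
    HasDerivAt (normal c) (curvature c x • deriv c x) x := by
  have hd := (hc.contDiff_normal.differentiable one_ne_zero x).hasDerivAt
  have h1 : inner ℝ (deriv (normal c) x) (normal c x) = (0:ℝ) := by
    have h2 : HasDerivAt (fun y => (inner ℝ (normal c y) (normal c y) : ℝ)) _ x := hd.inner ℝ hd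
    have h3 : (fun y => (inner ℝ (normal c y) (normal c y) : ℝ)) = fun _ => 1 := by
      ext y
      rw [real_inner_self_eq_norm_sq, hc.norm_normal, one_pow]
    rw [h3] at h2
    have h4 := h2.unique (hasDerivAt_const x (1:ℝ))
    rw [real_inner_comm (normal c x)] at h4
    rw [real_inner_comm]
    linarith
  have h2 : inner ℝ (deriv (normal c) x) (deriv c x) = curvature c x * ‖deriv c x‖ ^ 2 := by
    have h2 : HasDerivAt (fun y => (inner ℝ (normal c y) (deriv c y) : ℝ)) _ x :=
      hd.inner ℝ (hc.hasDerivAt_deriv x)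
    have h3 : (fun y => (inner ℝ (normal c y) (deriv c y) : ℝ)) = fun _ => 0 := by
      ext y
      exact hc.inner_normal_deriv y
    rw [h3] at h2
    have h4 := h2.unique (hasDerivAt_const x (0:ℝ))
    rw [curvature, div_mul_cancel₀ _ (pow_ne_zero 2 (hc.norm_deriv_pos x).ne')]
    linarith
  have h3 : deriv (normal c) x = curvature c x • deriv c x := by
    have h4 := eq_inner_smul_add (hc.norm_tangent x) (deriv (normal c) x)
    rw [← normal_eq, h1, zero_smul, add_zero] at h4
    rw [hc.deriv_eq_smul_tangent, inner_smul_right] at h2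
    have h5 : (inner ℝ (deriv (normal c) x) (tangent c x) : ℝ) = curvature c x * ‖deriv c x‖ := by
      have h6 := (hc.norm_deriv_pos x).ne'
      rw [← hc.deriv_eq_smul_tangent, sq, ← mul_assoc, mul_comm] at h2
      exact mul_right_cancel₀ h6 h2
    rw [h4, h5, mul_smul, ← hc.deriv_eq_smul_tangent]
  rwa [h3] at hd

theorem continuous_normal : Continuous (normal c) := hc.contDiff_normal.continuous

theorem continuous_deriv : Continuous (deriv c) := hc.contDiff_deriv.continuous

theorem continuous_curvature : Continuous (curvature c) := by
  have h1 : Continuous (deriv (deriv c)) := hc.contDiff_deriv.continuous_deriv le_rfl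
  have h2 := hc.continuous_normal
  have h3 := hc.continuous_deriv
  unfold curvature
  exact (h2.inner h1).neg.div (h3.norm.pow 2) fun x => pow_ne_zero 2 (hc.norm_deriv_pos x).ne'

theorem deriv_periodic : Function.Periodic (deriv c) 1 := by
  intro x
  rw [← deriv_comp_add_const]
  congr 1
  exact funext hc.periodic

theorem normal_periodic : Function.Periodic (normal c) 1 := by
  intro x
  simp only [normal, tangent, hc.deriv_periodic x]

theorem range_eq : range c = c '' Icc 0 1 := by
  have := hc.periodic.image_Icc one_pos 0
  rw [zero_add] at this
  exact this.symm

theorem isCompact_range : IsCompact (range c) := by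
  rw [hc.range_eq]
  exact isCompact_Icc.image hc.differentiable.continuous

end IsC2Jordan

/-- Normal coordinates along the curve, with the normal variable scaled by `ε`. -/
def tubeMap (c : ℝ → Plane) (ε : ℝ) (q : ℝ × ℝ) : Plane := c q.1 + (ε * q.2) • normal c q.1

/-- The Jacobian of the normal coordinates. -/
def tubeJac (c : ℝ → Plane) (ε : ℝ) (q : ℝ × ℝ) : ℝ :=
  |ε * (1 + ε * q.2 * curvature c q.1) * ‖deriv c q.1‖|

/-- Cartesian coordinates of the plane. -/
def coords : Plane ≃ᵐ ℝ × ℝ :=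
  (MeasurableEquiv.toLp 2 (Fin 2 → ℝ)).symm.trans MeasurableEquiv.finTwoArrow

theorem measurePreserving_coords : MeasurePreserving coords volume volume :=
  (PiLp.volume_preserving_ofLp (Fin 2)).trans (volume_preserving_finTwoArrow ℝ)

namespace IsC2Jordan

variable {c : ℝ → Plane} (hc : IsC2Jordan c)
include hc

theorem continuous_tubeMap (ε : ℝ) : Continuous (tubeMap c ε) := by
  have := hc.continuous_normal
  have := hc.differentiable.continuous
  unfold tubeMap
  fun_prop

theorem hasFDerivAt_tubeMap (ε : ℝ) (q : ℝ × ℝ) : HasFDerivAt (tubeMap c ε)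
    ((ContinuousLinearMap.fst ℝ ℝ ℝ).smulRight ((1 + ε * q.2 * curvature c q.1) • deriv c q.1) +
      (ContinuousLinearMap.snd ℝ ℝ ℝ).smulRight (ε • normal c q.1)) q := by
  have h1 : HasFDerivAt (fun q : ℝ × ℝ => c q.1) _ q :=
    (hc.hasDerivAt q.1).hasFDerivAt.comp q hasFDerivAt_fst
  have h2 : HasFDerivAt (fun q : ℝ × ℝ => normal c q.1) _ q :=
    (hc.hasDerivAt_normal q.1).hasFDerivAt.comp q hasFDerivAt_fst
  have h0 : HasFDerivAt (Prod.snd : ℝ × ℝ → ℝ) (ContinuousLinearMap.snd ℝ ℝ ℝ) q := hasFDerivAt_snd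
  have h3 : HasFDerivAt (fun q : ℝ × ℝ => ε * q.2) _ q := h0.const_mul ε
  refine (h1.add (h3.smul h2)).congr_fderiv ?_
  refine ContinuousLinearMap.ext fun w => ?_
  simp
  module

theorem hasFDerivAt_coords_tubeMap (ε : ℝ) (q : ℝ × ℝ) :
    HasFDerivAt (fun q => coords (tubeMap c ε q))
      (LinearMap.toContinuousLinearMap (Matrix.toLin (Module.Basis.finTwoProd ℝ)
        (Module.Basis.finTwoProd ℝ)
        !![(1 + ε * q.2 * curvature c q.1) * deriv c q.1 0, ε * normal c q.1 0;
          (1 + ε * q.2 * curvature c q.1) * deriv c q.1 1, ε * normal c q.1 1])) q := by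
  have h := hc.hasFDerivAt_tubeMap ε q
  have h0 : HasFDerivAt (fun q => tubeMap c ε q 0) _ q :=
    (EuclideanSpace.proj (𝕜 := ℝ) (0 : Fin 2)).hasFDerivAt.comp q h
  have h1 : HasFDerivAt (fun q => tubeMap c ε q 1) _ q :=
    (EuclideanSpace.proj (𝕜 := ℝ) (1 : Fin 2)).hasFDerivAt.comp q h
  refine (h0.prodMk h1).congr_fderiv ?_
  refine ContinuousLinearMap.ext fun w => ?_
  rw [Matrix.toLin_finTwoProd_toContinuousLinearMap]
  ext <;> simp <;> ring

theorem abs_det_tubeMap (ε : ℝ) (q : ℝ × ℝ) :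
    |(LinearMap.toContinuousLinearMap (Matrix.toLin (Module.Basis.finTwoProd ℝ)
        (Module.Basis.finTwoProd ℝ)
        !![(1 + ε * q.2 * curvature c q.1) * deriv c q.1 0, ε * normal c q.1 0;
          (1 + ε * q.2 * curvature c q.1) * deriv c q.1 1, ε * normal c q.1 1])).det| =
      tubeJac c ε q := by
  rw [LinearMap.det_toContinuousLinearMap, LinearMap.det_toLin, Matrix.det_fin_two_of, tubeJac,
    ← abs_neg]
  congr 1
  have h := EuclideanSpace.norm_sq_eq (deriv c q.1)
  simp only [Fin.sum_univ_two, Real.norm_eq_abs, sq_abs] at h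
  have h2 := (hc.norm_deriv_pos q.1).ne'
  simp [normal, tangent]
  field_simp
  linear_combination (-(ε * (1 + ε * q.2 * curvature c q.1))) * h

/-- Change of variables, with `Plane` replaced by `ℝ × ℝ` through the measure-preserving `coords` so
that the derivative is an endomorphism and has a determinant. -/
theorem setIntegral_tubeMap {ε : ℝ} {S : Set (ℝ × ℝ)} (hS : MeasurableSet S)
    (hinj : InjOn (tubeMap c ε) S) (f : Plane → ℝ) :
    ∫ y in tubeMap c ε '' S, f y = ∫ q in S, tubeJac c ε q * f (tubeMap c ε q) := by
  have hinj' : InjOn (fun q => coords (tubeMap c ε q)) S :=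
    coords.injective.comp_injOn hinj
  have h1 := integral_image_eq_integral_abs_det_fderiv_smul volume hS
    (fun q _ => (hc.hasFDerivAt_coords_tubeMap ε q).hasFDerivWithinAt) hinj' (fun z => f (coords.symm z))
  have h2 := measurePreserving_coords.setIntegral_preimage_emb coords.measurableEmbedding
    (fun z => f (coords.symm z)) ((fun q => coords (tubeMap c ε q)) '' S)
  have h3 : coords ⁻¹' ((fun q => coords (tubeMap c ε q)) '' S) = tubeMap c ε '' S := by
    rw [show (fun q => coords (tubeMap c ε q)) = coords ∘ tubeMap c ε from rfl, image_comp,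
      coords.injective.preimage_image]
  simp only [h3, MeasurableEquiv.symm_apply_apply] at h2
  rw [h2, h1]
  simp only [hc.abs_det_tubeMap, MeasurableEquiv.symm_apply_apply, smul_eq_mul]

theorem volume_tubeMap {ε : ℝ} {S : Set (ℝ × ℝ)} (hS : MeasurableSet S)
    (hinj : InjOn (tubeMap c ε) S) :
    volume (tubeMap c ε '' S) = ∫⁻ q in S, ENNReal.ofReal (tubeJac c ε q) := by
  have hinj' : InjOn (fun q => coords (tubeMap c ε q)) S :=
    coords.injective.comp_injOn hinj
  have h1 := lintegral_abs_det_fderiv_eq_addHaar_image volume hS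
    (fun q _ => (hc.hasFDerivAt_coords_tubeMap ε q).hasFDerivWithinAt) hinj'
  have h3 : coords ⁻¹' ((fun q => coords (tubeMap c ε q)) '' S) = tubeMap c ε '' S := by
    rw [show (fun q => coords (tubeMap c ε q)) = coords ∘ tubeMap c ε from rfl, image_comp,
      coords.injective.preimage_image]
  rw [← h3, measurePreserving_coords.measure_preimage_equiv, ← h1]
  simp only [hc.abs_det_tubeMap]

end IsC2Jordan

/-! ### Positive reach of the curve and its distance function -/

/-- A function squeezed between two functions with the same derivative at a contact point is
differentiable there. -/
theorem _root_.HasFDerivAt.of_squeeze {E : Type*} [NormedAddCommGroup E] [NormedSpace ℝ E]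
    {f g k : E → ℝ} {L : E →L[ℝ] ℝ} {x : E} (hf : HasFDerivAt f L x) (hk : HasFDerivAt k L x)
    (hfg : ∀ y, f y ≤ g y) (hgk : ∀ y, g y ≤ k y) (h1 : f x = g x) (h2 : k x = g x) :
    HasFDerivAt g L x := by
  have h := hf.isLittleO.norm_left.add hk.isLittleO.norm_left
  refine HasFDerivAt.of_isLittleO (Asymptotics.IsBigO.trans_isLittleO ?_ h)
  refine Asymptotics.IsBigO.of_norm_le fun y => ?_
  have h3 := neg_abs_le (f y - f x - L (y - x))
  have h4 := le_abs_self (k y - k x - L (y - x))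
  have h5 := hfg y
  have h6 := hgk y
  have h7 := abs_nonneg (f y - f x - L (y - x))
  have h8 := abs_nonneg (k y - k x - L (y - x))
  rw [Real.norm_eq_abs, Real.norm_eq_abs, Real.norm_eq_abs, abs_le]
  constructor <;> linarith

theorem hasFDerivAt_norm_sub (a : Plane) {x : Plane} (h : x ≠ a) :
    HasFDerivAt (fun y => ‖y - a‖) (‖x - a‖⁻¹ • innerSL ℝ (x - a)) x := by
  have h0 : ‖x - a‖ ≠ 0 := norm_ne_zero_iff.2 (sub_ne_zero.2 h)
  have h1 := ((hasFDerivAt_id x).sub_const a).norm_sq.sqrt (pow_ne_zero 2 h0)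
  simp only [id, Real.sqrt_sq (norm_nonneg _)] at h1
  refine h1.congr_fderiv (ContinuousLinearMap.ext fun w => ?_)
  simp
  field_simp

/-- The curve has normal coordinates on the `r`-neighbourhood. -/
structure IsReach (c : ℝ → Plane) (r : ℝ) : Prop where
  pos : 0 < r
  curv : ∀ x s, |s| ≤ r → |s * curvature c x| ≤ 1 / 2
  sep : ∀ x s, |s| ≤ r → ∀ y, s ^ 2 + ‖c x - c y‖ ^ 2 / 2 ≤ ‖tubeMap c 1 (x, s) - c y‖ ^ 2

namespace IsC2Jordan

variable {c : ℝ → Plane} (hc : IsC2Jordan c)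
include hc

theorem curvature_periodic : Function.Periodic (curvature c) 1 := by
  intro x
  have h : Function.Periodic (deriv (deriv c)) 1 := by
    intro x
    rw [← deriv_comp_add_const]
    congr 1
    exact funext hc.deriv_periodic
  simp only [curvature, hc.deriv_periodic x, hc.normal_periodic x, h x]

theorem exists_lipschitz_deriv : ∃ L, 0 < L ∧ ∀ x y, ‖deriv c x - deriv c y‖ ≤ L * |x - y| := by
  have h1 : Continuous (deriv (deriv c)) := hc.contDiff_deriv.continuous_deriv le_rfl
  have h : Function.Periodic (deriv (deriv c)) 1 := by
    intro x
    rw [← deriv_comp_add_const]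
    congr 1
    exact funext hc.deriv_periodic
  obtain ⟨L, hL⟩ := (h.isBounded_of_continuous one_ne_zero h1).exists_norm_le
  refine ⟨max L 1, lt_max_of_lt_right one_pos, fun x y => ?_⟩
  exact Convex.norm_image_sub_le_of_norm_hasDerivWithin_le (s := univ)
    (fun z _ => (hc.hasDerivAt_deriv z).hasDerivWithinAt)
    (fun z _ => (hL _ (mem_range_self z)).trans (le_max_left _ _)) convex_univ trivial trivial

theorem exists_taylor_bound : ∃ L, 0 < L ∧
    ∀ x y, ‖c y - c x - (y - x) • deriv c x‖ ≤ L * |y - x| ^ 2 := by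
  obtain ⟨L, hL, h⟩ := hc.exists_lipschitz_deriv
  refine ⟨L, hL, fun x y => ?_⟩
  have h1 : ∀ z ∈ uIcc x y, HasDerivWithinAt (fun z => c z - (z - x) • deriv c x)
      (deriv c z - deriv c x) (uIcc x y) z := by
    intro z _
    have := (hc.hasDerivAt z).sub (((hasDerivAt_id z).sub_const x).smul_const (deriv c x))
    exact (this.congr_deriv (by rw [one_smul])).hasDerivWithinAt
  have h2 := (convex_uIcc x y).norm_image_sub_le_of_norm_hasDerivWithin_le h1
    (C := L * |y - x|) (fun z hz => (h z x).trans (mul_le_mul_of_nonneg_left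
      (abs_sub_left_of_mem_uIcc hz) hL.le)) left_mem_uIcc right_mem_uIcc
  simp only [sub_self, zero_smul, sub_zero, Real.norm_eq_abs] at h2
  rw [sub_right_comm, sq, ← mul_assoc]
  exact h2

theorem map_sub_int (x : ℝ) (n : ℤ) : c (x - n) = c x := by
  simpa using hc.periodic.sub_int_mul_eq (x := x) n

theorem map_fract (x : ℝ) : c (Int.fract x) = c x := by
  rw [← Int.self_sub_floor, hc.map_sub_int]

theorem eq_of_map_eq {x y : ℝ} (hxy : |y - x| ≤ 1 / 2) (h : c y = c x) : y = x := by
  have h1 : Int.fract y = Int.fract x := by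
    refine hc.injOn ⟨Int.fract_nonneg _, Int.fract_lt_one _⟩ ⟨Int.fract_nonneg _, Int.fract_lt_one _⟩ ?_
    rw [hc.map_fract, hc.map_fract, h]
  obtain ⟨n, hn⟩ := Int.fract_eq_fract.1 h1
  rw [hn] at hxy
  have h2 : |n| < 1 := by
    have : |(n:ℝ)| < 1 := by linarith
    exact_mod_cast this
  rw [Int.abs_lt_one_iff.1 h2] at hn
  push_cast at hn
  linarith

/-- By simplicity of the curve `|c y - c x|` is positive on the compact set of parameter pairs at
distance between `δ` and half a period, so it has a positive minimum there. -/
theorem exists_separation {δ : ℝ} (hδ : 0 < δ) : ∃ m, 0 < m ∧ ∀ x ∈ Icc (0:ℝ) 1, ∀ y,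
    δ ≤ |y - x| → |y - x| ≤ 1 / 2 → m ≤ ‖c y - c x‖ := by
  let K : Set (ℝ × ℝ) := {q : ℝ × ℝ | q ∈ Icc (0:ℝ) 1 ×ˢ Icc (-1:ℝ) 2 ∧ δ ≤ |q.2 - q.1| ∧ |q.2 - q.1| ≤ 1 / 2}
  have hK : IsCompact K := by
    refine (isCompact_Icc.prod isCompact_Icc).inter_right (IsClosed.inter ?_ ?_)
    · exact isClosed_le continuous_const (continuous_snd.sub continuous_fst).abs
    · exact isClosed_le (continuous_snd.sub continuous_fst).abs continuous_const
  obtain ⟨f, hf, hcont⟩ : ∃ f : ℝ × ℝ → ℝ, (∀ q, f q = ‖c q.2 - c q.1‖) ∧ Continuous f := by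
    have := hc.differentiable.continuous
    exact ⟨_, fun q => rfl, by fun_prop⟩
  have hmem : ∀ x ∈ Icc (0:ℝ) 1, ∀ y, δ ≤ |y - x| → |y - x| ≤ 1 / 2 → (x, y) ∈ K := by
    intro x hx y h1 h2
    have h3 := abs_le.1 h2
    exact ⟨⟨hx, by linarith [hx.1], by linarith [hx.2]⟩, h1, h2⟩
  rcases K.eq_empty_or_nonempty with h | h
  · refine ⟨1, one_pos, fun x hx y h1 h2 => ?_⟩
    have : (x, y) ∈ K := hmem x hx y h1 h2
    rw [h] at this
    exact this.elim
  · obtain ⟨q, hq, hmin⟩ := hK.exists_isMinOn h hcont.continuousOn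
    refine ⟨f q, ?_, fun x hx y h1 h2 => ?_⟩
    · rw [hf, norm_pos_iff, sub_ne_zero]
      intro he
      have := hc.eq_of_map_eq hq.2.2 he
      have h3 := hq.2.1
      rw [this, sub_self, abs_zero] at h3
      linarith
    · exact (isMinOn_iff.1 hmin _ (hmem x hx y h1 h2)).trans_eq (hf _)

/-- The curve leaves its tangent line only to second order. For close parameters the linear Taylor
term is orthogonal to `ν` and the chord is comparable to `|y - x|`; for distant parameters the chord
is bounded below by the separation of the curve. -/
theorem exists_inner_normal_bound : ∃ C, 0 < C ∧
    ∀ x y, |(inner ℝ (c y - c x) (normal c x) : ℝ)| ≤ C * ‖c y - c x‖ ^ 2 := by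
  obtain ⟨L, hL, hT⟩ := hc.exists_taylor_bound
  obtain ⟨x₀, -, hx₀⟩ := isCompact_Icc.exists_isMinOn (nonempty_Icc.2 (zero_le_one (α := ℝ)))
    hc.continuous_deriv.norm.continuousOn
  generalize hm : ‖deriv c x₀‖ = m 
  -- For `|y - x| ≤ δ = m/(2L)` the Taylor remainder is at most half of the linear term, so the
  -- chord is at least `m|y - x|/2`.
  have hm0 : 0 < m := hm ▸ hc.norm_deriv_pos x₀
  set δ := m / (2 * L)
  have hδ : 0 < δ := by positivity
  obtain ⟨m1, hm1, hsep⟩ := hc.exists_separation hδ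
  refine ⟨max (4 * L / m ^ 2) m1⁻¹, lt_max_of_lt_left (by positivity), ?_⟩
  have key : ∀ x ∈ Icc (0:ℝ) 1, ∀ y, |y - x| ≤ 1 / 2 →
      |(inner ℝ (c y - c x) (normal c x) : ℝ)| ≤ max (4 * L / m ^ 2) m1⁻¹ * ‖c y - c x‖ ^ 2 := by
    intro x hx y hxy
    rcases le_total δ |y - x| with h | h
    · have h1 := hsep x hx y h hxy
      have h2 := abs_real_inner_le_norm (c y - c x) (normal c x)
      rw [hc.norm_normal, mul_one] at h2
      have h3 : ‖c y - c x‖ ≤ m1⁻¹ * ‖c y - c x‖ ^ 2 := by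
        rw [inv_mul_eq_div, le_div_iff₀ hm1, sq]
        exact mul_le_mul_of_nonneg_left h1 (norm_nonneg _)
      exact h2.trans (h3.trans (mul_le_mul_of_nonneg_right (le_max_right _ _) (sq_nonneg _)))
    · have h1 := hT x y
      have h4 : (inner ℝ (c y - c x) (normal c x) : ℝ) =
          inner ℝ (c y - c x - (y - x) • deriv c x) (normal c x) := by
        rw [inner_sub_left (c y - c x), inner_smul_left, real_inner_comm, real_inner_comm (normal c x) (deriv c x),
          hc.inner_normal_deriv, mul_zero, sub_zero]
      have h5 := abs_real_inner_le_norm (c y - c x - (y - x) • deriv c x) (normal c x)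
      rw [← h4, hc.norm_normal, mul_one] at h5
      have h6 : m / 2 * |y - x| ≤ ‖c y - c x‖ := by
        have h7 : ‖(y - x) • deriv c x‖ - ‖c y - c x - (y - x) • deriv c x‖ ≤ ‖c y - c x‖ := by
          have := norm_sub_le (c y - c x) (c y - c x - (y - x) • deriv c x)
          rw [sub_sub_cancel] at this
          linarith
        rw [norm_smul, Real.norm_eq_abs] at h7
        have h8 : m * |y - x| ≤ |y - x| * ‖deriv c x‖ := by
          rw [mul_comm]
          exact mul_le_mul_of_nonneg_left (hm.symm.trans_le (hx₀ hx)) (abs_nonneg _)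
        have h9 : L * |y - x| ^ 2 ≤ m / 2 * |y - x| := by
          rw [sq, ← mul_assoc]
          refine mul_le_mul_of_nonneg_right ?_ (abs_nonneg _)
          calc L * |y - x| ≤ L * δ := mul_le_mul_of_nonneg_left h hL.le
            _ = m / 2 := by simp only [δ]; field_simp
        linarith
      refine (h5.trans h1).trans (le_trans ?_ (mul_le_mul_of_nonneg_right (le_max_left _ _) (sq_nonneg _)))
      calc L * |y - x| ^ 2 = 4 * L / m ^ 2 * (m / 2 * |y - x|) ^ 2 := by field_simp; norm_num
        _ ≤ 4 * L / m ^ 2 * ‖c y - c x‖ ^ 2 :=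
          mul_le_mul_of_nonneg_left (pow_le_pow_left₀ (by positivity) h6 2) (by positivity)
  intro x y
  have h2 : ∀ z (n : ℤ), normal c (z - n) = normal c z := fun z n => by
    simpa using hc.normal_periodic.sub_int_mul_eq (x := z) n
  -- Periodicity brings `x` into `[0, 1)`, and shifting `y` by the nearest integer makes the
  -- parameter distance at most `1/2`.
  have h3 := key (x - ⌊x⌋) ⟨Int.fract_nonneg _, (Int.fract_lt_one _).le⟩
    (y - (⌊x⌋ + round (y - x) : ℤ)) (by
      rw [show y - ((⌊x⌋ + round (y - x) : ℤ) : ℝ) - (x - ⌊x⌋) = y - x - round (y - x) by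
        push_cast; ring]
      exact abs_sub_round (y - x))
  rwa [hc.map_sub_int, hc.map_sub_int, h2] at h3

/-- In the expansion of `|sν - (c y - c x)|²` the cross term `2s⟨c y - c x, ν⟩` is at most half of
`|c y - c x|²` once `|s| ≤ 1/(4C)`. -/
theorem exists_isReach : ∃ r, IsReach c r := by
  obtain ⟨C, hC, h⟩ := hc.exists_inner_normal_bound
  obtain ⟨k, hk⟩ := (hc.curvature_periodic.isBounded_of_continuous one_ne_zero
    hc.continuous_curvature).exists_norm_le
  have hk0 : 0 ≤ k := (norm_nonneg _).trans (hk _ (mem_range_self 0))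
  refine ⟨min (1 / (4 * C)) (1 / (2 * (k + 1))), by positivity, fun x s hs => ?_, fun x s hs y => ?_⟩
  · rw [abs_mul]
    have h1 := hs.trans (min_le_right _ _)
    have h2 : |curvature c x| ≤ k := hk _ (mem_range_self x)
    calc |s| * |curvature c x| ≤ 1 / (2 * (k + 1)) * (k + 1) :=
          mul_le_mul h1 (by linarith) (abs_nonneg _) (by positivity)
      _ = 1 / 2 := by field_simp
  · have h1 := hs.trans (min_le_left _ _)
    have h2 : tubeMap c 1 (x, s) - c y = s • normal c x - (c y - c x) := by
      simp only [tubeMap, one_mul]; abel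
    rw [h2, norm_sub_rev (c x), norm_sub_sq_real (s • normal c x), norm_smul, hc.norm_normal,
      inner_smul_left, mul_one, Real.norm_eq_abs, sq_abs, real_inner_comm]
    have h3 : |s * (inner ℝ (c y - c x) (normal c x) : ℝ)| ≤ ‖c y - c x‖ ^ 2 / 4 := by
      rw [abs_mul]
      calc |s| * |(inner ℝ (c y - c x) (normal c x) : ℝ)| ≤ 1 / (4 * C) * (C * ‖c y - c x‖ ^ 2) :=
            mul_le_mul h1 (h x y) (abs_nonneg _) (by positivity)
        _ = ‖c y - c x‖ ^ 2 / 4 := by field_simp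
    have h4 := (abs_le.1 h3).2
    simp only [conj_trivial]
    linarith

end IsC2Jordan

namespace IsReach

variable {c : ℝ → Plane} {r : ℝ} (hr : IsReach c r) (hc : IsC2Jordan c)
include hr hc

theorem infDist_tubeMap {x s : ℝ} (hs : |s| ≤ r) :
    Metric.infDist (tubeMap c 1 (x, s)) (range c) = |s| := by
  refine le_antisymm ?_ ((Metric.le_infDist (range_nonempty c)).2 ?_)
  · refine (Metric.infDist_le_dist_of_mem (mem_range_self x)).trans_eq ?_
    rw [dist_eq_norm, tubeMap, add_sub_cancel_left, norm_smul, hc.norm_normal, mul_one, one_mul,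
      Real.norm_eq_abs]
  · rintro _ ⟨y, rfl⟩
    rw [dist_eq_norm, ← sq_le_sq₀ (abs_nonneg _) (norm_nonneg _), sq_abs]
    have := hr.sep x s hs y
    have := sq_nonneg ‖c x - c y‖
    linarith

/-- Equal images have equal distance to the curve, so `|s| = |t|`, and the separation inequality
then forces the two base points to coincide. -/
theorem injOn_tubeMap_one : InjOn (tubeMap c 1) (Ico (0:ℝ) 1 ×ˢ Icc (-r) r) := by
  rintro ⟨x, s⟩ ⟨hx, hs⟩ ⟨y, t⟩ ⟨hy, ht⟩ h
  simp only at hx hs hy ht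
  have h1 := hr.infDist_tubeMap hc (x := x) (abs_le.2 hs)
  have h2 := hr.infDist_tubeMap hc (x := y) (abs_le.2 ht)
  have h3 := hr.sep x s (abs_le.2 hs) y
  rw [h] at h1 h3
  have h4 : ‖tubeMap c 1 (y, t) - c y‖ = |t| := by
    rw [tubeMap, add_sub_cancel_left, norm_smul, hc.norm_normal, mul_one, one_mul,
      Real.norm_eq_abs]
  rw [h4, ← h2, h1, sq_abs] at h3
  have h5 : ‖c x - c y‖ = 0 := pow_eq_zero_iff two_ne_zero |>.1 (by linarith [sq_nonneg ‖c x - c y‖])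
  have h6 : x = y := hc.injOn hx hy (sub_eq_zero.1 (norm_eq_zero.1 h5))
  subst h6
  simp only [tubeMap, one_mul, add_right_inj] at h
  have h7 : normal c x ≠ 0 := norm_ne_zero_iff.1 (by rw [hc.norm_normal]; norm_num)
  rw [smul_left_injective ℝ h7 h]

omit hr in
-- Take a nearest point of the compact curve: the first-order condition makes the connecting vector
-- normal. This gives surjectivity of the normal coordinates without an inverse function theorem.
theorem exists_eq_tubeMap (y : Plane) : ∃ x ∈ Ico (0:ℝ) 1, ∃ s : ℝ,
    |s| = Metric.infDist y (range c) ∧ y = tubeMap c 1 (x, s) := by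
  obtain ⟨_, ⟨x', rfl⟩, hx'⟩ := hc.isCompact_range.exists_infDist_eq_dist (range_nonempty c) y
  set x := Int.fract x' with hxdef
  have hcx : c x = c x' := hc.map_fract x'
  rw [← hcx] at hx'
  have hmin : ∀ z, ‖y - c x‖ ^ 2 ≤ ‖y - c z‖ ^ 2 := fun z => by
    refine pow_le_pow_left₀ (norm_nonneg _) ?_ 2
    rw [← dist_eq_norm, ← dist_eq_norm, ← hx']
    exact Metric.infDist_le_dist_of_mem (mem_range_self z)
  have hd : HasDerivAt (fun z => ‖y - c z‖ ^ 2) _ x := ((hc.hasDerivAt x).const_sub y).norm_sq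
  have h0 := IsLocalMin.hasDerivAt_eq_zero (Eventually.of_forall hmin : IsLocalMin _ x) hd
  rw [inner_neg_right, hc.deriv_eq_smul_tangent, inner_smul_right] at h0
  have h1 : inner ℝ (y - c x) (tangent c x) = (0:ℝ) := by
    have := (hc.norm_deriv_pos x).ne'
    simpa [this] using h0
  have h2 := eq_inner_smul_add (hc.norm_tangent x) (y - c x)
  rw [h1, zero_smul, zero_add, ← normal_eq] at h2
  refine ⟨x, ⟨Int.fract_nonneg _, Int.fract_lt_one _⟩, inner ℝ (y - c x) (normal c x), ?_, ?_⟩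
  · rw [hx', dist_eq_norm]
    conv_rhs => rw [h2]
    rw [norm_smul, hc.norm_normal, mul_one, Real.norm_eq_abs]
  · simp only [tubeMap, one_mul]
    rw [← h2]
    abel

/-- Two barriers touch the distance function at the point: above, the distance to the foot point `c
x`; below, `s2` minus the distance to a point further along the same normal. Both have gradient
`sign s · ν`, so no regularity of inverse normal coordinates is needed. -/
theorem hasFDerivAt_infDist {x s : ℝ} (hs : |s| < r) (hs0 : s ≠ 0) :
    HasFDerivAt (fun y => Metric.infDist y (range c)) ((SignType.sign s : ℝ) • innerSL ℝ (normal c x))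
      (tubeMap c 1 (x, s)) := by
  set σ : ℝ := (SignType.sign s : ℝ) with hσ
  have hσs : σ * |s| = s := sign_mul_abs s
  have hs1 : 0 < |s| := abs_pos.2 hs0
  have hσ1 : |σ| = 1 := by
    have := congrArg abs hσs
    rw [abs_mul, abs_abs] at this
    exact mul_right_cancel₀ hs1.ne' (by rw [this, one_mul])
  -- The centre of the lower barrier lies at a distance `s2` strictly between `|s|` and `r`: beyond
  -- the point, but still where the distance to the curve is known.
  obtain ⟨s2, h2, h2r⟩ := exists_between hs
  have h2' : |σ * s2| = s2 := by rw [abs_mul, hσ1, one_mul, abs_of_pos (hs1.trans h2)]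
  have hd0 := hr.infDist_tubeMap hc (x := x) hs.le
  have hd2 := hr.infDist_tubeMap hc (x := x) (s := σ * s2) (by rw [h2']; exact h2r.le)
  rw [h2'] at hd2
  have e1 : tubeMap c 1 (x, s) - c x = s • normal c x := by simp [tubeMap]
  have e2 : tubeMap c 1 (x, s) - tubeMap c 1 (x, σ * s2) = (-(σ * (s2 - |s|))) • normal c x := by
    simp only [tubeMap, one_mul, add_sub_add_left_eq_sub, ← sub_smul]
    congr 1
    linear_combination -hσs
  have n1 : ‖tubeMap c 1 (x, s) - c x‖ = |s| := by
    rw [e1, norm_smul, hc.norm_normal, mul_one, Real.norm_eq_abs]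
  have n2 : ‖tubeMap c 1 (x, s) - tubeMap c 1 (x, σ * s2)‖ = s2 - |s| := by
    rw [e2, norm_smul, hc.norm_normal, mul_one, Real.norm_eq_abs, abs_neg, abs_mul, hσ1, one_mul,
      abs_of_pos (sub_pos.2 h2)]
  have d1 := hasFDerivAt_norm_sub (c x) (x := tubeMap c 1 (x, s))
    (sub_ne_zero.1 (norm_ne_zero_iff.1 (by rw [n1]; exact hs1.ne')))
  have d2 := (hasFDerivAt_norm_sub (tubeMap c 1 (x, σ * s2)) (x := tubeMap c 1 (x, s))
    (sub_ne_zero.1 (norm_ne_zero_iff.1 (by rw [n2]; exact (sub_pos.2 h2).ne')))).const_sub s2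
  rw [n1, e1] at d1
  rw [n2, e2] at d2
  have hp := (sub_pos.2 h2).ne'
  refine HasFDerivAt.of_squeeze (d2.congr_fderiv (ContinuousLinearMap.ext fun w => ?_))
    (d1.congr_fderiv (ContinuousLinearMap.ext fun w => ?_)) (fun y => ?_) (fun y => ?_) ?_ ?_
  · simp
    field_simp
  · simp
    rw [inv_mul_eq_div, div_eq_iff hs1.ne']
    linear_combination (-(inner ℝ (normal c x) w : ℝ)) * hσs
  · rw [sub_le_iff_le_add]
    refine hd2.symm.trans_le ?_
    refine (Metric.infDist_le_infDist_add_dist (x := tubeMap c 1 (x, σ * s2)) (y := y)).trans_eq ?_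
    rw [dist_comm, dist_eq_norm]
  · rw [← dist_eq_norm]
    exact Metric.infDist_le_dist_of_mem (mem_range_self x)
  · rw [n2, hd0, sub_sub_cancel]
  · rw [n1, hd0]

end IsReach

/-! ### Null measure of the curve and global bounds from traces and decay -/

namespace IsC2Jordan

variable {c : ℝ → Plane} (hc : IsC2Jordan c)
include hc

/-- The curve is the image of the null set `[0, 1) × {0}` under injective normal coordinates. -/
theorem volume_range : volume (range c) = 0 := by
  obtain ⟨r, hr⟩ := hc.exists_isReach
  have h1 : tubeMap c 1 '' (Ico (0:ℝ) 1 ×ˢ {0}) = range c := by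
    refine Subset.antisymm ?_ ?_
    · rintro _ ⟨q, ⟨-, hq⟩, rfl⟩
      rw [mem_singleton_iff] at hq
      exact ⟨q.1, by simp [tubeMap, hq]⟩
    · rintro _ ⟨x, rfl⟩
      exact ⟨(Int.fract x, 0), ⟨⟨Int.fract_nonneg _, Int.fract_lt_one _⟩, rfl⟩, by
        simp [tubeMap, hc.map_fract]⟩
  have h3 : (Ico (0:ℝ) 1 ×ˢ {(0:ℝ)}) ⊆ Ico (0:ℝ) 1 ×ˢ Icc (-r) r := by
    refine prod_mono le_rfl (singleton_subset_iff.2 ⟨?_, hr.pos.le⟩)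
    linarith [hr.pos]
  rw [← h1, hc.volume_tubeMap (measurableSet_Ico.prod (measurableSet_singleton 0))
    ((hr.injOn_tubeMap_one hc).mono h3)]
  refine setLIntegral_measure_zero _ _ ?_
  rw [Measure.volume_eq_prod, Measure.prod_prod]
  simp

theorem ae_notMem_range : ∀ᵐ y, y ∉ range c := measure_eq_zero_iff_ae_notMem.1 hc.volume_range

/-- One-sided limits that are joint in the base point and the normal distance bound `f` locally;
compactness of a period makes this uniform, and the normal coordinates reach every nearby point. -/
theorem exists_bound_near {E : Type*} [NormedAddCommGroup E] {f : Plane → E} {fi fo : ℝ → E}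
    (hi : ∀ x, HasInnerTrace c f x (fi x)) (ho : ∀ x, HasOuterTrace c f x (fo x)) :
    ∃ δ : ℝ, 0 < δ ∧ ∃ M : ℝ, ∀ y ∉ range c, Metric.infDist y (range c) < δ → ‖f y‖ ≤ M := by
  have h1 : ∃ δ : ℝ, 0 < δ ∧ ∃ M : ℝ, ∀ x ∈ Icc (0:ℝ) 1, ∀ s, 0 < s → s < δ →
      ‖f (c x + s • normal c x)‖ ≤ M ∧ ‖f (c x - s • normal c x)‖ ≤ M := by
    refine isCompact_Icc.induction_on (p := fun S => ∃ δ : ℝ, 0 < δ ∧ ∃ M : ℝ, ∀ x ∈ S, ∀ s, 0 < s → s < δ →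
      ‖f (c x + s • normal c x)‖ ≤ M ∧ ‖f (c x - s • normal c x)‖ ≤ M) ?_ ?_ ?_ ?_
    · exact ⟨1, one_pos, 0, fun x hx => hx.elim⟩
    · rintro S S' hS ⟨δ, hδ, M, h⟩
      exact ⟨δ, hδ, M, fun x hx => h x (hS hx)⟩
    · rintro S S' ⟨δ, hδ, M, h⟩ ⟨δ', hδ', M', h'⟩
      refine ⟨min δ δ', lt_min hδ hδ', max M M', ?_⟩
      rintro x (hx | hx) s hs hs'
      · have := h x hx s hs (hs'.trans_le (min_le_left _ _))
        exact ⟨this.1.trans (le_max_left _ _), this.2.trans (le_max_left _ _)⟩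
      · have := h' x hx s hs (hs'.trans_le (min_le_right _ _))
        exact ⟨this.1.trans (le_max_right _ _), this.2.trans (le_max_right _ _)⟩
    · intro x _
      have ei := (hi x).norm.eventually (gt_mem_nhds (lt_add_one ‖fi x‖))
      have eo := (ho x).norm.eventually (gt_mem_nhds (lt_add_one ‖fo x‖))
      obtain ⟨P, hP, Q, hQ, hPQ⟩ := eventually_prod_iff.1 (ei.and eo)
      obtain ⟨δ, hδ, hQδ⟩ := mem_nhdsGT_iff_exists_Ioo_subset.1 hQ
      refine ⟨{z | P z}, mem_nhdsWithin_of_mem_nhds hP, δ, hδ, max (‖fo x‖ + 1) (‖fi x‖ + 1), ?_⟩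
      intro z hz s hs hs'
      have := hPQ hz (hQδ ⟨hs, hs'⟩)
      exact ⟨this.2.le.trans (le_max_left _ _), this.1.le.trans (le_max_right _ _)⟩
  obtain ⟨δ, hδ, M, h⟩ := h1
  refine ⟨δ, hδ, M, fun y hy hd => ?_⟩
  obtain ⟨x, hx, s, hs, rfl⟩ := IsReach.exists_eq_tubeMap hc y
  have hs0 : s ≠ 0 := by
    rintro rfl
    exact hy ⟨x, by simp [tubeMap]⟩
  rw [← hs] at hd
  have h2 := h x ⟨hx.1, hx.2.le⟩ |s| (abs_pos.2 hs0) hd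
  rcases abs_choice s with h3 | h3
  · rw [h3] at h2
    simpa only [tubeMap, one_mul] using h2.1
  · rw [h3] at h2
    simpa only [tubeMap, one_mul, neg_smul, sub_neg_eq_add] using h2.2

/-- Three regions: near the curve the traces bound `f`, far away the decay hypothesis does, and what
remains is compact and lies in the domain of continuity. -/
theorem exists_bound {E : Type*} [NormedAddCommGroup E] {f : Plane → E} {fi fo : ℝ → E}
    (hf : ContinuousOn f (range c)ᶜ) (hO : f =O[Bornology.cobounded Plane] fun x => (‖x‖ ^ 2)⁻¹)
    (hi : ∀ x, HasInnerTrace c f x (fi x)) (ho : ∀ x, HasOuterTrace c f x (fo x)) :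
    ∃ M, 0 ≤ M ∧ ∀ y ∉ range c, ‖f y‖ ≤ M * (1 + ‖y‖ ^ 2)⁻¹ := by
  obtain ⟨δ, hδ, M1, h1⟩ := hc.exists_bound_near hi ho
  obtain ⟨C, hC⟩ := hO.bound
  obtain ⟨R, hR⟩ : ∃ R, ∀ y, R < ‖y‖ → ‖f y‖ ≤ C * ‖(‖y‖ ^ 2)⁻¹‖ := by
    obtain ⟨R, hR⟩ := (comap_norm_atTop (E := Plane) ▸ hC : ∀ᶠ y in comap norm atTop, _).exists_mem
    obtain ⟨⟨S, hS, hSR⟩, h⟩ := hR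
    obtain ⟨R', hR'⟩ := mem_atTop_sets.1 hS
    exact ⟨R', fun y hy => h y (hSR (hR' _ hy.le))⟩
  set R1 := max R 1
  have hK : IsCompact (Metric.closedBall (0:Plane) R1 ∩ {y | δ ≤ Metric.infDist y (range c)}) :=
    (isCompact_closedBall _ _).inter_right
      (isClosed_le continuous_const (Metric.continuous_infDist_pt _))
  obtain ⟨M2, hM2⟩ := hK.exists_bound_of_continuousOn (hf.mono fun y hy => by
    rintro hy'
    have := hy.2
    rw [mem_ofPred_eq, Metric.infDist_zero_of_mem hy'] at this
    linarith)
  set M0 := max (max M1 M2) 0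
  have hb : ∀ y ∉ range c, ‖y‖ ≤ R1 → ‖f y‖ ≤ M0 := by
    intro y hy hyR
    rcases lt_or_ge (Metric.infDist y (range c)) δ with h | h
    · exact (h1 y hy h).trans ((le_max_left _ _).trans (le_max_left _ _))
    · exact (hM2 y ⟨by simpa using hyR, h⟩).trans ((le_max_right _ _).trans (le_max_left _ _))
  have hM0 : 0 ≤ M0 := le_max_right _ _
  refine ⟨max (M0 * (1 + R1 ^ 2)) (2 * |C|), le_max_of_le_right (by positivity), fun y hy => ?_⟩
  rw [← div_eq_mul_inv, le_div_iff₀ (by positivity)]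
  rcases le_or_gt ‖y‖ R1 with h | h
  · refine le_trans ?_ (le_max_left _ _)
    exact mul_le_mul (hb y hy h) (by gcongr) (by positivity) hM0
  · refine le_trans ?_ (le_max_right _ _)
    have h2 := hR y ((le_max_left _ _).trans_lt h)
    have h3 : 1 < ‖y‖ := (le_max_right _ _).trans_lt h
    rw [Real.norm_of_nonneg (by positivity)] at h2
    calc ‖f y‖ * (1 + ‖y‖ ^ 2) ≤ (|C| * (‖y‖ ^ 2)⁻¹) * (2 * ‖y‖ ^ 2) := by
          refine mul_le_mul (h2.trans (mul_le_mul_of_nonneg_right (le_abs_self C) (by positivity)))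
            (by nlinarith) (by positivity) (by positivity)
      _ = 2 * |C| := by field_simp

theorem memLp_two {E : Type*} [NormedAddCommGroup E] [SecondCountableTopology E] {f : Plane → E} {M : ℝ}
    (hf : ContinuousOn f (range c)ᶜ) (hM : ∀ y ∉ range c, ‖f y‖ ≤ M * (1 + ‖y‖ ^ 2)⁻¹) :
    MemLp f 2 := by
  have hm : AEStronglyMeasurable f volume := by
    have h1 := hf.aestronglyMeasurable (μ := volume) hc.isCompact_range.isClosed.measurableSet.compl
    rwa [Measure.restrict_eq_self_of_ae_mem] at h1
    exact hc.ae_notMem_range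
  have hg : MemLp (fun y : Plane => (1 + ‖y‖ ^ 2)⁻¹) 2 := by
    have h1 : Continuous fun y : Plane => (1 + ‖y‖ ^ 2)⁻¹ :=
      Continuous.inv₀ (by fun_prop) fun y => by positivity
    refine (memLp_two_iff_integrable_sq h1.aestronglyMeasurable).2 ?_
    have h2 := integrable_rpow_neg_one_add_norm_sq (E := Plane) (μ := volume) (r := 4) (by simp; norm_num)
    refine h2.congr (.of_forall fun y => ?_)
    have h3 : (0:ℝ) < 1 + ‖y‖ ^ 2 := by positivity
    simp only
    rw [show (-4 / 2 : ℝ) = -(2:ℕ) by norm_num, Real.rpow_neg h3.le, Real.rpow_natCast, inv_pow]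
  refine hg.of_le_mul (c := M) hm ?_
  filter_upwards [hc.ae_notMem_range] with y hy
  rw [Real.norm_of_nonneg (by positivity)]
  exact hM y hy

end IsC2Jordan

/-! ### Integration by parts off the curve and tubular cutoffs -/

theorem sum_smul_fderiv {L : Plane →L[ℝ] ℝ} (v : Plane) :
    ∑ i : Fin 2, v i * L (EuclideanSpace.single i 1) = L v := by
  have : v = ∑ i : Fin 2, v i • EuclideanSpace.single i (1:ℝ) := by
    ext j
    fin_cases j <;> simp
  conv_rhs => rw [this]
  simp

/-- Integration by parts against a solenoidal field. -/
theorem integral_inner_gradient_cutoff {Ω : Set Plane} (hΩ : IsOpen Ω) {u : Plane → Plane}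
    {p : Plane → ℝ} (hu : ContDiffOn ℝ 1 u Ω) (hp : ContDiffOn ℝ 1 p Ω)
    (hdiv : ∀ x ∈ Ω, divergence u x = 0) {χ : Plane → ℝ} {C : NNReal} (hχL : LipschitzWith C χ)
    (hχd : Differentiable ℝ χ)
    (hχc : HasCompactSupport χ) (hχΩ : tsupport χ ⊆ Ω) :
    ∫ x, inner ℝ (-gradient p x) (χ x • u x) = ∫ x, p x * fderiv ℝ χ x (u x) := by
  have hud : ∀ x ∈ Ω, DifferentiableAt ℝ u x := fun x hx =>
    (hu.differentiableOn one_ne_zero).differentiableAt (hΩ.mem_nhds hx)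
  have hpd : ∀ x ∈ Ω, DifferentiableAt ℝ p x := fun x hx =>
    (hp.differentiableOn one_ne_zero).differentiableAt (hΩ.mem_nhds hx)
  have hgC : ∀ i : Fin 2, ContDiffOn ℝ 1 (fun x => p x * u x i) Ω := fun i =>
    hp.mul ((contDiff_euclidean.1 contDiff_id i).comp_contDiffOn hu)
  -- No integrability up to the boundary of `Ω` is assumed: each integrand has a bounded factor
  -- supported in the compact `tsupport χ`, on which the other factor is continuous.
  have hcomp : ∀ {g : Plane → ℝ} {k : Plane → ℝ}, ContinuousOn g Ω → AEStronglyMeasurable k volume →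
      (∃ B, ∀ x, ‖k x‖ ≤ B) → (∀ x ∉ tsupport χ, k x = 0) → Integrable (fun x => k x * g x) := by
    rintro g k hg hk ⟨B, hB⟩ hk0
    obtain ⟨B', hB'⟩ := hχc.exists_bound_of_continuousOn (hg.mono hχΩ)
    refine (integrableOn_iff_integrable_of_support_subset (s := tsupport χ) fun x hx => ?_).1 ?_
    · by_contra h
      exact hx (by simp [hk0 x h])
    · have : IsFiniteMeasure (volume.restrict (tsupport χ)) :=
        isFiniteMeasure_restrict.2 (IsCompact.measure_lt_top hχc).ne
      refine Integrable.of_bound ?_ (B * B') ?_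
      · exact hk.restrict.mul ((hg.mono hχΩ).aestronglyMeasurable (isClosed_tsupport χ).measurableSet)
      · refine (ae_restrict_iff' (isClosed_tsupport χ).measurableSet).2 (.of_forall fun x hx => ?_)
        rw [norm_mul]
        exact mul_le_mul (hB x) (hB' x hx) (norm_nonneg _) ((norm_nonneg _).trans (hB x))
  have hint : ∀ i : Fin 2, ∫ x, χ x * fderiv ℝ (fun x => p x * u x i) x (EuclideanSpace.single i 1) =
      - ∫ x, fderiv ℝ χ x (EuclideanSpace.single i 1) * (p x * u x i) ∧
      Integrable (fun x => χ x * fderiv ℝ (fun x => p x * u x i) x (EuclideanSpace.single i 1)) ∧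
      Integrable (fun x => fderiv ℝ χ x (EuclideanSpace.single i 1) * (p x * u x i)) := by
    intro i
    have h1 : Integrable (fun x => fderiv ℝ χ x (EuclideanSpace.single i 1) * (p x * u x i)) := by
      refine hcomp (hgC i).continuousOn
        (measurable_fderiv_apply_const ℝ χ _).aestronglyMeasurable ⟨C * 1, fun x => ?_⟩ fun x hx => ?_
      · refine (ContinuousLinearMap.le_opNorm _ _).trans ?_
        rw [PiLp.norm_single, norm_one]
        exact mul_le_mul_of_nonneg_right (norm_fderiv_le_of_lipschitz ℝ hχL) zero_le_one
      · rw [fderiv_of_notMem_tsupport (𝕜 := ℝ) hx, zero_apply]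
    have hχb : ∃ B, ∀ x, ‖χ x‖ ≤ B := hχc.exists_bound_of_continuous hχL.continuous
    have h2 : Integrable (fun x => χ x * fderiv ℝ (fun x => p x * u x i) x (EuclideanSpace.single i 1)) :=
      hcomp (((hgC i).continuousOn_fderiv_of_isOpen hΩ le_rfl).clm_apply continuousOn_const)
        hχL.continuous.aestronglyMeasurable hχb fun x hx => image_eq_zero_of_notMem_tsupport hx
    have h3 : Integrable (fun x => χ x * (p x * u x i)) :=
      hcomp (hgC i).continuousOn
        hχL.continuous.aestronglyMeasurable hχb fun x hx => image_eq_zero_of_notMem_tsupport hx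
    exact ⟨integral_mul_fderiv_eq_neg_fderiv_mul_of_integrable h1 h2 h3 (fun x _ => hχd x)
      (fun x hx => ((hgC i).differentiableOn one_ne_zero).differentiableAt (hΩ.mem_nhds (hχΩ hx))),
      h2, h1⟩
  -- Since `u` is divergence free, `∇p · u = div (p u)`.
  have e1 : ∀ x, inner ℝ (-gradient p x) (χ x • u x) =
      -∑ i : Fin 2, χ x * fderiv ℝ (fun x => p x * u x i) x (EuclideanSpace.single i 1) := by
    intro x
    by_cases hx : x ∈ Ω
    · have h4 : ∀ i : Fin 2, fderiv ℝ (fun x => p x * u x i) x (EuclideanSpace.single i 1) =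
          p x * fderiv ℝ u x (EuclideanSpace.single i 1) i +
            u x i * fderiv ℝ p x (EuclideanSpace.single i 1) := by
        intro i
        have h5 : HasFDerivAt (fun x => u x i) _ x :=
          (EuclideanSpace.proj (𝕜 := ℝ) i).hasFDerivAt.comp x (hud x hx).hasFDerivAt
        have h7 : HasFDerivAt (fun x => p x * u x i) _ x := (hpd x hx).hasFDerivAt.mul h5
        rw [h7.fderiv]
        simp
      simp only [h4, ← Finset.mul_sum, Finset.sum_add_distrib, sum_smul_fderiv]
      have h6 := hdiv x hx
      rw [divergence] at h6
      rw [h6, inner_neg_left, inner_smul_right, gradient, InnerProductSpace.toDual_symm_apply]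
      ring
    · have : χ x = 0 := image_eq_zero_of_notMem_tsupport fun h => hx (hχΩ h)
      simp [this]
  have e2 : ∀ x, p x * fderiv ℝ χ x (u x) =
      ∑ i : Fin 2, fderiv ℝ χ x (EuclideanSpace.single i 1) * (p x * u x i) := by
    intro x
    rw [← sum_smul_fderiv, Finset.mul_sum]
    exact Finset.sum_congr rfl fun i _ => by ring
  simp only [e1, e2]
  rw [integral_neg, integral_finsetSum _ fun i _ => (hint i).2.1,
    integral_finsetSum _ fun i _ => (hint i).2.2, ← Finset.sum_neg_distrib]
  exact Finset.sum_congr rfl fun i _ => by rw [(hint i).1, neg_neg]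

theorem exists_smoothTransition_bound : ∃ B : ℝ, 0 < B ∧
    (∀ t, |deriv Real.smoothTransition t| ≤ B) ∧
      ∀ s t, |Real.smoothTransition s - Real.smoothTransition t| ≤ B * |s - t| := by
  have hd : ContDiff ℝ 1 Real.smoothTransition := Real.smoothTransition.contDiff (n := 1)
  have hcont : Continuous (deriv Real.smoothTransition) := hd.continuous_deriv le_rfl
  obtain ⟨B, hB⟩ := (isCompact_Icc (a := (0:ℝ)) (b := 1)).exists_bound_of_continuousOn hcont.continuousOn
  have hb : ∀ t, |deriv Real.smoothTransition t| ≤ max B 1 := by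
    intro t
    rcases lt_or_ge t 0 with h | h
    · have : Real.smoothTransition =ᶠ[𝓝 t] fun _ => 0 := by
        filter_upwards [gt_mem_nhds h] with s hs
        exact Real.smoothTransition.zero_of_nonpos (le_of_lt hs)
      rw [this.deriv_eq]
      simp
    rcases lt_or_ge 1 t with h' | h'
    · have : Real.smoothTransition =ᶠ[𝓝 t] fun _ => 1 := by
        filter_upwards [lt_mem_nhds h'] with s hs
        exact Real.smoothTransition.one_of_one_le (le_of_lt hs)
      rw [this.deriv_eq]
      simp
    · exact (hB t ⟨h, h'⟩).trans (le_max_left _ _)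
  refine ⟨max B 1, lt_max_of_lt_right one_pos, hb, fun s t => ?_⟩
  exact Convex.norm_image_sub_le_of_norm_deriv_le (s := univ)
    (fun z _ => hd.differentiable one_ne_zero z) (fun z _ => hb z) convex_univ trivial trivial

/-- A cutoff vanishing on the `ε/2`-neighbourhood of the curve, and equal to `1` at distance at
least `ε` from it. -/
def tubeCut (c : ℝ → Plane) (ε : ℝ) (y : Plane) : ℝ :=
  Real.smoothTransition (2 * Metric.infDist y (range c) / ε - 1)

theorem tubeCut_nonneg (c : ℝ → Plane) (ε : ℝ) (y : Plane) : 0 ≤ tubeCut c ε y :=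
  Real.smoothTransition.nonneg _

theorem tubeCut_le_one (c : ℝ → Plane) (ε : ℝ) (y : Plane) : tubeCut c ε y ≤ 1 :=
  Real.smoothTransition.le_one _

theorem tubeCut_eq_zero {c : ℝ → Plane} {ε : ℝ} (hε : 0 < ε) {y : Plane}
    (h : Metric.infDist y (range c) ≤ ε / 2) : tubeCut c ε y = 0 :=
  Real.smoothTransition.zero_of_nonpos (by
    rw [sub_nonpos, div_le_one hε]; linarith)

theorem tubeCut_eq_one {c : ℝ → Plane} {ε : ℝ} (hε : 0 < ε) {y : Plane}
    (h : ε ≤ Metric.infDist y (range c)) : tubeCut c ε y = 1 :=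
  Real.smoothTransition.one_of_one_le (by
    rw [le_sub_iff_add_le, le_div_iff₀ hε]; linarith)

theorem tubeCut_lipschitz {B : ℝ} (hB0 : 0 < B)
    (hB : ∀ s t, |Real.smoothTransition s - Real.smoothTransition t| ≤ B * |s - t|)
    (c : ℝ → Plane) {ε : ℝ} (hε : 0 < ε) (x y : Plane) :
    |tubeCut c ε x - tubeCut c ε y| ≤ B * (2 / ε) * ‖x - y‖ := by
  refine (hB _ _).trans ?_
  rw [mul_assoc]
  refine mul_le_mul_of_nonneg_left ?_ hB0.le
  rw [sub_sub_sub_cancel_right, ← sub_div, ← mul_sub, mul_div_right_comm, abs_mul,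
    abs_of_pos (by positivity : 0 < 2 / ε)]
  refine mul_le_mul_of_nonneg_left ?_ (by positivity)
  have := (Metric.lipschitz_infDist_pt (range c)).dist_le_mul x y
  rwa [NNReal.coe_one, one_mul, Real.dist_eq, dist_eq_norm] at this

theorem tsupport_tubeCut_subset (c : ℝ → Plane) {ε : ℝ} (hε : 0 < ε) :
    tsupport (tubeCut c ε) ⊆ (range c)ᶜ := by
  have h1 : tsupport (tubeCut c ε) ⊆ {y | ε / 2 ≤ Metric.infDist y (range c)} := by
    refine closure_minimal (fun y hy => ?_)
      (isClosed_le continuous_const (Metric.continuous_infDist_pt _))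
    by_contra h
    exact hy (tubeCut_eq_zero hε (not_le.1 h).le)
  intro y hy hy'
  have := h1 hy
  rw [mem_ofPred_eq, Metric.infDist_zero_of_mem hy'] at this
  linarith

theorem hasFDerivAt_tubeCut_of_lt {c : ℝ → Plane} {ε : ℝ} (hε : 0 < ε) {y : Plane}
    (h : ε < Metric.infDist y (range c)) : HasFDerivAt (tubeCut c ε) (0 : Plane →L[ℝ] ℝ) y := by
  refine (hasFDerivAt_const (1:ℝ) y).congr_of_eventuallyEq ?_
  filter_upwards [(Metric.continuous_infDist_pt (range c)).continuousAt.eventually (lt_mem_nhds h)]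
    with z hz
  exact tubeCut_eq_one hε (le_of_lt hz)

namespace IsReach

variable {c : ℝ → Plane} {r : ℝ} (hr : IsReach c r) (hc : IsC2Jordan c)
include hr hc

theorem hasFDerivAt_tubeCut {ε : ℝ} {x s : ℝ} (hs : |s| < r) (hs0 : s ≠ 0) :
    HasFDerivAt (tubeCut c ε) ((deriv Real.smoothTransition (2 * |s| / ε - 1) * (2 / ε) *
      (SignType.sign s : ℝ)) • innerSL ℝ (normal c x)) (tubeMap c 1 (x, s)) := by
  have h1 := hr.hasFDerivAt_infDist hc (x := x) hs hs0
  have h2 : HasFDerivAt (fun y => 2 * Metric.infDist y (range c) / ε - 1)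
      (ε⁻¹ • (2:ℝ) • (SignType.sign s : ℝ) • innerSL ℝ (normal c x)) (tubeMap c 1 (x, s)) :=
    ((h1.const_mul 2).mul_const ε⁻¹).sub_const 1
  have hd : Differentiable ℝ Real.smoothTransition :=
    (Real.smoothTransition.contDiff (n := 1)).differentiable (by norm_num)
  have h3 := (hd (2 * Metric.infDist (tubeMap c 1 (x, s)) (range c) / ε - 1)).hasDerivAt
  refine (h3.comp_hasFDerivAt (tubeMap c 1 (x, s)) h2).congr_fderiv ?_
  rw [hr.infDist_tubeMap hc hs.le]
  simp only [smul_smul]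
  congr 1
  ring

/-- The distance is not differentiable on the curve nor perhaps beyond `r`, but the cutoff is
constant near the curve and at distances above `ε < r`. -/
theorem differentiable_tubeCut {ε : ℝ} (hε : 0 < ε) (hεr : ε < r) :
    Differentiable ℝ (tubeCut c ε) := by
  intro y
  rcases lt_or_ge (Metric.infDist y (range c)) (ε / 2) with h | h
  · refine ((hasFDerivAt_const (0:ℝ) y).congr_of_eventuallyEq ?_).differentiableAt
    filter_upwards [(Metric.continuous_infDist_pt (range c)).continuousAt.eventually
      (gt_mem_nhds h)] with z hz
    exact tubeCut_eq_zero hε (le_of_lt hz)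
  rcases lt_or_ge (Metric.infDist y (range c)) r with h' | h'
  · obtain ⟨x, hx, s, hs, rfl⟩ := exists_eq_tubeMap hc y
    rw [← hs] at h h'
    exact (hr.hasFDerivAt_tubeCut hc h' (abs_pos.1 (by linarith))).differentiableAt
  · exact (hasFDerivAt_tubeCut_of_lt hε (hεr.trans_le h')).differentiableAt

omit hr in
theorem exists_eq_tubeMap_of_le {ε : ℝ} (hε : 0 < ε) {y : Plane} (hy : y ∉ range c)
    (hd : Metric.infDist y (range c) ≤ ε) :
    y ∈ tubeMap c ε '' (Ico (0:ℝ) 1 ×ˢ Ioc 0 1) ∪ tubeMap c (-ε) '' (Ico (0:ℝ) 1 ×ˢ Ioc 0 1) := by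
  obtain ⟨x, hx, s, hs, rfl⟩ := exists_eq_tubeMap hc y
  have hs0 : s ≠ 0 := by
    rintro rfl
    exact hy ⟨x, by simp [tubeMap]⟩
  rw [← hs] at hd
  have h1 : |s| / ε ∈ Ioc (0:ℝ) 1 := ⟨div_pos (abs_pos.2 hs0) hε, (div_le_one hε).2 hd⟩
  rcases lt_or_gt_of_ne hs0 with h | h
  · refine Or.inr ⟨(x, |s| / ε), ⟨hx, h1⟩, ?_⟩
    simp only [tubeMap, one_mul, abs_of_neg h]
    congr 2
    field_simp
  · refine Or.inl ⟨(x, |s| / ε), ⟨hx, h1⟩, ?_⟩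
    simp only [tubeMap, one_mul, abs_of_pos h]
    congr 2
    field_simp

theorem tubeMap_sign_injOn {e ε : ℝ} (he : |e| = 1) (hε : 0 < ε) (hεr : ε ≤ r) :
    InjOn (tubeMap c (e * ε)) (Ico (0:ℝ) 1 ×ˢ Ioc 0 1) := by
  rintro ⟨x, s⟩ ⟨hx, hs⟩ ⟨y, t⟩ ⟨hy, ht⟩ h
  simp only at hx hy
  have hb : ∀ s : ℝ, s ∈ Ioc (0:ℝ) 1 → (e * ε) * s ∈ Icc (-r) r := fun s hs => by
    rw [mem_Icc, ← abs_le, abs_mul, abs_mul, he, one_mul, abs_of_pos hε, abs_of_pos hs.1]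
    nlinarith [hs.2, hs.1]
  have h1 := hr.injOn_tubeMap_one hc (x₁ := (x, (e * ε) * s)) (x₂ := (y, (e * ε) * t))
    ⟨hx, hb s hs⟩ ⟨hy, hb t ht⟩ (by simpa only [tubeMap, one_mul] using h)
  have he0 : e ≠ 0 := by
    rintro rfl
    simp at he
  simpa [hε.ne', he0] using h1

theorem tubeMap_notMem_range {e ε : ℝ} (he : |e| = 1) (hε : 0 < ε) (hεr : ε ≤ r) {q : ℝ × ℝ}
    (hq : q.2 ∈ Ioc (0:ℝ) 1) : tubeMap c (e * ε) q ∉ range c := by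
  intro h
  have h1 : |e * ε * q.2| = ε * q.2 := by
    rw [abs_mul, abs_mul, he, one_mul, abs_of_pos hε, abs_of_pos hq.1]
  have h2 := hr.infDist_tubeMap hc (x := q.1) (s := e * ε * q.2)
    (by rw [h1]; nlinarith [hq.1, hq.2])
  rw [show tubeMap c 1 (q.1, e * ε * q.2) = tubeMap c (e * ε) q by simp [tubeMap],
    Metric.infDist_zero_of_mem h, h1] at h2
  have := mul_pos hε hq.1
  linarith

omit hc in
theorem tubeJac_eq {e ε : ℝ} (he : |e| = 1) (hε : 0 < ε) (hεr : ε ≤ r) {q : ℝ × ℝ}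
    (hq : q.2 ∈ Ioc (0:ℝ) 1) :
    tubeJac c (e * ε) q = ε * (1 + e * ε * q.2 * curvature c q.1) * ‖deriv c q.1‖ ∧
      |1 + e * ε * q.2 * curvature c q.1| ≤ 3 / 2 := by
  have h1 : |e * ε * q.2| = ε * q.2 := by
    rw [abs_mul, abs_mul, he, one_mul, abs_of_pos hε, abs_of_pos hq.1]
  have h2 := abs_le.1 (hr.curv q.1 (e * ε * q.2) (by rw [h1]; nlinarith [hq.1, hq.2]))
  refine ⟨?_, abs_le.2 ⟨by linarith [h2.1], by linarith [h2.2]⟩⟩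
  rw [tubeJac, abs_mul, abs_mul, abs_mul, he, one_mul, abs_of_pos hε, abs_norm,
    abs_of_pos (by linarith [h2.1])]

/-- Each side of the tube has Jacobian at most `(3/2) m ε`, with `m` a bound for `|c'|`; the curve
itself is null. -/
theorem exists_volume_le : ∃ A : ℝ, 0 ≤ A ∧ ∀ ε, 0 < ε → ε ≤ r →
    volume {y | Metric.infDist y (range c) < ε} ≤ ENNReal.ofReal (A * ε) := by
  obtain ⟨m, hm⟩ := (hc.deriv_periodic.isBounded_of_continuous one_ne_zero
    hc.continuous_deriv).exists_norm_le
  have hm0 : 0 ≤ m := (norm_nonneg _).trans (hm _ (mem_range_self 0))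
  refine ⟨3 * m, by positivity, fun ε hε hεr => ?_⟩
  have hS : MeasurableSet (Ico (0:ℝ) 1 ×ˢ Ioc (0:ℝ) 1) := measurableSet_Ico.prod measurableSet_Ioc
  have h1 : ∀ e : ℝ, |e| = 1 → volume (tubeMap c (e * ε) '' (Ico (0:ℝ) 1 ×ˢ Ioc 0 1)) ≤
      ENNReal.ofReal (3 / 2 * m * ε) := by
    intro e he
    rw [hc.volume_tubeMap hS (hr.tubeMap_sign_injOn hc he hε hεr)]
    calc ∫⁻ q in Ico (0:ℝ) 1 ×ˢ Ioc 0 1, ENNReal.ofReal (tubeJac c (e * ε) q)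
        ≤ ∫⁻ _ in Ico (0:ℝ) 1 ×ˢ Ioc (0:ℝ) 1, ENNReal.ofReal (3 / 2 * m * ε) := by
          refine setLIntegral_mono measurable_const fun q hq => ENNReal.ofReal_le_ofReal ?_
          obtain ⟨h2, h3⟩ := hr.tubeJac_eq he hε hεr hq.2
          rw [h2, mul_assoc, mul_comm ε]
          refine mul_le_mul_of_nonneg_right ?_ hε.le
          exact mul_le_mul ((le_abs_self _).trans h3) (hm _ (mem_range_self _)) (norm_nonneg _)
            (by norm_num)
      _ = ENNReal.ofReal (3 / 2 * m * ε) := by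
          rw [setLIntegral_const, Measure.volume_eq_prod, Measure.prod_prod]
          simp
  have h2 : {y | Metric.infDist y (range c) < ε} ⊆ range c ∪
      (tubeMap c (1 * ε) '' (Ico (0:ℝ) 1 ×ˢ Ioc 0 1) ∪
        tubeMap c (-1 * ε) '' (Ico (0:ℝ) 1 ×ˢ Ioc 0 1)) := by
    intro y hy
    by_cases hy' : y ∈ range c
    · exact Or.inl hy'
    · have := exists_eq_tubeMap_of_le hc hε hy' (le_of_lt hy)
      rw [one_mul, neg_one_mul]
      exact Or.inr this
  refine (measure_mono h2).trans ((measure_union_le _ _).trans ?_)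
  rw [hc.volume_range, zero_add]
  refine (measure_union_le _ _).trans
    ((add_le_add (h1 1 (by norm_num)) (h1 (-1) (by norm_num))).trans_eq ?_)
  rw [← ENNReal.ofReal_add (by positivity) (by positivity)]
  congr 1
  ring

end IsReach

/-! ### Flux through a thin layer around the curve -/

/-- The total rise of the cutoff profile across the layer in the scaled normal variable; it makes
the limiting flux carry weight one. -/
theorem setIntegral_deriv_smoothTransition :
    ∫ t in Ioc (0:ℝ) 1, 2 * deriv Real.smoothTransition (2 * t - 1) = 1 := by
  have hd : ContDiff ℝ 1 Real.smoothTransition := Real.smoothTransition.contDiff (n := 1)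
  have hcont : Continuous (deriv Real.smoothTransition) := hd.continuous_deriv le_rfl
  rw [← intervalIntegral.integral_of_le zero_le_one]
  have h : ∀ t ∈ uIcc (0:ℝ) 1, HasDerivAt (fun t => Real.smoothTransition (2 * t - 1))
      (2 * deriv Real.smoothTransition (2 * t - 1)) t := by
    intro t _
    have h1 : HasDerivAt (fun t : ℝ => 2 * t - 1) 2 t := by
      simpa using ((hasDerivAt_id t).const_mul 2).sub_const 1
    have h2 := ((hd.differentiable one_ne_zero (2 * t - 1)).hasDerivAt).comp t h1
    rwa [mul_comm] at h2
  rw [intervalIntegral.integral_eq_sub_of_hasDerivAt h (Continuous.intervalIntegrable (by fun_prop) _ _)]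
  norm_num [Real.smoothTransition.zero_of_nonpos, Real.smoothTransition.one]

theorem aestronglyMeasurable_fderiv_apply {a : Plane → ℝ} {w : Plane → Plane} {μ : Measure Plane}
    (hw : AEStronglyMeasurable w μ) : AEStronglyMeasurable (fun y => fderiv ℝ a y (w y)) μ := by
  have h : ∀ i : Fin 2, AEStronglyMeasurable (fun y => w y i *
      fderiv ℝ a y (EuclideanSpace.single i 1)) μ := fun i =>
    ((EuclideanSpace.proj (𝕜 := ℝ) i).continuous.comp_aestronglyMeasurable hw).mul
      (measurable_fderiv_apply_const ℝ a _).aestronglyMeasurable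
  have h2 := (h 0).add (h 1)
  refine h2.congr (.of_forall fun y => ?_)
  have h3 := sum_smul_fderiv (L := fderiv ℝ a y) (w y)
  rwa [Fin.sum_univ_two] at h3

namespace IsReach

variable {c : ℝ → Plane} {r : ℝ} (hr : IsReach c r) (hc : IsC2Jordan c)
include hr hc

/-- The contribution of one side of the tube to the flux through a tubular cutoff layer. -/
theorem tendsto_setIntegral_fderiv_tubeCut {w : Plane → Plane} (hw : ContinuousOn w (range c)ᶜ)
    {M : ℝ} (hM : ∀ y ∉ range c, ‖w y‖ ≤ M) {e : ℝ} (he : e = 1 ∨ e = -1) {wt : ℝ → Plane}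
    (ht : ∀ x, Tendsto (fun q : ℝ × ℝ => w (c q.1 + (e * q.2) • normal c q.1))
      (𝓝 x ×ˢ 𝓝[>] 0) (𝓝 (wt x))) :
    Tendsto (fun ε => ∫ y in tubeMap c (e * ε) '' (Ico (0:ℝ) 1 ×ˢ Ioc 0 1),
        fderiv ℝ (tubeCut c ε) y (w y)) (𝓝[>] 0)
      (𝓝 (∫ x in (0:ℝ)..1, e * (‖deriv c x‖ * inner ℝ (normal c x) (wt x)))) := by
  have he1 : |e| = 1 := by rcases he with rfl | rfl <;> norm_num
  have hee : e * e = 1 := by rcases he with rfl | rfl <;> norm_num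
  obtain ⟨B, hB0, hB, -⟩ := exists_smoothTransition_bound
  have hcont : Continuous (deriv Real.smoothTransition) :=
    (Real.smoothTransition.contDiff (n := 1)).continuous_deriv le_rfl
  obtain ⟨m, hm⟩ := (hc.deriv_periodic.isBounded_of_continuous one_ne_zero
    hc.continuous_deriv).exists_norm_le
  have hm0 : 0 ≤ m := (norm_nonneg _).trans (hm _ (mem_range_self 0))
  set S : Set (ℝ × ℝ) := Ico (0:ℝ) 1 ×ˢ Ioc (0:ℝ) 1 with hSdef
  have hS : MeasurableSet S := measurableSet_Ico.prod measurableSet_Ioc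
  have hε : ∀ᶠ ε in 𝓝[>] (0:ℝ), 0 < ε ∧ ε < r :=
    (eventually_mem_nhdsWithin).and (mem_nhdsWithin_of_mem_nhds (gt_mem_nhds hr.pos))
  set F : ℝ → ℝ × ℝ → ℝ := fun ε q => (1 + e * ε * q.2 * curvature c q.1) * ‖deriv c q.1‖ *
    (2 * deriv Real.smoothTransition (2 * q.2 - 1)) *
      (e * inner ℝ (normal c q.1) (w (tubeMap c (e * ε) q))) with hF
  set G : ℝ × ℝ → ℝ := fun q => (e * (‖deriv c q.1‖ * inner ℝ (normal c q.1) (wt q.1))) *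
    (2 * deriv Real.smoothTransition (2 * q.2 - 1)) with hG
  -- The factor `1/ε` in the gradient of the cutoff cancels the factor `ε` of the Jacobian, which
  -- leaves integrands on the fixed square that are bounded uniformly in `ε`. The sign `e` comes
  -- from the gradient of the distance.
  have h1 : ∀ᶠ ε in 𝓝[>] (0:ℝ), ∫ q in S, F ε q = ∫ y in tubeMap c (e * ε) '' S,
      fderiv ℝ (tubeCut c ε) y (w y) := by
    filter_upwards [hε] with ε hε
    rw [hc.setIntegral_tubeMap hS (hr.tubeMap_sign_injOn hc he1 hε.1 hε.2.le)]
    refine setIntegral_congr_fun hS fun q hq => ?_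
    have e1 : |e * ε * q.2| = ε * q.2 := by
      rw [abs_mul, abs_mul, he1, one_mul, abs_of_pos hε.1, abs_of_pos hq.2.1]
    have e2 : tubeMap c (e * ε) q = tubeMap c 1 (q.1, e * ε * q.2) := by simp [tubeMap]
    have e3 : (SignType.sign (e * ε * q.2) : ℝ) = e := by
      have := mul_pos hε.1 hq.2.1
      rcases he with rfl | rfl
      · rw [one_mul, sign_pos this]; rfl
      · rw [mul_assoc, neg_one_mul, sign_neg (neg_lt_zero.2 this)]; simp
    have hlt : |e * ε * q.2| < r := by
      rw [e1]
      nlinarith [hq.2.1, hq.2.2, hε.1, hε.2]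
    have hne : e * ε * q.2 ≠ 0 := abs_pos.1 (by rw [e1]; exact mul_pos hε.1 hq.2.1)
    have h2 := hr.hasFDerivAt_tubeCut hc (x := q.1) (ε := ε) hlt hne
    rw [e1, e3, ← e2] at h2
    simp only [hF]
    rw [h2.fderiv, (hr.tubeJac_eq he1 hε.1 hε.2.le hq.2).1]
    have := hε.1.ne'
    have e4 : 2 * (ε * q.2) / ε = 2 * q.2 := by field_simp
    rw [e4]
    simp only [smul_apply, innerSL_apply_apply, smul_eq_mul]
    field_simp
  have h2 : ∫ q in S, G q = ∫ x in (0:ℝ)..1, e * (‖deriv c x‖ * inner ℝ (normal c x) (wt x)) := by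
    rw [hSdef, Measure.volume_eq_prod]
    simp only [hG]
    rw [setIntegral_prod_mul (fun x => e * (‖deriv c x‖ * inner ℝ (normal c x) (wt x)))
      (fun t => 2 * deriv Real.smoothTransition (2 * t - 1)), setIntegral_deriv_smoothTransition,
      mul_one, intervalIntegral.integral_of_le zero_le_one, integral_Ico_eq_integral_Ioc]
  rw [← h2]
  refine Tendsto.congr' h1 ?_
  have hvol : volume S < ∞ := by
    rw [hSdef, Measure.volume_eq_prod, Measure.prod_prod]
    simp
  refine tendsto_integral_filter_of_dominated_convergence
    (fun _ => 3 / 2 * m * (2 * B) * M) ?_ ?_ ?_ ?_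
  · filter_upwards [hε] with ε hε
    have c1 : ContinuousOn (fun q => w (tubeMap c (e * ε) q)) S :=
      hw.comp (hc.continuous_tubeMap _).continuousOn fun q hq =>
        hr.tubeMap_notMem_range hc he1 hε.1 hε.2.le hq.2
    have c2 := hc.continuous_normal
    have c3 := hc.continuous_deriv
    have c4 := hc.continuous_curvature
    have c5 : ContinuousOn (fun q : ℝ × ℝ => (inner ℝ (normal c q.1) (w (tubeMap c (e * ε) q)) : ℝ)) S :=
      (c2.comp continuous_fst).continuousOn.inner c1
    have c6 : Continuous (fun q : ℝ × ℝ => (1 + e * ε * q.2 * curvature c q.1) * ‖deriv c q.1‖ *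
        (2 * deriv Real.smoothTransition (2 * q.2 - 1))) := by fun_prop
    exact (c6.continuousOn.mul (continuousOn_const.mul c5)).aestronglyMeasurable hS
  · filter_upwards [hε] with ε hε
    refine (ae_restrict_iff' hS).2 (.of_forall fun q hq => ?_)
    have b1 := (hr.tubeJac_eq he1 hε.1 hε.2.le hq.2).2
    have b2 := hM _ (hr.tubeMap_notMem_range hc he1 hε.1 hε.2.le hq.2)
    have b3 := abs_real_inner_le_norm (normal c q.1) (w (tubeMap c (e * ε) q))
    rw [hc.norm_normal, one_mul] at b3
    have b4 := hB (2 * q.2 - 1)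
    have b5 := hm _ (mem_range_self q.1)
    simp only [hF, norm_mul, Real.norm_eq_abs, he1, one_mul, abs_norm, abs_two]
    exact mul_le_mul (mul_le_mul (mul_le_mul b1 b5 (norm_nonneg _) (by norm_num))
      (mul_le_mul_of_nonneg_left b4 zero_le_two) (by positivity) (by positivity))
      (b3.trans b2) (abs_nonneg _) (by positivity)
  · exact integrableOn_const hvol.ne
  · refine (ae_restrict_iff' hS).2 (.of_forall fun q hq => ?_)
    have t1 : Tendsto (fun ε => w (tubeMap c (e * ε) q)) (𝓝[>] 0) (𝓝 (wt q.1)) := by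
      have : Tendsto (fun ε : ℝ => (q.1, ε * q.2)) (𝓝[>] 0) (𝓝 q.1 ×ˢ 𝓝[>] 0) := by
        refine tendsto_const_nhds.prodMk (tendsto_nhdsWithin_iff.2 ⟨?_, ?_⟩)
        · have : Tendsto (fun ε : ℝ => ε * q.2) (𝓝 0) (𝓝 (0 * q.2)) :=
            tendsto_id.mul_const _
          rw [zero_mul] at this
          exact this.mono_left nhdsWithin_le_nhds
        · filter_upwards [self_mem_nhdsWithin] with ε hε
          exact mul_pos hε hq.2.1
      refine ((ht q.1).comp this).congr fun ε => ?_
      simp [tubeMap, mul_assoc]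
    have t2 : Tendsto (fun ε : ℝ => 1 + e * ε * q.2 * curvature c q.1) (𝓝[>] 0) (𝓝 1) := by
      have : Continuous (fun ε : ℝ => 1 + e * ε * q.2 * curvature c q.1) := by fun_prop
      have := this.tendsto 0
      simp only [mul_zero, zero_mul, add_zero] at this
      exact this.mono_left nhdsWithin_le_nhds
    have t3 := ((t2.mul_const ‖deriv c q.1‖).mul_const
      (2 * deriv Real.smoothTransition (2 * q.2 - 1))).mul
        (((tendsto_const_nhds (x := normal c q.1)).inner (𝕜 := ℝ) t1).const_mul e)
    convert t3 using 2
    simp only [hG]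
    ring

/-- The gradient of the cutoff vanishes beyond distance `ε`, so only the two disjoint sides of the
tube contribute. The cutoff increases away from the curve, hence the plus sign outside and the minus
sign inside. -/
theorem tendsto_integral_fderiv_tubeCut {w : Plane → Plane} (hw : ContinuousOn w (range c)ᶜ)
    (hwi : Integrable w) {M : ℝ} (hM : ∀ y ∉ range c, ‖w y‖ ≤ M) {wi wo : ℝ → Plane}
    (hi : ∀ x, HasInnerTrace c w x (wi x)) (ho : ∀ x, HasOuterTrace c w x (wo x)) :
    Tendsto (fun ε => ∫ y, fderiv ℝ (tubeCut c ε) y (w y)) (𝓝[>] 0)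
      (𝓝 ((∫ x in (0:ℝ)..1, 1 * (‖deriv c x‖ * inner ℝ (normal c x) (wo x))) +
        ∫ x in (0:ℝ)..1, (-1) * (‖deriv c x‖ * inner ℝ (normal c x) (wi x)))) := by
  obtain ⟨B, hB0, -, hB⟩ := exists_smoothTransition_bound
  have h1 := hr.tendsto_setIntegral_fderiv_tubeCut hc hw hM (Or.inl rfl) (wt := wo) fun x => by
    have h := ho x
    rw [HasOuterTrace] at h
    simpa only [one_mul] using h
  have h2 := hr.tendsto_setIntegral_fderiv_tubeCut hc hw hM (Or.inr rfl) (wt := wi) fun x => by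
    have h := hi x
    rw [HasInnerTrace] at h
    simpa only [neg_one_mul, neg_smul, ← sub_eq_add_neg] using h
  refine (h1.add h2).congr' ?_
  have hε : ∀ᶠ ε in 𝓝[>] (0:ℝ), 0 < ε ∧ ε < r :=
    (eventually_mem_nhdsWithin).and (mem_nhdsWithin_of_mem_nhds (gt_mem_nhds hr.pos))
  filter_upwards [hε] with ε hε
  set S : Set (ℝ × ℝ) := Ico (0:ℝ) 1 ×ˢ Ioc (0:ℝ) 1 with hSdef
  have hS : MeasurableSet S := measurableSet_Ico.prod measurableSet_Ioc
  have hmeas : ∀ e : ℝ, |e| = 1 → MeasurableSet (tubeMap c (e * ε) '' S) := fun e he =>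
    hS.image_of_continuousOn_injOn (hc.continuous_tubeMap _).continuousOn
      (hr.tubeMap_sign_injOn hc he hε.1 hε.2.le)
  have hint : Integrable (fun y => fderiv ℝ (tubeCut c ε) y (w y)) := by
    refine (hwi.norm.const_mul (B * (2 / ε))).mono' (aestronglyMeasurable_fderiv_apply hwi.1)
      (.of_forall fun y => ?_)
    refine (ContinuousLinearMap.le_opNorm _ _).trans (mul_le_mul_of_nonneg_right ?_ (norm_nonneg _))
    have h0 : 0 ≤ B * (2 / ε) := by have := hε.1; positivity
    have hL : LipschitzWith ⟨B * (2 / ε), h0⟩ (tubeCut c ε) :=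
      LipschitzWith.of_dist_le_mul fun x y => by
        rw [Real.dist_eq, dist_eq_norm]
        exact tubeCut_lipschitz hB0 hB c hε.1 x y
    exact norm_fderiv_le_of_lipschitz ℝ hL
  have hdisj : Disjoint (tubeMap c (1 * ε) '' S) (tubeMap c (-1 * ε) '' S) := by
    rw [Set.disjoint_left]
    rintro _ ⟨⟨x, s⟩, ⟨hx, hs⟩, rfl⟩ ⟨⟨y, t⟩, ⟨hy, ht⟩, h⟩
    have hb : ∀ s : ℝ, s ∈ Ioc (0:ℝ) 1 → (1 * ε) * s ∈ Icc (-r) r ∧ (-1 * ε) * s ∈ Icc (-r) r := by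
      intro s hs
      have := mul_pos hε.1 hs.1
      have : ε * s ≤ r := by nlinarith [hs.1, hs.2, hε.1, hε.2]
      constructor <;> constructor <;> linarith
    have h3 := hr.injOn_tubeMap_one hc (x₁ := (y, (-1 * ε) * t)) (x₂ := (x, (1 * ε) * s))
      ⟨hy, (hb t ht).2⟩ ⟨hx, (hb s hs).1⟩ (by simpa only [tubeMap, one_mul] using h)
    have h4 := congrArg Prod.snd h3
    simp only at h4
    have := mul_pos hε.1 hs.1
    have := mul_pos hε.1 ht.1
    simp only at *
    linarith
  rw [← setIntegral_union hdisj (hmeas (-1) (by norm_num)) hint.integrableOn hint.integrableOn]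
  refine setIntegral_eq_integral_of_ae_compl_eq_zero ?_
  filter_upwards [hc.ae_notMem_range] with y hy hy'
  have h5 : ε < Metric.infDist y (range c) := by
    by_contra h
    have := exists_eq_tubeMap_of_le hc hε.1 hy (not_lt.1 h)
    rw [one_mul, neg_one_mul] at hy'
    exact hy' this
  rw [(hasFDerivAt_tubeCut_of_lt hε.1 h5).fderiv]
  rfl

end IsReach

/-! ### The energy balance -/

/-- Joint one-sided limits are automatically continuous along the curve, so the trace integrals make
sense; letting the normal variable tend to `0` in a closed ball keeps the estimate. -/
theorem continuous_of_tendsto_prod {E : Type*} [PseudoMetricSpace E] {f : ℝ × ℝ → E} {g : ℝ → E}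
    (h : ∀ x, Tendsto f (𝓝 x ×ˢ 𝓝[>] 0) (𝓝 (g x))) : Continuous g := by
  refine continuous_iff_continuousAt.2 fun x => Metric.tendsto_nhds.2 fun ε hε => ?_
  have h1 := (h x).eventually (Metric.closedBall_mem_nhds (g x) (half_pos hε))
  obtain ⟨P, hP, Q, hQ, hPQ⟩ := eventually_prod_iff.1 h1
  filter_upwards [hP] with z hz
  have h2 : Tendsto (fun s => f (z, s)) (𝓝[>] 0) (𝓝 (g z)) :=
    (h z).comp (tendsto_const_nhds.prodMk tendsto_id)
  have h3 : g z ∈ Metric.closedBall (g x) (ε / 2) :=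
    Metric.isClosed_closedBall.mem_of_tendsto h2 (by
      filter_upwards [hQ] with s hs
      exact hPQ hz hs)
  exact (Metric.mem_closedBall.1 h3).trans_lt (half_lt_self hε)

/-- Smooth compactly supported cutoffs at spatial infinity. -/
theorem exists_bump : ∃ (η : Plane → ℝ) (l : ℝ), 0 < l ∧ Differentiable ℝ η ∧ HasCompactSupport η ∧
    (∀ x, 0 ≤ η x) ∧ (∀ x, η x ≤ 1) ∧ (∀ x, ‖x‖ ≤ 1 → η x = 1) ∧
      (∀ x y, |η x - η y| ≤ l * ‖x - y‖) := by
  let η : ContDiffBump (0 : Plane) := ⟨1, 2, one_pos, one_lt_two⟩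
  obtain ⟨C, hC⟩ := (η.contDiff (n := 1)).lipschitzWith_of_hasCompactSupport η.hasCompactSupport
    (by simp)
  refine ⟨η, C + 1, by positivity, (η.contDiff (n := 1)).differentiable (by simp),
    η.hasCompactSupport, fun x => η.nonneg, fun x => η.le_one, fun x hx => ?_, fun x y => ?_⟩
  · exact η.one_of_mem_closedBall (by simpa using hx)
  · have := hC.dist_le_mul x y
    rw [Real.dist_eq, dist_eq_norm] at this
    refine this.trans (mul_le_mul_of_nonneg_right (by simp) (norm_nonneg _))

theorem IsState.exists_bounds {c : ℝ → Plane} {u : Plane → Plane} {p : Plane → ℝ} {U : ℝ → ℝ}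
    (hc : IsC2Jordan c) (hs : IsState c u p U) : MemLp u 2 ∧ MemLp p 2 ∧
      ∃ M, 0 ≤ M ∧ ∀ y ∉ range c, ‖u y‖ ≤ M ∧ ‖p y‖ ≤ M := by
  obtain ⟨ui, uo, hui, huo, -⟩ := hs.u_jump
  obtain ⟨pi, po, hpi, hpo, -⟩ := hs.p_jump
  obtain ⟨M, hM, hu⟩ := hc.exists_bound hs.u_contDiffOn.continuousOn hs.u_decay hui huo
  obtain ⟨M', hM', hp⟩ := hc.exists_bound hs.p_contDiffOn.continuousOn hs.p_decay hpi hpo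
  refine ⟨hc.memLp_two hs.u_contDiffOn.continuousOn hu, hc.memLp_two hs.p_contDiffOn.continuousOn hp,
    max M M', le_max_of_le_left hM, fun y hy => ?_⟩
  have h1 : (1 + ‖y‖ ^ 2)⁻¹ ≤ 1 := inv_le_one_of_one_le₀ (by nlinarith [norm_nonneg y])
  exact ⟨(hu y hy).trans ((mul_le_of_le_one_right hM h1).trans (le_max_left _ _)),
    (hp y hy).trans ((mul_le_of_le_one_right hM' h1).trans (le_max_right _ _))⟩

/-- The energy balance: the Dirichlet energy equals the rate of work of the line tension. -/
theorem IsState.toReal_dirichletEnergy {c : ℝ → Plane} {u : Plane → Plane} {p : Plane → ℝ}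
    {U : ℝ → ℝ} (hc : IsC2Jordan c) (hs : IsState c u p U) :
    (dirichletEnergy u).toReal = -∫ x in (0:ℝ)..1, curvature c x * U x * ‖deriv c x‖ := by
  obtain ⟨hu, hp, M, hM0, hM⟩ := hs.exists_bounds hc
  obtain ⟨ui, uo, hui, huo, hujump, hU⟩ := hs.u_jump
  obtain ⟨pi, po, hpi, hpo, hpjump⟩ := hs.p_jump
  obtain ⟨r, hr⟩ := hc.exists_isReach
  obtain ⟨B, hB0, -, hB⟩ := exists_smoothTransition_bound
  obtain ⟨η, l, hl, hηd, hηc, hη0, hη1, hηone, hηl⟩ := exists_bump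
  obtain ⟨A, hA0, hA⟩ := hr.exists_volume_le hc
  obtain ⟨K, hK0, hK⟩ := exists_cutoff_bound
  have hopen : IsOpen (range c)ᶜ := hc.isCompact_range.isClosed.isOpen_compl
  have huae : ∀ᵐ x, ‖u x‖ ≤ M := by
    filter_upwards [hc.ae_notMem_range] with x hx using (hM x hx).1
  -- The shift by `2` keeps every `ε n` strictly below `r`. The same parameter is the width of the
  -- layer around the curve and the inverse radius of the cutoff at infinity.
  set ε : ℕ → ℝ := fun n => r / (n + 2) with hεdef
  have hr0 := hr.pos
  have hε0 : ∀ n, 0 < ε n := fun n => by positivity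
  have hεr : ∀ n, ε n < r := fun n => div_lt_self hr0 (by linarith [(Nat.cast_nonneg n : (0:ℝ) ≤ n)])
  have hεlim : Tendsto ε atTop (𝓝 0) :=
    tendsto_const_nhds.div_atTop (tendsto_atTop_add_const_right _ _ tendsto_natCast_atTop_atTop)
  have hεlim' : Tendsto ε atTop (𝓝[>] 0) :=
    tendsto_nhdsWithin_iff.2 ⟨hεlim, .of_forall hε0⟩
  set a : ℕ → Plane → ℝ := fun n => tubeCut c (ε n) with ha
  set b : ℕ → Plane → ℝ := fun n y => η (ε n • y) with hb
  set χ : ℕ → Plane → ℝ := fun n y => a n y * b n y with hχ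
  have hal : ∀ n x y, |a n x - a n y| ≤ B * (2 / ε n) * ‖x - y‖ := fun n x y =>
    tubeCut_lipschitz hB0 hB c (hε0 n) x y
  have hbl : ∀ n x y, |b n x - b n y| ≤ l * ε n * ‖x - y‖ := fun n x y => by
    refine (hηl _ _).trans_eq ?_
    rw [← smul_sub, norm_smul, Real.norm_of_nonneg (hε0 n).le, mul_assoc]
  have had : ∀ n, Differentiable ℝ (a n) := fun n => hr.differentiable_tubeCut hc (hε0 n) (hεr n)
  have hbd : ∀ n, Differentiable ℝ (b n) := fun n => hηd.comp (show Differentiable ℝ fun y : Plane => ε n • y by fun_prop)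
  have ha0 : ∀ n x, 0 ≤ a n x := fun n x => tubeCut_nonneg _ _ _
  have ha1 : ∀ n x, a n x ≤ 1 := fun n x => tubeCut_le_one _ _ _
  have hb0 : ∀ n x, 0 ≤ b n x := fun n x => hη0 _
  have hb1 : ∀ n x, b n x ≤ 1 := fun n x => hη1 _
  have hχd : ∀ n, Differentiable ℝ (χ n) := fun n => (had n).mul (hbd n)
  have hχl : ∀ n, LipschitzWith (B * (2 / ε n) + l * ε n).toNNReal (χ n) := fun n => by
    refine LipschitzWith.of_dist_le_mul fun x y => ?_
    have := hε0 n
    rw [Real.coe_toNNReal _ (by positivity), Real.dist_eq, dist_eq_norm, add_mul]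
    have e : χ n x - χ n y = (a n x - a n y) * b n x + a n y * (b n x - b n y) := by
      simp only [hχ]; ring
    rw [e]
    refine (abs_add_le _ _).trans (add_le_add ?_ ?_)
    · rw [abs_mul, abs_of_nonneg (hb0 n x)]
      exact (mul_le_of_le_one_right (abs_nonneg _) (hb1 n x)).trans (hal n x y)
    · rw [abs_mul, abs_of_nonneg (ha0 n y)]
      exact (mul_le_of_le_one_left (abs_nonneg _) (ha1 n y)).trans (hbl n x y)
  have hχc : ∀ n, HasCompactSupport (χ n) := fun n =>
    (hηc.comp_smul (hε0 n).ne').mul_left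
  have hχΩ : ∀ n, tsupport (χ n) ⊆ (range c)ᶜ := fun n =>
    (tsupport_mul_subset_left).trans (tsupport_tubeCut_subset c (hε0 n))
  -- convergence of the cut-off energies
  have hE := bform_self hu hs.finite_energy
  have hgag := integrable_gag hu hs.finite_energy
  obtain ⟨hcut, hlim⟩ := tendsto_bform_cutoff hu hgag (χ := χ) (fun n => (hχl n).continuous.measurable)
    (fun n x => mul_nonneg (ha0 n x) (hb0 n x)) (fun n x => mul_le_one₀ (ha1 n x) (hb0 n x) (hb1 n x))
    -- In the first term the slope `2B/ε` meets the area `Aε`; in the second the slope `l ε` of the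
    -- outer cutoff is at most `l r`.
    (C := 4 * M ^ 2 * K * (2 * B) * A + 2 * K * (l * r) * ∫ x, ‖u x‖ ^ 2)
    (by have : 0 ≤ ∫ x, ‖u x‖ ^ 2 := integral_nonneg fun x => by positivity
        positivity)
    (fun n => by
      have hn := hε0 n
      have hi : 0 ≤ ∫ x, ‖u x‖ ^ 2 := integral_nonneg fun x => by positivity
      refine (hK u M hM0 hu huae (a n) (b n) (B * (2 / ε n)) (l * ε n) (by positivity) (by positivity)
        (ha0 n) (ha1 n) (hb0 n) (hb1 n) (hal n) (hbl n) {y | Metric.infDist y (range c) < ε n}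
        (measurableSet_lt (Metric.continuous_infDist_pt _).measurable measurable_const)
        (fun x hx => tubeCut_eq_one hn (not_lt.1 hx))).trans ?_
      rw [ENNReal.ofReal_add (by positivity) (by positivity)]
      refine add_le_add ?_ (ENNReal.ofReal_le_ofReal ?_)
      · refine (mul_le_mul_right (hA _ hn (hεr n).le) _).trans_eq ?_
        rw [← ENNReal.ofReal_mul (by positivity)]
        congr 1
        field_simp
      · have := (hεr n).le
        gcongr)
    (by
      filter_upwards [hc.ae_notMem_range] with x hx
      have hd : 0 < Metric.infDist x (range c) :=
        (hc.isCompact_range.isClosed.notMem_iff_infDist_pos (range_nonempty c)).1 hx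
      have h1 := hεlim.eventually (gt_mem_nhds hd)
      have h2 : Tendsto (fun n => ε n * ‖x‖) atTop (𝓝 (0 * ‖x‖)) := hεlim.mul_const _
      rw [zero_mul] at h2
      filter_upwards [h1, h2.eventually (gt_mem_nhds one_pos)] with n h1 h2
      have e1 : a n x = 1 := tubeCut_eq_one (hε0 n) (le_of_lt h1)
      have e2 : b n x = 1 := hηone _ (by
        rw [norm_smul, Real.norm_of_nonneg (hε0 n).le]; exact le_of_lt h2)
      simp only [hχ, e1, e2, mul_one])
  rw [hE] at hlim
  -- The same difference quotients have two limits: the singular form, and the pairing with `Λu =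
  -- -∇p`, legitimate because `χ n` is supported off the curve. Integration by parts rewrites the
  -- latter.
  have hform : ∀ n, bform u (fun x => χ n x • u x) = ∫ x, p x * fderiv ℝ (χ n) x (u x) := by
    intro n
    have h1 := tendsto_quotient_bform hu (hcut n).1 hgag (hcut n).2
    have h2 := tendsto_dtn_pairing hu huae (Ω := (range c)ᶜ)
      (fun x hx => (hs.u_contDiffOn.continuousOn).continuousAt (hopen.mem_nhds hx))
      (w := fun x => -gradient p x) (fun x hx => hs.momentum x hx) (hχl n).continuous (hχc n) (hχΩ n)
    rw [tendsto_nhds_unique h1 h2]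
    exact integral_inner_gradient_cutoff hopen hs.u_contDiffOn hs.p_contDiffOn
      (fun x hx => hs.incompressible x hx) (hχl n) (hχd n) (hχc n) (hχΩ n)
  simp only [hform] at hlim
  -- convergence of the flux
  set w : Plane → Plane := fun y => p y • u y with hw
  have hwc : ContinuousOn w (range c)ᶜ :=
    hs.p_contDiffOn.continuousOn.smul hs.u_contDiffOn.continuousOn
  have hwi : Integrable w := memLp_one_iff_integrable.1 (hu.smul hp)
  have hwM : ∀ y ∉ range c, ‖w y‖ ≤ M * M := fun y hy => by
    rw [norm_smul]
    exact mul_le_mul (hM y hy).2 (hM y hy).1 (norm_nonneg _) hM0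
  have hti : ∀ x, HasInnerTrace c w x (pi x • ui x) := fun x => (hpi x).smul (hui x)
  have hto : ∀ x, HasOuterTrace c w x (po x • uo x) := fun x => (hpo x).smul (huo x)
  have hflux := (hr.tendsto_integral_fderiv_tubeCut hc hwc hwi hwM hti hto).comp hεlim'
  obtain ⟨R, hR⟩ : ∃ R, ∀ y, Metric.infDist y (range c) ≤ r → ‖y‖ ≤ R := by
    obtain ⟨R, hR⟩ := hc.isCompact_range.isBounded.exists_norm_le
    refine ⟨R + r, fun y hy => ?_⟩
    obtain ⟨z, hz, hyz⟩ := hc.isCompact_range.exists_infDist_eq_dist (range_nonempty c) y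
    rw [hyz, dist_eq_norm] at hy
    have := norm_add_le z (y - z)
    rw [add_sub_cancel] at this
    linarith [hR z hz]
  -- The outer cutoff does not matter in the limit: its gradient is `O(ε)` against the integrable `p
  -- u`, and for large `n` it equals `1` wherever the inner cutoff varies.
  have hdiff : Tendsto (fun n => (∫ x, p x * fderiv ℝ (χ n) x (u x)) -
      ∫ y, fderiv ℝ (tubeCut c (ε n)) y (w y)) atTop (𝓝 0) := by
    have h2 : Tendsto (fun n => l * ε n * ∫ y, ‖w y‖) atTop (𝓝 (l * 0 * ∫ y, ‖w y‖)) :=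
      (hεlim.const_mul l).mul_const _
    rw [mul_zero, zero_mul] at h2
    refine squeeze_zero_norm' ?_ h2
    have h3 : Tendsto (fun n => ε n * R) atTop (𝓝 (0 * R)) := hεlim.mul_const _
    rw [zero_mul] at h3
    filter_upwards [h3.eventually (gt_mem_nhds one_pos)] with n hn
    have hn0 := hε0 n
    have hfa : ∀ y, b n y * fderiv ℝ (a n) y (w y) = fderiv ℝ (a n) y (w y) := by
      intro y
      rcases lt_or_ge (ε n) (Metric.infDist y (range c)) with h | h
      · rw [(hasFDerivAt_tubeCut_of_lt hn0 h).fderiv, zero_apply, mul_zero]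
      · have : b n y = 1 := hηone _ (by
          rw [norm_smul, Real.norm_of_nonneg hn0.le]
          exact (mul_le_mul_of_nonneg_left (hR y (h.trans (hεr n).le)) hn0.le).trans (le_of_lt hn))
        rw [this, one_mul]
    have hfχ : ∀ y, p y * fderiv ℝ (χ n) y (u y) =
        fderiv ℝ (a n) y (w y) + a n y * fderiv ℝ (b n) y (w y) := by
      intro y
      have h4 : HasFDerivAt (χ n) _ y := (had n y).hasFDerivAt.mul (hbd n y).hasFDerivAt
      rw [h4.fderiv, ← hfa y]
      simp [hw]
      ring
    have hLa : LipschitzWith (B * (2 / ε n)).toNNReal (a n) :=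
      LipschitzWith.of_dist_le_mul fun x y => by
        rw [Real.dist_eq, dist_eq_norm, Real.coe_toNNReal _ (by positivity)]
        exact hal n x y
    have hLb : LipschitzWith (l * ε n).toNNReal (b n) :=
      LipschitzWith.of_dist_le_mul fun x y => by
        rw [Real.dist_eq, dist_eq_norm, Real.coe_toNNReal _ (by positivity)]
        exact hbl n x y
    have hbw : ∀ y, ‖a n y * fderiv ℝ (b n) y (w y)‖ ≤ l * ε n * ‖w y‖ := fun y => by
      rw [norm_mul, Real.norm_of_nonneg (ha0 n y)]
      refine (mul_le_of_le_one_left (norm_nonneg _) (ha1 n y)).trans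
        ((ContinuousLinearMap.le_opNorm _ _).trans (mul_le_mul_of_nonneg_right ?_ (norm_nonneg _)))
      have := norm_fderiv_le_of_lipschitz ℝ hLb (x₀ := y)
      rwa [Real.coe_toNNReal _ (by positivity)] at this
    have i1 : Integrable (fun y => fderiv ℝ (a n) y (w y)) :=
      (hwi.norm.const_mul _).mono' (aestronglyMeasurable_fderiv_apply hwi.1) (.of_forall fun y =>
        (ContinuousLinearMap.le_opNorm _ _).trans (mul_le_mul_of_nonneg_right
          (norm_fderiv_le_of_lipschitz ℝ hLa) (norm_nonneg _)))
    have i2 : Integrable (fun y => a n y * fderiv ℝ (b n) y (w y)) :=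
      (hwi.norm.const_mul _).mono' ((had n).continuous.aestronglyMeasurable.mul
        (aestronglyMeasurable_fderiv_apply hwi.1)) (.of_forall hbw)
    simp only [hfχ]
    rw [integral_add i1 i2, add_sub_cancel_left]
    refine (norm_integral_le_integral_norm _).trans ?_
    rw [← integral_const_mul]
    exact integral_mono i2.norm (hwi.norm.const_mul _) hbw
  have hfin := hdiff.add hflux
  simp only [Function.comp_apply, sub_add_cancel, zero_add] at hfin
  -- What remains is outer minus inner flux of `p u`: continuity of `u · ν` factors out the pressure
  -- jump, which is the curvature, with a minus sign.
  rw [tendsto_nhds_unique hlim hfin]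
  have k1 := continuous_of_tendsto_prod hti
  have k2 := continuous_of_tendsto_prod hto
  have k3 := hc.continuous_deriv
  have k4 := hc.continuous_normal
  rw [← intervalIntegral.integral_add, ← intervalIntegral.integral_neg]
  · congr 1
    ext x
    have e1 := hujump x
    have e2 := hpjump x
    have e3 := hU x
    rw [real_inner_comm] at e3
    rw [real_inner_comm, real_inner_comm (normal c x)] at e1
    rw [inner_smul_right, inner_smul_right, ← e2, e3,
      show (inner ℝ (normal c x) (uo x) : ℝ) = inner ℝ (normal c x) (ui x) by linarith]
    ring
  · exact Continuous.intervalIntegrable (continuous_const.mul (k3.norm.mul (k4.inner k2))) _ _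
  · exact Continuous.intervalIntegrable (continuous_const.mul (k3.norm.mul (k4.inner k1))) _ _

/-! ### First variation of length -/

theorem rot_rot (v : Plane) : rot (rot v) = -v := by
  ext i
  fin_cases i <;> simp [rot_apply]

theorem IsC2Jordan.hasDerivAt_tangent {c : ℝ → Plane} (hc : IsC2Jordan c) (x : ℝ) :
    HasDerivAt (tangent c) (-(curvature c x * ‖deriv c x‖) • normal c x) x := by
  have h1 : tangent c = fun y => -rot (normal c y) := by
    ext1 y
    rw [normal_eq, rot_rot, neg_neg]
  have h2 : HasDerivAt (fun y => -rot (normal c y)) _ x :=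
    (rot.hasFDerivAt.comp_hasDerivAt x (hc.hasDerivAt_normal x)).neg
  rw [h1]
  refine h2.congr_deriv ?_
  rw [map_smul, hc.deriv_eq_smul_tangent, map_smul, ← normal_eq, smul_smul, neg_smul,
    ← hc.deriv_eq_smul_tangent]

/-- Integration by parts along a closed curve. -/
theorem IsC2Jordan.integral_inner_tangent {c : ℝ → Plane} (hc : IsC2Jordan c) {d : ℝ → Plane}
    (hd : ContDiff ℝ 1 d) (hper : Function.Periodic d 1) :
    ∫ x in (0:ℝ)..1, (inner ℝ (tangent c x) (deriv d x) : ℝ) =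
      ∫ x in (0:ℝ)..1, curvature c x * ‖deriv c x‖ * inner ℝ (normal c x) (d x) := by
  have k1 := hc.contDiff_tangent.continuous
  have k2 := hd.continuous_deriv le_rfl
  have k3 := hc.continuous_curvature
  have k4 := hc.continuous_deriv
  have k5 := hc.continuous_normal
  have k6 := hd.continuous
  have i1 : IntervalIntegrable (fun x => (inner ℝ (tangent c x) (deriv d x) : ℝ)) volume 0 1 :=
    (k1.inner k2).intervalIntegrable _ _
  have i2 : IntervalIntegrable (fun x => curvature c x * ‖deriv c x‖ * inner ℝ (normal c x) (d x))
      volume 0 1 := ((k3.mul k4.norm).mul (k5.inner k6)).intervalIntegrable _ _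
  -- By `τ' = -κ|c'| ν`, the difference of the two integrands is the derivative of the periodic
  -- function `τ · d`.
  have h : ∀ x ∈ uIcc (0:ℝ) 1, HasDerivAt (fun x => (inner ℝ (tangent c x) (d x) : ℝ))
      (inner ℝ (tangent c x) (deriv d x) - curvature c x * ‖deriv c x‖ * inner ℝ (normal c x) (d x)) x := by
    intro x _
    refine ((hc.hasDerivAt_tangent x).inner ℝ
      (hd.differentiable one_ne_zero x).hasDerivAt).congr_deriv ?_
    rw [inner_smul_left]
    simp
    ring
  have h1 := intervalIntegral.integral_eq_sub_of_hasDerivAt h (i1.sub i2)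
  rw [intervalIntegral.integral_sub i1 i2] at h1
  have h2 : tangent c 1 = tangent c 0 := by
    simp only [tangent]
    rw [← zero_add (1:ℝ), hc.deriv_periodic]
  have h3 : d 1 = d 0 := by rw [← zero_add (1:ℝ), hper]
  rw [h2, h3, sub_self] at h1
  linarith

namespace IsEvolution

variable {T : ℝ} {γ : ℝ → ℝ → Plane} {u : ℝ → Plane → Plane} {p : ℝ → Plane → ℝ}
  (hev : IsEvolution T γ u p)
include hev

theorem continuousOn_normal :
    ContinuousOn (fun q : ℝ × ℝ => normal (γ q.1) q.2) (Ico 0 T ×ˢ univ) :=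
  rot.continuous.comp_continuousOn ((hev.cont_deriv.norm.inv₀ fun q hq =>
    ((hev.jordan q.1 hq.1).norm_deriv_pos q.2).ne').smul hev.cont_deriv)

theorem continuousOn_weight :
    ContinuousOn (fun q : ℝ × ℝ => curvature (γ q.1) q.2 * ‖deriv (γ q.1) q.2‖)
      (Ico 0 T ×ˢ univ) := by
  unfold curvature
  exact (((hev.continuousOn_normal.inner hev.cont_deriv2).neg).div (hev.cont_deriv.norm.pow 2)
    fun q hq => pow_ne_zero 2 ((hev.jordan q.1 hq.1).norm_deriv_pos q.2).ne').mul hev.cont_deriv.norm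

/-- Used with `ρ` constantly `t` and with `ρ` the identity: the geometric weights of the lower and
the upper bound for the length increment are taken at different times, yet the limits agree.
Domination comes from the mean value inequality in time and compactness. -/
theorem tendsto_quotient {t : ℝ} (ht : t ∈ Ico 0 T) {ρ : ℝ → ℝ}
    (hρ : Tendsto ρ (𝓝[Ico 0 T \ {t}] t) (𝓝[Ico 0 T] t)) :
    Tendsto (fun s => (s - t)⁻¹ * ∫ x in (0:ℝ)..1, curvature (γ (ρ s)) x * ‖deriv (γ (ρ s)) x‖ *
        inner ℝ (normal (γ (ρ s)) x) (γ s x - γ t x)) (𝓝[Ico 0 T \ {t}] t)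
      (𝓝 (∫ x in (0:ℝ)..1, curvature (γ t) x * ‖deriv (γ t) x‖ *
        inner ℝ (normal (γ t) x) (timeDeriv T γ t x))) := by
  obtain ⟨T', htT', hT'⟩ := exists_between ht.2
  have hKsub : Icc 0 T' ⊆ Ico 0 T := fun s hs => ⟨hs.1, hs.2.trans_lt hT'⟩
  have hKc : IsCompact (Icc 0 T' ×ˢ Icc (0:ℝ) 1) := isCompact_Icc.prod isCompact_Icc
  have hsub : Icc 0 T' ×ˢ Icc (0:ℝ) 1 ⊆ Ico 0 T ×ˢ univ := prod_mono hKsub (subset_univ _)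
  obtain ⟨M, hM⟩ := hKc.exists_bound_of_continuousOn (hev.cont_time.mono hsub)
  obtain ⟨W, hW⟩ := hKc.exists_bound_of_continuousOn (hev.continuousOn_weight.mono hsub)
  have hnhds : Icc 0 T' ∈ 𝓝[Ico 0 T] t := by
    filter_upwards [self_mem_nhdsWithin, mem_nhdsWithin_of_mem_nhds (gt_mem_nhds htT')] with s h1 h2
    exact ⟨h1.1, le_of_lt h2⟩
  have hle : 𝓝[Ico 0 T \ {t}] t ≤ 𝓝[Ico 0 T] t := nhdsWithin_mono _ sdiff_subset
  have hevρ : ∀ᶠ s in 𝓝[Ico 0 T \ {t}] t, ρ s ∈ Icc 0 T' := hρ hnhds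
  have hevs : ∀ᶠ s in 𝓝[Ico 0 T \ {t}] t, s ∈ Icc 0 T' := hle hnhds
  have hne : ∀ᶠ s in 𝓝[Ico 0 T \ {t}] t, s ≠ t := by
    filter_upwards [self_mem_nhdsWithin] with s hs using hs.2
  have htK : t ∈ Icc 0 T' := ⟨ht.1, htT'.le⟩
  have hMV : ∀ s ∈ Icc 0 T', ∀ x ∈ Icc (0:ℝ) 1, ‖γ s x - γ t x‖ ≤ M * |s - t| := by
    intro s hs x hx
    exact Convex.norm_image_sub_le_of_norm_hasDerivWithin_le (s := Icc 0 T')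
      (f := fun s => γ s x) (f' := fun s => timeDeriv T γ s x)
      (fun r hr => ((hev.diff_time r (hKsub hr) x).hasDerivWithinAt).mono hKsub)
      (fun r hr => hM (r, x) ⟨hr, hx⟩) (convex_Icc _ _) htK hs
  simp only [← intervalIntegral.integral_const_mul]
  refine intervalIntegral.tendsto_integral_filter_of_dominated_convergence (fun _ => W * M) ?_ ?_ ?_ ?_
  · filter_upwards [hevρ, hevs] with s h1 h2
    have j1 := hev.jordan _ (hKsub h1)
    have j2 := (hev.jordan _ (hKsub h2)).differentiable.continuous
    have j3 := (hev.jordan _ ht).differentiable.continuous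
    exact (continuous_const.mul ((j1.continuous_curvature.mul j1.continuous_deriv.norm).mul
      (j1.continuous_normal.inner (j2.sub j3)))).aestronglyMeasurable
  · filter_upwards [hevρ, hevs, hne] with s h1 h2 h3
    refine .of_forall fun x hx => ?_
    rw [uIoc_of_le zero_le_one] at hx
    have hx' : x ∈ Icc (0:ℝ) 1 := ⟨hx.1.le, hx.2⟩
    have b1 : |curvature (γ (ρ s)) x * ‖deriv (γ (ρ s)) x‖| ≤ W := hW (ρ s, x) ⟨h1, hx'⟩
    have b2 := hMV s h2 x hx'
    have b3 := abs_real_inner_le_norm (normal (γ (ρ s)) x) (γ s x - γ t x)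
    rw [(hev.jordan _ (hKsub h1)).norm_normal, one_mul] at b3
    have h4 : 0 < |s - t| := abs_pos.2 (sub_ne_zero.2 h3)
    rw [norm_mul, norm_mul, norm_inv, Real.norm_eq_abs, Real.norm_eq_abs, Real.norm_eq_abs,
      inv_mul_le_iff₀ h4]
    calc _ ≤ W * (M * |s - t|) := mul_le_mul b1 (b3.trans b2) (abs_nonneg _) ((abs_nonneg _).trans b1)
      _ = _ := by ring
  · exact intervalIntegrable_const
  · refine .of_forall fun x _ => ?_
    have hpair : Tendsto (fun s => (ρ s, x)) (𝓝[Ico 0 T \ {t}] t) (𝓝[Ico 0 T ×ˢ univ] (t, x)) := by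
      rw [nhdsWithin_prod_eq]
      refine hρ.prodMk ?_
      rw [nhdsWithin_univ]
      exact tendsto_const_nhds
    have t1 := (hev.continuousOn_weight (t, x) ⟨ht, trivial⟩).tendsto.comp hpair
    have t2 := (hev.continuousOn_normal (t, x) ⟨ht, trivial⟩).tendsto.comp hpair
    have t3 : Tendsto (fun s => (s - t)⁻¹ • (γ s x - γ t x)) (𝓝[Ico 0 T \ {t}] t)
        (𝓝 (timeDeriv T γ t x)) := by
      have := hasDerivWithinAt_iff_tendsto_slope.1 (hev.diff_time t ht x).hasDerivWithinAt
      exact this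
    refine (t1.mul (t2.inner (𝕜 := ℝ) t3)).congr fun s => ?_
    simp only [Function.comp_apply, inner_smul_right]
    ring

/-- As `τ` is a unit vector, `τ_t · (∂ₓγ_s - ∂ₓγ_t) ≤ |∂ₓγ_s| - |∂ₓγ_t| ≤ τ_s · (∂ₓγ_s - ∂ₓγ_t)`.
Integration by parts puts the space derivative on the tangent, so only `γ_s - γ_t` itself is divided
by `s - t`, and the quotient is squeezed. -/
theorem hasDerivWithinAt_length {t : ℝ} (ht : t ∈ Ico 0 T) :
    HasDerivWithinAt (fun s => length (γ s))
      (∫ x in (0:ℝ)..1, curvature (γ t) x * ‖deriv (γ t) x‖ *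
        inner ℝ (normal (γ t) x) (timeDeriv T γ t x)) (Ico 0 T) t := by
  set I := ∫ x in (0:ℝ)..1, curvature (γ t) x * ‖deriv (γ t) x‖ *
        inner ℝ (normal (γ t) x) (timeDeriv T γ t x) with hI
  have hle : 𝓝[Ico 0 T \ {t}] t ≤ 𝓝[Ico 0 T] t := nhdsWithin_mono _ sdiff_subset
  have h1 := hev.tendsto_quotient ht (ρ := fun _ => t)
    (tendsto_const_pure.mono_right (pure_le_nhdsWithin ht))
  have h2 := hev.tendsto_quotient ht (ρ := id) (tendsto_id.mono_right hle)
  rw [← hI] at h1 h2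
  simp only [id] at h2
  rw [hasDerivWithinAt_iff_tendsto_slope, tendsto_iff_dist_tendsto_zero]
  have h3 := (tendsto_iff_dist_tendsto_zero.1 h1).add (tendsto_iff_dist_tendsto_zero.1 h2)
  rw [add_zero] at h3
  refine squeeze_zero' (.of_forall fun _ => dist_nonneg) ?_ h3
  filter_upwards [self_mem_nhdsWithin] with s hs
  have js := hev.jordan s hs.1
  have jt := hev.jordan t ht
  have hd : ContDiff ℝ 1 (fun x => γ s x - γ t x) :=
    (js.contDiff.sub jt.contDiff).of_le (by norm_num)
  have hper : Function.Periodic (fun x => γ s x - γ t x) 1 := fun x => by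
    simp only [js.periodic x, jt.periodic x]
  have hder : ∀ x, deriv (fun x => γ s x - γ t x) x = deriv (γ s) x - deriv (γ t) x := fun x =>
    deriv_fun_sub (js.differentiable x) (jt.differentiable x)
  have e1 := jt.integral_inner_tangent hd hper
  have e2 := js.integral_inner_tangent hd hper
  have e3 : length (γ s) - length (γ t) = ∫ x in (0:ℝ)..1, (‖deriv (γ s) x‖ - ‖deriv (γ t) x‖) :=
    (intervalIntegral.integral_sub (js.continuous_deriv.norm.intervalIntegrable _ _)
      (jt.continuous_deriv.norm.intervalIntegrable _ _)).symm
  have hself : ∀ {c : ℝ → Plane}, IsC2Jordan c → ∀ x, (inner ℝ (tangent c x) (deriv c x) : ℝ) =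
      ‖deriv c x‖ := by
    intro c hc x
    conv_lhs => rw [hc.deriv_eq_smul_tangent]
    rw [inner_smul_right, real_inner_self_eq_norm_sq, hc.norm_tangent, one_pow, mul_one]
  have hCS : ∀ {c : ℝ → Plane}, IsC2Jordan c → ∀ x v, (inner ℝ (tangent c x) v : ℝ) ≤ ‖v‖ := by
    intro c hc x v
    have := real_inner_le_norm (tangent c x) v
    rwa [hc.norm_tangent, one_mul] at this
  have hdc := hd.continuous_deriv le_rfl
  have hcd : Continuous fun x => ‖deriv (γ s) x‖ - ‖deriv (γ t) x‖ :=
    js.continuous_deriv.norm.sub jt.continuous_deriv.norm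
  have l1 : ∫ x in (0:ℝ)..1, (inner ℝ (tangent (γ t) x) (deriv (fun x => γ s x - γ t x) x) : ℝ) ≤
      length (γ s) - length (γ t) := by
    rw [e3]
    refine intervalIntegral.integral_mono_on zero_le_one
      ((jt.contDiff_tangent.continuous.inner hdc).intervalIntegrable _ _)
      (hcd.intervalIntegrable _ _) fun x _ => ?_
    rw [hder, inner_sub_right, hself jt]
    linarith [hCS jt x (deriv (γ s) x)]
  have l2 : length (γ s) - length (γ t) ≤
      ∫ x in (0:ℝ)..1, (inner ℝ (tangent (γ s) x) (deriv (fun x => γ s x - γ t x) x) : ℝ) := by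
    rw [e3]
    refine intervalIntegral.integral_mono_on zero_le_one (hcd.intervalIntegrable _ _)
      ((js.contDiff_tangent.continuous.inner hdc).intervalIntegrable _ _) fun x _ => ?_
    rw [hder, inner_sub_right, hself js]
    linarith [hCS js x (deriv (γ t) x)]
  rw [e1] at l1
  rw [e2] at l2
  have hne : s - t ≠ 0 := sub_ne_zero.2 hs.2
  rw [slope_def_field, div_eq_inv_mul]
  generalize (∫ x in (0:ℝ)..1, curvature (γ t) x * ‖deriv (γ t) x‖ *
    inner ℝ (normal (γ t) x) (γ s x - γ t x) : ℝ) = A at l1 ⊢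
  generalize (∫ x in (0:ℝ)..1, curvature (γ s) x * ‖deriv (γ s) x‖ *
    inner ℝ (normal (γ s) x) (γ s x - γ t x) : ℝ) = B at l2 ⊢
  generalize length (γ s) - length (γ t) = D at l1 l2 ⊢
  simp only [Real.dist_eq]
  have a1 := le_abs_self ((s - t)⁻¹ * A - I)
  have a2 := neg_abs_le ((s - t)⁻¹ * A - I)
  have a3 := le_abs_self ((s - t)⁻¹ * B - I)
  have a4 := neg_abs_le ((s - t)⁻¹ * B - I)
  have a5 := abs_nonneg ((s - t)⁻¹ * A - I)
  have a6 := abs_nonneg ((s - t)⁻¹ * B - I)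
  -- For `s < t` division by `s - t` interchanges the two bounds, but the quotient still lies
  -- between them; its distance to `I` is at most the sum of both errors.
  rcases lt_or_gt_of_ne hne with h | h
  · have m1 := mul_le_mul_of_nonpos_left l1 (inv_lt_zero.2 h).le
    have m2 := mul_le_mul_of_nonpos_left l2 (inv_lt_zero.2 h).le
    rw [abs_le]
    constructor <;> linarith
  · have m1 := mul_le_mul_of_nonneg_left l1 (inv_pos.2 h).le
    have m2 := mul_le_mul_of_nonneg_left l2 (inv_pos.2 h).le
    rw [abs_le]
    constructor <;> linarith

end IsEvolution

/-! ### Strict decrease of the length -/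

/-- The weight `2π|ξ|` vanishes only at the origin, so the transform of `u` is zero almost
everywhere, and Plancherel applies. -/
theorem ae_eq_zero_of_dirichletEnergy_eq_zero {u : Plane → Plane} (hu : MemLp u 2)
    (h : dirichletEnergy u = 0) : u =ᵐ[volume] 0 := by
  have hu' := memLp_complexify hu
  have hm : AEMeasurable (fun ξ => ENNReal.ofReal (2 * Real.pi * ‖ξ‖) * ‖hat hu' ξ‖ₑ ^ 2) volume :=
    (show Measurable fun ξ : Plane => ENNReal.ofReal (2 * Real.pi * ‖ξ‖) by fun_prop).aemeasurable.mul
      ((Lp.aestronglyMeasurable _).enorm.pow_const 2)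
  rw [dirichletEnergy_eq hu', lintegral_eq_zero_iff' hm] at h
  have h0 : ∀ᵐ ξ : Plane, ξ ≠ 0 := by
    simp [ae_iff]
  have h1 : (fun ξ => ‖hat hu' ξ‖ ^ 2) =ᵐ[volume] 0 := by
    filter_upwards [h, h0] with ξ h2 h3
    have h4 : 0 < 2 * Real.pi * ‖ξ‖ := by
      have := norm_pos_iff.2 h3
      positivity
    simp only [Pi.zero_apply, mul_eq_zero, ENNReal.ofReal_eq_zero, not_le.2 h4, false_or] at h2
    have h5 : hat hu' ξ = 0 := by simpa using h2
    simp [h5]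
  have h2 : ∫ x, ‖u x‖ ^ 2 = 0 := by
    rw [integral_norm_sq_eq hu', integral_congr_ae h1]
    simp
  rw [integral_eq_zero_iff_of_nonneg (fun x => by positivity) (hu.integrable_norm_pow (by norm_num))] at h2
  filter_upwards [h2] with x hx
  simpa using hx

/-- A field vanishing almost everywhere vanishes at every point of the open complement of the curve,
by continuity there. -/
theorem IsState.dirichletEnergy_pos {c : ℝ → Plane} {u : Plane → Plane} {p : Plane → ℝ}
    {U : ℝ → ℝ} (hc : IsC2Jordan c) (hs : IsState c u p U) (h : ∃ x ∉ range c, u x ≠ 0) :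
    0 < (dirichletEnergy u).toReal := by
  obtain ⟨x, hx, hux⟩ := h
  refine ENNReal.toReal_pos (fun h0 => hux ?_) hs.finite_energy.ne
  have h1 := ae_eq_zero_of_dirichletEnergy_eq_zero (hs.exists_bounds hc).1 h0
  exact Measure.eqOn_open_of_ae_eq (ae_restrict_of_ae h1)
    hc.isCompact_range.isClosed.isOpen_compl hs.u_contDiffOn.continuousOn continuousOn_const hx

theorem IsEvolution.hasDerivWithinAt_length_energy {T : ℝ} {γ : ℝ → ℝ → Plane}
    {u : ℝ → Plane → Plane} {p : ℝ → Plane → ℝ} (hev : IsEvolution T γ u p) {t : ℝ}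
    (ht : t ∈ Ico 0 T) :
    HasDerivWithinAt (fun s => length (γ s)) (-(dirichletEnergy (u t)).toReal) (Ico 0 T) t := by
  refine (hev.hasDerivWithinAt_length ht).congr_deriv ?_
  rw [(hev.state t ht).toReal_dirichletEnergy (hev.jordan t ht), neg_neg]
  refine intervalIntegral.integral_congr fun x _ => ?_
  rw [real_inner_comm]
  ring

/-- The length is nonincreasing. Equal values at `s` and `t` would make it constant in between, with
zero derivative within `[s, t]` at `r`; but this derivative is minus the energy at `r`, which is
positive. One-sided derivatives cover the case where `r` is an endpoint. -/
theorem IsEvolution.length_lt {T : ℝ} {γ : ℝ → ℝ → Plane}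
    {u : ℝ → Plane → Plane} {p : ℝ → Plane → ℝ} (hev : IsEvolution T γ u p) {s t r : ℝ}
    (hs : s ∈ Ico 0 T) (ht : t ∈ Ico 0 T) (hst : s < t) (hr : r ∈ Icc s t)
    (hu : ∃ x ∉ range (γ r), u r x ≠ 0) : length (γ t) < length (γ s) := by
  have hsub : Icc s t ⊆ Ico 0 T := fun z hz => ⟨hs.1.trans hz.1, hz.2.trans_lt ht.2⟩
  have hanti : AntitoneOn (fun z => length (γ z)) (Ico 0 T) := by
    have hd : ∀ z ∈ interior (Ico 0 T), HasDerivAt (fun z => length (γ z))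
        (-(dirichletEnergy (u z)).toReal) z := fun z hz =>
      (hev.hasDerivWithinAt_length_energy (interior_subset hz)).hasDerivAt
        (mem_interior_iff_mem_nhds.1 hz)
    refine antitoneOn_of_deriv_nonpos (convex_Ico 0 T)
      (fun z hz => (hev.hasDerivWithinAt_length_energy hz).continuousWithinAt)
      (fun z hz => (hd z hz).differentiableAt.differentiableWithinAt) fun z hz => ?_
    rw [(hd z hz).deriv, neg_nonpos]
    exact ENNReal.toReal_nonneg
  refine (hanti hs ht hst.le).lt_of_ne fun heq => ?_
  have hconst : ∀ z ∈ Icc s t, length (γ z) = length (γ s) := fun z hz =>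
    le_antisymm (hanti hs (hsub hz) hz.1) (heq.symm.trans_le (hanti (hsub hz) ht hz.2))
  have h1 := (hev.hasDerivWithinAt_length_energy (hsub hr)).mono hsub
  have h2 : HasDerivWithinAt (fun z => length (γ z)) 0 (Icc s t) r :=
    (hasDerivWithinAt_const r (Icc s t) (length (γ s))).congr hconst (hconst r hr)
  have h3 := (uniqueDiffOn_Icc hst r hr).eq_deriv _ h1 h2
  have h4 := (hev.state r (hsub hr)).dirichletEnergy_pos (hev.jordan r (hsub hr)) hu
  linarith

end ILLSS

end
-- Assembly of the three identities
theorem proposition3p7 (T : ℝ) (γ : ℝ → ℝ → ILLSS.Plane) (u : ℝ → ILLSS.Plane → ILLSS.Plane)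
    (p : ℝ → ILLSS.Plane → ℝ) (h : ILLSS.IsEvolution T γ u p) :
    (∀ t ∈ Set.Ico 0 T, ∃ hu : MeasureTheory.MemLp (ILLSS.complexify (u t)) 2 MeasureTheory.volume,
      ILLSS.hDotNorm (1 / 2) hu.toLp < ⊤ ∧
      HasDerivWithinAt (fun s => ILLSS.length (γ s))
        (-(1 / (2 * Real.pi) ^ 2) * (ILLSS.hDotNorm (1 / 2) hu.toLp).toReal ^ 2)
        (Set.Ico 0 T) t) ∧
    (∀ t ∈ Set.Ico 0 T, (∃ x ∉ Set.range (γ t), u t x ≠ 0) →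
      derivWithin (fun s => ILLSS.length (γ s)) (Set.Ico 0 T) t < 0) ∧
    (∀ s ∈ Set.Ico 0 T, ∀ t ∈ Set.Ico 0 T, s < t →
      (∃ r ∈ Set.Icc s t, ∃ x ∉ Set.range (γ r), u r x ≠ 0) →
      ILLSS.length (γ t) < ILLSS.length (γ s)) := by
  refine ⟨fun t ht => ?_, fun t ht hu => ?_, fun s hs t ht hst ⟨r, hr, hu⟩ =>
    h.length_lt hs ht hst hr hu⟩
  · have hst := h.state t ht
    have hu := ILLSS.memLp_complexify (hst.exists_bounds (h.jordan t ht)).1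
    have hsq := ILLSS.hDotNorm_half_sq hu
    refine ⟨hu, ?_, (h.hasDerivWithinAt_length_energy ht).congr_deriv ?_⟩
    · have h1 : ILLSS.hDotNorm (1 / 2) hu.toLp ^ 2 < ⊤ := by
        rw [hsq]
        exact ENNReal.mul_lt_top ENNReal.ofReal_lt_top hst.finite_energy
      exact (ENNReal.pow_lt_top_iff.1 h1).resolve_right two_ne_zero
    -- The factor `(2π)²` between the squared norm and the Dirichlet energy cancels the prefactor of
    -- the claim.
    · rw [← ENNReal.toReal_pow, hsq, ENNReal.toReal_mul, ENNReal.toReal_ofReal (by positivity)]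
      have := Real.pi_ne_zero
      field_simp
  · rw [(h.hasDerivWithinAt_length_energy ht).derivWithin
      (uniqueDiffOn_Ico 0 T t ht), neg_lt_zero]
    exact (h.state t ht).dirichletEnergy_pos (h.jordan t ht) hu
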